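/- Let $d\ge 1$ be an integer, let $0<\alpha<1$, and let $\mathbb B$ be the regular $d$-ary rooted tree, with $|x|$ the generation of a vertex $x$, $0$ the root, and $x\le y$ meaning that $x$ is an ancestor of $y$ or $x=y$. Let $(U_x)_{x\in\mathbb B}$ be i.i.d. exponential random variables of mean $1$ on a probability space $(\Omega,\mathcal F,\mathbb P)$. Put $T(x)=\sum_{y\le x}\alpha^{|y|}U_y$ and $C(t)=\{x:T(x)\le t\}$; let $T(\infty)$ be the limit as $n\to\infty$ of the first time at which $C(t)$ has $n$ elements, and put $A_\infty=\{x:T(x)<T(\infty)\}$. For a vertex $x$ let $$T(x,\infty)=\lim_{n\to\infty}\min\{T(y)-T(x): y\ge x,\ |y|=n\},\qquad W(x)=\alpha^{-|x|-1}T(x,\infty).$$ Almost surely $A_\infty$ contains a unique infinite line of descent $(\xi_n)_{n\ge 0}$ from the root (the backbone: $|\xi_n|=n$ and $\xi_n$ is the parent of $\xi_{n+1}$), and the backbone times $W_n=W(\xi_n)$ are finite and positive for all $n\ge0$. Let $\Lambda(A)=\mathbb E[e^{\alpha W_0}1(W_0\in A)]/\mathbb E[e^{\alpha W_0}]$. Let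 $\bar{\mathcal F}_x$ be the $\sigma$-field generated by $W(x)$ and all $U_z$ with $z$ not a strict descendant of $x$, and let $\mathcal W_n$ be the $\sigma$-field of the events $A\in\mathcal F$ such that, for every vertex $x$ of generation $n$, $A\cap\{\xi_n=x\}=B\cap\{\xi_n=x\}$ for some $B\in\bar{\mathcal F}_x$. Then: 1. $(W_n)_{n\ge0}$ is a Markov chain with respect to the filtration $(\mathcal W_n)$, with transition kernel $p(\cdot\,|\,w)=\Lambda(\cdot\,|\,(0,w/\alpha))$: for every Borel set $B$, $\mathbb P(W_{n+1}\in B\mid\mathcal W_n)=p(B\,|\,W_n)$ a.s. 2. $(W_n)$ is stochastically non-increasing: $\mathbb E\,\psi(W_{n+1})\le\mathbb E\,\psi(W_n)$ for all $n$ and all bounded measurable non-decreasing $\psi:\mathbb R\to\mathbb R$. 3. There is a probability law $\pi$ on $(0,\infty)$, depending only on $d$ and $\alpha$, such that $W_n$ converges in distribution to $\pi$ and $\pi$ is stationary for $p$. It is the unique stationary probability law for $p$ on $(0,\infty)$. The stationary chain (the Markov chain with transition kernel $p$ and initial law $\pi$) exists and is ergodic: the shift on $\mathbb R^{\{0,1,2,\dots\}}$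 is ergodic for its law. 4. For every real $p>0$ there is a constant $c(p)>0$, depending only on $d,\alpha,p$, with $\pi((0,w])\le c(p)\,w^p$ for all $w\ge0$; and there is a constant $c>0$, depending only on $d,\alpha$, with $\pi([w,\infty))\le c\,e^{-dw}$ for all $w\ge0$. -/

import Mathlib

open MeasureTheory ProbabilityTheory Filter Topology
open scoped ENNReal

noncomputable section

namespace TreeDLA

/-! ### First-passage percolation on the regular `d`-ary tree

Vertices are finite words over `Fin d`; the root is `[]`, the generation of `x` is `x.length`, the
ancestors of `x` (including `x`) are the prefixes of `x`, and the descendants of `x` in the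
subtree of `x` are the words `x ++ z`. -/

/-- Vertices of the regular `d`-ary rooted tree. -/
abbrev Vertex (d : ℕ) : Type := List (Fin d)

variable {d : ℕ}

/-- The percolation time `T(x) = ∑_{y ≤ x} α^{|y|} u_y`, the sum running over all ancestors of
`x` including the root and `x` itself. (The weights are non-negative in all applications;
`ENNReal.ofReal` only records that the value lies in `[0, ∞]`.) -/
def passageTime (α : ℝ) (u : Vertex d → ℝ) (x : Vertex d) : ℝ≥0∞ :=
  ∑ k ∈ Finset.range (x.length + 1), ENNReal.ofReal (α ^ k * u (x.take k))

/-- The set `C(t)` of vertices that are wet at time `t`. -/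
def wetCluster (α : ℝ) (u : Vertex d → ℝ) (t : ℝ≥0∞) : Set (Vertex d) :=
  {x | passageTime α u x ≤ t}

/-- The time at which the wet cluster reaches size `n`. -/
def growTime (α : ℝ) (u : Vertex d → ℝ) (n : ℕ) : ℝ≥0∞ :=
  sInf {t | (n : ℕ∞) ≤ (wetCluster α u t).encard}

/-- `T(∞)`, the limit of the (non-decreasing) growth times. -/
def timeToInfinity (α : ℝ) (u : Vertex d → ℝ) : ℝ≥0∞ :=
  ⨆ n, growTime α u n

/-- The infinite cluster `A_∞ = {x : T(x) < T(∞)}`. -/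
def infiniteCluster (α : ℝ) (u : Vertex d → ℝ) : Set (Vertex d) :=
  {x | passageTime α u x < timeToInfinity α u}

/-- `T(x, ∞)`: the limit as `n → ∞` of the (non-decreasing in `n`) minimum of `T(y) - T(x)` over
the descendants `y` of `x` that are `n` generations below `x`. -/
def timeFrom (α : ℝ) (u : Vertex d → ℝ) (x : Vertex d) : ℝ≥0∞ :=
  ⨆ n : ℕ, ⨅ z : Vertex d, ⨅ _ : z.length = n,
    (passageTime α u (x ++ z) - passageTime α u x)

/-- The rescaled time `W(x) = T(x, ∞) α^{-|x|-1}`. -/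
def scaledTime (α : ℝ) (u : Vertex d → ℝ) (x : Vertex d) : ℝ≥0∞ :=
  timeFrom α u x / ENNReal.ofReal (α ^ (x.length + 1))

/-- `ξ` is an infinite line of descent in `A_∞`: `ξ n` is a vertex of generation `n` in `A_∞`,
and `ξ n` is the parent of `ξ (n + 1)`. -/
def IsLineOfDescent (α : ℝ) (u : Vertex d → ℝ) (ξ : ℕ → Vertex d) : Prop :=
  ∀ n, (ξ n).length = n ∧ ξ n ∈ infiniteCluster α u ∧ ξ n = (ξ (n + 1)).dropLast

open Classical in
/-- The backbone: the unique infinite line of descent in `A_∞`. Where there is none, or more than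
one, every term is set to be the root. -/
def backbone (α : ℝ) (u : Vertex d → ℝ) : ℕ → Vertex d :=
  if h : ∃! ξ : ℕ → Vertex d, IsLineOfDescent α u ξ then h.choose else fun _ => []

/-- The rescaled time `W_n` to percolate along the backbone from generation `n` to infinity. -/
def backboneTime (α : ℝ) (u : Vertex d → ℝ) (n : ℕ) : ℝ :=
  (scaledTime α u (backbone α u n)).toReal

/-! ### The random environment and the filtration -/

section Random

variable {Ω : Type*} [mΩ : MeasurableSpace Ω]

/-- `U` is a family of independent, mean one exponential random variables indexed by the
vertices. -/
structure IsExpEnvironment (U : Vertex d → Ω → ℝ) (P : Measure Ω) : Prop where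
  measurable : ∀ x, Measurable (U x)
  indep : iIndepFun U P
  law : ∀ x, P.map (U x) = expMeasure 1

/-- The random variables `W_n`. -/
def W (α : ℝ) (U : Vertex d → Ω → ℝ) (n : ℕ) (ω : Ω) : ℝ :=
  backboneTime α (fun x => U x ω) n

/-- The wide sense past of `x`, generated by all `U_z` with `z` not a strict descendant of `x`. -/
@[reducible] def widePast (U : Vertex d → Ω → ℝ) (x : Vertex d) : MeasurableSpace Ω :=
  ⨆ z ∈ {z : Vertex d | ¬ (x <+: z ∧ z ≠ x)}, MeasurableSpace.comap (U z) inferInstance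

/-- The wide sense past of `x` together with `W(x)`. -/
@[reducible] def widePastTime (α : ℝ) (U : Vertex d → Ω → ℝ) (x : Vertex d) : MeasurableSpace Ω :=
  widePast U x ⊔ MeasurableSpace.comap (fun ω => scaledTime α (fun z => U z ω) x) inferInstance

/-- The `σ`-field `𝒲_n` of the past of the `n`-th backbone vertex: the events `A` whose trace on
`{ξ_n = x}` is, for each `x` in generation `n`, the trace of an event of `widePastTime α U x`.
(Up to a null set, `{ξ_n = x}` is itself in `widePastTime α U x`, so that this says
`A ∩ {ξ_n = x} ∈ widePastTime α U x`.) -/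
@[reducible] def backbonePast (α : ℝ) (U : Vertex d → Ω → ℝ) (n : ℕ) : MeasurableSpace Ω where
  MeasurableSet' A := MeasurableSet A ∧ ∀ x : Vertex d, x.length = n →
    ∃ B, MeasurableSet[widePastTime α U x] B ∧
      A ∩ {ω | backbone α (fun z => U z ω) n = x} = B ∩ {ω | backbone α (fun z => U z ω) n = x}
  measurableSet_empty := ⟨MeasurableSet.empty, fun _ _ => ⟨∅, MeasurableSpace.measurableSet_empty _, rfl⟩⟩
  measurableSet_compl A hA := by
    refine ⟨hA.1.compl, fun x hx => ?_⟩
    obtain ⟨B, hB, h⟩ := hA.2 x hx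
    refine ⟨Bᶜ, MeasurableSpace.measurableSet_compl _ _ hB, ?_⟩
    ext ω
    have := Set.ext_iff.1 h ω
    simp only [Set.mem_inter_iff, Set.mem_compl_iff] at this ⊢
    tauto
  measurableSet_iUnion f hf := by
    refine ⟨MeasurableSet.iUnion fun i => (hf i).1, fun x hx => ?_⟩
    choose B hB h using fun i => (hf i).2 x hx
    refine ⟨⋃ i, B i, MeasurableSpace.measurableSet_iUnion _ _ hB, ?_⟩
    rw [Set.iUnion_inter, Set.iUnion_inter]
    exact Set.iUnion_congr h

/-- `X` is a real valued Markov chain with respect to the increasing family `ℱ` of `σ`-fields,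
with transition kernel `κ`. -/
structure IsMarkovChain (P : Measure Ω) (ℱ : ℕ → MeasurableSpace Ω) (X : ℕ → Ω → ℝ)
    (κ : Kernel ℝ ℝ) : Prop where
  mono : Monotone ℱ
  le : ∀ n, ℱ n ≤ mΩ
  adapted : ∀ n, Measurable[ℱ n] (X n)
  markov : ∀ (n : ℕ) (B : Set ℝ), MeasurableSet B →
    P⟦X (n + 1) ⁻¹' B | ℱ n⟧ =ᵐ[P] fun ω => (κ (X n ω)).real B

end Random

/-! ### The transition kernel -/

/-- The law `Λ(A) = E[e^{α W} 1(W ∈ A)] / E[e^{α W}]`, where `W` has law `F`. -/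
def tiltedLaw (α : ℝ) (F : Measure ℝ) : Measure ℝ :=
  F.tilted fun w => α * w

/-- The kernel `w ↦ Λ(· | (0, w/α))`. -/
def condKernel (α : ℝ) (L : Measure ℝ) : Kernel ℝ ℝ where
  toFun w := L[|Set.Ioo 0 (w / α)]
  measurable' := by
    have key : ∀ s : Set ℝ, Measurable fun w : ℝ => L (Set.Ioo 0 (w / α) ∩ s) := by
      intro s
      have hm : Monotone fun t : ℝ => L (Set.Ioo 0 t ∩ s) := fun a b hab =>
        measure_mono (Set.inter_subset_inter_left _ (Set.Ioo_subset_Ioo_right hab))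
      exact hm.measurable.comp (measurable_id.div_const α)
    refine Measure.measurable_of_measurable_coe _ fun s _ => ?_
    simp only [ProbabilityTheory.cond_apply measurableSet_Ioo]
    have h1 := key Set.univ
    simp only [Set.inter_univ] at h1
    exact h1.inv.mul (key s)

/-- The transition kernel `w ↦ Λ(· | (0, w/α))`, with `Λ` built from the law of `W_0`. -/
def backboneKernel {Ω : Type*} [MeasurableSpace Ω] (α : ℝ) (U : Vertex d → Ω → ℝ)
    (P : Measure Ω) : Kernel ℝ ℝ :=
  condKernel α (tiltedLaw α (P.map (W α U 0)))

/-! ### Stochastic order and stationary chains -/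

/-- `μ` is stochastically smaller than `ν`. -/
def StochLE (μ ν : Measure ℝ) : Prop :=
  ∀ ψ : ℝ → ℝ, Measurable ψ → Monotone ψ → (∃ C, ∀ x, |ψ x| ≤ C) → ∫ x, ψ x ∂μ ≤ ∫ x, ψ x ∂ν

/-- The law `Q` on path space of a Markov chain with transition kernel `κ` and initial law `μ`,
the chain being considered with respect to its own filtration. -/
structure IsChainLaw (κ : Kernel ℝ ℝ) (μ : Measure ℝ) (Q : Measure (ℕ → ℝ)) : Prop where
  isProbabilityMeasure : IsProbabilityMeasure Q
  initial : Q.map (fun x => x 0) = μ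
  chain : IsMarkovChain Q
    (fun n => ⨆ k ∈ Set.Iic n, MeasurableSpace.comap (fun x : ℕ → ℝ => x k) inferInstance)
    (fun n x => x n) κ

/-- The shift on path space. -/
def shift (x : ℕ → ℝ) : ℕ → ℝ := fun n => x (n + 1)

end TreeDLA

end

open TreeDLA

noncomputable section

namespace TreeDLA

variable {d : ℕ}

/-! The proof rests on one recursion. Since `W(x)` depends only on the weights at strict descendants
of `x`, and through the same functional for every `x` (`scaledTime_eq`), it satisfies `W(x) = min_c
(U_{xc} + α W(xc))` with `d` independent terms (`hitTime_eq`). The law `F` of `W_0` therefore has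
tail equal to the `d`-th power of the tail of the law `G` of `U + α W`; this identity, positivity
and finiteness of `E e^{αW}` are all that the analysis uses (`IsTreeLaw`).

Markov property. `T(∞)` is the least total passage time of an infinite path, and almost surely no
two vertices of one generation share the same total time (`ae_isGeneric`). So the backbone passes
through `y` exactly when the total time of `y` is the smallest in its generation, an event that
involves the subtree of `y` only through `V = U_y + α W(y)`. On it `V` equals `W` at the parent. The
joint law of `(V, W(y))` is `e^{-v} dv · e^{αw} F(dw)` on `αw ≤ v`, so given `V = v` the law of
`W(y)` is `Λ` conditioned on `(0, v/α)` (`map_prod_eq_compProd`), and independence of disjoint sets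
of weights leaves this unchanged by the rest of the past (`measure_inter_W`).

Monotonicity and convergence. The kernel is stochastically monotone, `F` is below `G`, and `G` is
carried to `F` by the kernel; hence the law of `W_1` is below `F`, and induction continues. The
quantile functions of the laws of `W_n` then decrease pointwise, and `π` is the law of their limit.
The exponential tail of `F` passes to `π` by domination.

Escape from zero. The relation between `F` and `G` gains one power at the origin at each use, so the
mass of `e^{αw} F(dw)` near zero decreases faster than every power (`eventually_expWeight_mul_le`).
From a small `w` the next state is then nearly `w/α`, negative moments contract there
(`exists_drift`), and they are bounded along the chain. Fatou's lemma gives the small ball bounds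
for `π` and excludes mass at zero, which makes `π` stationary.

Uniqueness and ergodicity. Any two nonzero invariant measures on `(0, ∞)` dominate a common nonzero
measure (`exists_common_le`). Applied to what remains after removing the infimum of two invariant
laws, this gives uniqueness. An invariant event of the stationary chain is determined by the current
state (`exists_preimage_ae_eq`), so it splits `π` into two mutually singular invariant parts, one of
which must vanish. -/

/-! ### Passage times along a word and the recursion for the rescaled times -/

/-- The passage time to `z`, not counting the root, rescaled by `α⁻¹`. -/
def excess (α : ℝ) : (Vertex d → ℝ) → Vertex d → ℝ≥0∞
  | _, [] => 0
  | u, c :: z => ENNReal.ofReal (u [c]) + ENNReal.ofReal α * excess α (fun y => u (c :: y)) z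

lemma passageTime_ne_top (α : ℝ) (u : Vertex d → ℝ) (x : Vertex d) : passageTime α u x ≠ ∞ := by
  unfold passageTime
  exact ENNReal.sum_ne_top.2 fun _ _ => ENNReal.ofReal_ne_top

lemma passageTime_concat (α : ℝ) (u : Vertex d → ℝ) (x : Vertex d) (c : Fin d) :
    passageTime α u (x ++ [c]) =
      passageTime α u x + ENNReal.ofReal (α ^ (x.length + 1) * u (x ++ [c])) := by
  unfold passageTime
  rw [List.length_append, List.length_singleton, Finset.sum_range_succ]
  congr 1
  · refine Finset.sum_congr rfl fun k hk => ?_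
    rw [List.take_append_of_le_length]
    simp only [Finset.mem_range] at hk
    omega
  · rw [List.take_of_length_le]
    simp

/-- The percolation below `x` is a scaled copy of the percolation from the root in the weights `y ↦
u (x ++ y)`. The exponent `|x| + 1` is that of the first edge below `x`, since the excess omits the
weight at `x` itself. -/
lemma passageTime_append {α : ℝ} (hα : 0 ≤ α) (u : Vertex d → ℝ) (x z : Vertex d) :
    passageTime α u (x ++ z) = passageTime α u x +
      ENNReal.ofReal (α ^ (x.length + 1)) * excess α (fun y => u (x ++ y)) z := by
  induction z generalizing x with
  | nil => simp [excess]
  | cons c z ih =>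
    have h := ih (x ++ [c])
    rw [List.append_assoc, List.singleton_append] at h
    rw [h, passageTime_concat, excess, mul_add, ← ENNReal.ofReal_mul (by positivity), ← mul_assoc,
      ← ENNReal.ofReal_mul (by positivity), ← pow_succ, add_assoc]
    simp

lemma excess_le_append (α : ℝ) (u : Vertex d → ℝ) (x z : Vertex d) :
    excess α u x ≤ excess α u (x ++ z) := by
  induction x generalizing u with
  | nil => simp [excess]
  | cons c x ih =>
    simp only [List.cons_append, excess]
    gcongr
    exact ih _

/-- The least excess in generation `n`. -/
def minExcess (α : ℝ) (u : Vertex d → ℝ) (n : ℕ) : ℝ≥0∞ :=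
  ⨅ z : Vertex d, ⨅ _ : z.length = n, excess α u z

/-- Split a word at its first letter. Multiplication by `α` commutes with the infimum because the
factor is neither `0` nor `∞`. -/
lemma minExcess_succ {α : ℝ} (hα : 0 < α) (u : Vertex d → ℝ) (n : ℕ) :
    minExcess α u (n + 1) = ⨅ c : Fin d, (ENNReal.ofReal (u [c]) +
      ENNReal.ofReal α * minExcess α (fun y => u (c :: y)) n) := by
  have h0 : ENNReal.ofReal α ≠ 0 := by simpa using hα
  unfold minExcess
  refine le_antisymm ?_ ?_
  · refine le_iInf fun c => ?_
    rw [ENNReal.mul_iInf_of_ne h0 ENNReal.ofReal_ne_top, ENNReal.add_iInf]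
    refine le_iInf fun z => ?_
    rw [ENNReal.mul_iInf_of_ne h0 ENNReal.ofReal_ne_top, ENNReal.add_iInf]
    refine le_iInf fun hz => ?_
    exact iInf₂_le (c :: z) (by simp [hz])
  · refine le_iInf₂ fun z hz => ?_
    cases z with
    | nil => simp at hz
    | cons c z =>
      refine (iInf_le _ c).trans ?_
      rw [excess]
      gcongr
      exact iInf₂_le z (by simpa using hz)

lemma minExcess_mono (α : ℝ) (u : Vertex d → ℝ) : Monotone (minExcess α u) := by
  refine monotone_nat_of_le_succ fun n => le_iInf₂ fun z hz => ?_
  refine (iInf₂_le (z.take n) (by simp [hz])).trans ?_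
  conv_rhs => rw [← List.take_append_drop n z]
  exact excess_le_append _ _ _ _

/-- The rescaled time to reach infinity from the root. -/
def hitTime (α : ℝ) (u : Vertex d → ℝ) : ℝ≥0∞ := ⨆ n, minExcess α u n

lemma timeFrom_eq {α : ℝ} (hα : 0 < α) (u : Vertex d → ℝ) (x : Vertex d) :
    timeFrom α u x = ENNReal.ofReal (α ^ (x.length + 1)) * hitTime α (fun y => u (x ++ y)) := by
  have h0 : ENNReal.ofReal (α ^ (x.length + 1)) ≠ 0 := by simpa using pow_pos hα _
  unfold timeFrom hitTime minExcess
  rw [ENNReal.mul_iSup]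
  refine iSup_congr fun n => ?_
  rw [ENNReal.mul_iInf_of_ne h0 ENNReal.ofReal_ne_top]
  refine iInf_congr fun z => ?_
  rw [ENNReal.mul_iInf_of_ne h0 ENNReal.ofReal_ne_top]
  refine iInf_congr fun hz => ?_
  rw [passageTime_append hα.le, ENNReal.add_sub_cancel_left (passageTime_ne_top _ _ _)]

/-- The normalisation of `W(x)` cancels the scale factor exactly: every `W(x)` is the same
functional of the weights below `x`, so all of them have the same law. -/
lemma scaledTime_eq {α : ℝ} (hα : 0 < α) (u : Vertex d → ℝ) (x : Vertex d) :
    scaledTime α u x = hitTime α (fun y => u (x ++ y)) := by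
  have h0 : ENNReal.ofReal (α ^ (x.length + 1)) ≠ 0 := by simpa using pow_pos hα _
  rw [scaledTime, timeFrom_eq hα, mul_comm, ENNReal.mul_div_cancel_right h0 ENNReal.ofReal_ne_top]

lemma timeFrom_eq_mul_scaledTime {α : ℝ} (hα : 0 < α) (u : Vertex d → ℝ) (x : Vertex d) :
    timeFrom α u x = ENNReal.ofReal (α ^ (x.length + 1)) * scaledTime α u x := by
  rw [scaledTime_eq hα, timeFrom_eq hα]

/-- With finitely many monotone sequences, one index works for all of them at once. This is where
finiteness of the offspring enters the recursion. -/
lemma iSup_iInf_fin {f : Fin d → ℕ → ℝ≥0∞} (hf : ∀ c, Monotone (f c)) :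
    ⨆ n, ⨅ c, f c n = ⨅ c, ⨆ n, f c n := by
  refine le_antisymm (iSup_iInf_le_iInf_iSup _) ?_
  refine le_of_forall_lt fun b hb => ?_
  have h : ∀ c, ∃ n, b < f c n := fun c => lt_iSup_iff.1 (hb.trans_le (iInf_le _ c))
  choose n hn using h
  rcases isEmpty_or_nonempty (Fin d) with he | he
  · simp only [iInf_of_empty] at hb ⊢
    simpa using hb
  refine lt_of_lt_of_le ?_ (le_iSup _ (Finset.univ.sup n))
  obtain ⟨c, hc⟩ := exists_eq_ciInf_of_finite (f := fun c => f c (Finset.univ.sup n))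
  rw [← hc]
  exact (hn c).trans_le (hf c (Finset.le_sup (Finset.mem_univ c)))

/-- The rescaled time to reach infinity through the edge leading to `x`. -/
def edgeTime (α : ℝ) (u : Vertex d → ℝ) (x : Vertex d) : ℝ≥0∞ :=
  ENNReal.ofReal (u x) + ENNReal.ofReal α * scaledTime α u x

/-- The distributional recursion in pathwise form: the first step chooses the child `c`, and the
remaining time is `α` times a copy rooted at `c`. -/
lemma hitTime_eq {α : ℝ} (hα : 0 < α) (u : Vertex d → ℝ) :
    hitTime α u = ⨅ c : Fin d, (ENNReal.ofReal (u [c]) +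
      ENNReal.ofReal α * hitTime α (fun y => u (c :: y))) := by
  have h1 : hitTime α u = ⨆ n, minExcess α u (n + 1) :=
    ((minExcess_mono α u).iSup_nat_add 1).symm
  rw [h1]
  simp only [minExcess_succ hα]
  rw [iSup_iInf_fin]
  · refine iInf_congr fun c => ?_
    rw [hitTime, ENNReal.mul_iSup, ENNReal.add_iSup]
  · intro c m n hmn
    dsimp only
    gcongr
    exact minExcess_mono _ _ hmn

lemma scaledTime_eq_iInf {α : ℝ} (hα : 0 < α) (u : Vertex d → ℝ) (x : Vertex d) :
    scaledTime α u x = ⨅ c, edgeTime α u (x ++ [c]) := by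
  rw [scaledTime_eq hα, hitTime_eq hα]
  refine iInf_congr fun c => ?_
  rw [edgeTime, scaledTime_eq hα]
  simp

/-- The least passage time to infinity along a line of descent through `x`. -/
def totalTime (α : ℝ) (u : Vertex d → ℝ) (x : Vertex d) : ℝ≥0∞ :=
  passageTime α u x + timeFrom α u x

lemma totalTime_concat {α : ℝ} (hα : 0 < α) (u : Vertex d → ℝ) (x : Vertex d) (c : Fin d) :
    totalTime α u (x ++ [c]) =
      passageTime α u x + ENNReal.ofReal (α ^ (x.length + 1)) * edgeTime α u (x ++ [c]) := by
  rw [totalTime, passageTime_concat, timeFrom_eq_mul_scaledTime hα, edgeTime, mul_add,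
    ENNReal.ofReal_mul (by positivity), ← mul_assoc, ← ENNReal.ofReal_mul (by positivity),
    add_assoc, List.length_append, List.length_singleton, pow_succ α (x.length + 1),
    ENNReal.ofReal_mul (p := α ^ (x.length + 1)) (q := α) (by positivity)]

lemma totalTime_eq_iInf {α : ℝ} (hα : 0 < α) (u : Vertex d → ℝ) (x : Vertex d) :
    totalTime α u x = ⨅ c, totalTime α u (x ++ [c]) := by
  have h0 : ENNReal.ofReal (α ^ (x.length + 1)) ≠ 0 := by simpa using pow_pos hα _
  simp only [totalTime_concat hα]
  rw [totalTime, timeFrom_eq_mul_scaledTime hα, scaledTime_eq_iInf hα,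
    ENNReal.mul_iInf_of_ne h0 ENNReal.ofReal_ne_top, ENNReal.add_iInf]

lemma totalTime_le_append {α : ℝ} (hα : 0 < α) (u : Vertex d → ℝ) (x z : Vertex d) :
    totalTime α u x ≤ totalTime α u (x ++ z) := by
  induction z generalizing x with
  | nil => simp
  | cons c z ih =>
    have := ih (x ++ [c])
    rw [List.append_assoc, List.singleton_append] at this
    refine le_trans ?_ this
    rw [totalTime_eq_iInf hα]
    exact iInf_le _ c

lemma passageTime_le_append {α : ℝ} (hα : 0 < α) (u : Vertex d → ℝ) (x z : Vertex d) :
    passageTime α u x ≤ passageTime α u (x ++ z) := by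
  rw [passageTime_append hα.le]
  exact le_self_add

/-! ### The time to infinity -/

lemma totalTime_eq_iSup {α : ℝ} (hα : 0 < α) (u : Vertex d → ℝ) (x : Vertex d) :
    totalTime α u x = ⨆ n : ℕ, ⨅ z : Vertex d, ⨅ _ : z.length = n, passageTime α u (x ++ z) := by
  rw [totalTime, timeFrom, ENNReal.add_iSup]
  refine iSup_congr fun n => ?_
  rw [ENNReal.add_iInf]
  refine iInf_congr fun z => ?_
  rw [ENNReal.add_iInf]
  refine iInf_congr fun hz => ?_
  exact add_tsub_cancel_of_le (passageTime_le_append hα u x z)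

lemma encard_length_lt_ne_top (d n : ℕ) : {x : Vertex d | x.length < n}.encard ≠ ⊤ := by
  rw [Set.encard_ne_top_iff]
  exact List.finite_length_lt _ n

/-- Cluster size and depth control each other. When a vertex of generation `n` is wet, so are its
`n` strict ancestors; conversely a cluster with more vertices than the finitely many of generation
below `n` has a vertex of generation at least `n`. -/
theorem timeToInfinity_eq {α : ℝ} (hα : 0 < α) (u : Vertex d → ℝ) :
    timeToInfinity α u = totalTime α u [] := by
  rw [totalTime_eq_iSup hα]
  refine le_antisymm (iSup_le fun n => ?_) (iSup_le fun n => ?_)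
  · refine le_iSup_of_le n (le_iInf₂ fun z hz => ?_)
    refine sInf_le ?_
    simp only [Set.mem_ofPred_eq, List.nil_append]
    have hsub : (fun k : ℕ => z.take k) '' (Finset.range (n + 1) : Set ℕ) ⊆
        wetCluster α u (passageTime α u z) := by
      rintro _ ⟨k, hk, rfl⟩
      show passageTime α u (z.take k) ≤ passageTime α u z
      conv_rhs => rw [← List.take_append_drop k z]
      exact passageTime_le_append hα _ _ _
    refine le_trans ?_ (Set.encard_le_encard hsub)
    rw [Set.InjOn.encard_image, Set.encard_coe_eq_coe_finsetCard, Finset.card_range]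
    · exact_mod_cast Nat.le_succ n
    · intro a ha b hb hab
      have := congrArg List.length hab
      simp only [Finset.coe_range, Set.mem_Iio, List.length_take] at ha hb this
      omega
  · obtain ⟨N, hN⟩ := ENat.ne_top_iff_exists.1 (encard_length_lt_ne_top d n)
    refine le_iSup_of_le (N + 1) ?_
    refine le_sInf fun t ht => ?_
    have : ∃ x ∈ wetCluster α u t, n ≤ x.length := by
      by_contra! h
      have h1 : wetCluster α u t ⊆ {x : Vertex d | x.length < n} := fun x hx => h x hx
      have h2 := ht.trans (Set.encard_le_encard h1)
      rw [← hN] at h2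
      have h3 : N + 1 ≤ N := by exact_mod_cast h2
      omega
    obtain ⟨x, hx, hxn⟩ := this
    refine (iInf₂_le (x.take n) (by simp [hxn])).trans (le_trans ?_ hx)
    rw [List.nil_append]
    conv_rhs => rw [← List.take_append_drop n x]
    exact passageTime_le_append hα _ _ _

lemma timeToInfinity_le_totalTime {α : ℝ} (hα : 0 < α) (u : Vertex d → ℝ) (x : Vertex d) :
    timeToInfinity α u ≤ totalTime α u x := by
  rw [timeToInfinity_eq hα]
  simpa using totalTime_le_append hα u [] x

end TreeDLA
end

noncomputable section

namespace TreeDLA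

variable {d : ℕ}

/-! ### Lines of descent and the backbone -/

lemma mem_infiniteCluster_of_append {α : ℝ} (hα : 0 < α) {u : Vertex d → ℝ} {x z : Vertex d}
    (h : x ++ z ∈ infiniteCluster α u) : x ∈ infiniteCluster α u :=
  lt_of_le_of_lt (passageTime_le_append hα u x z) h

/-- `x` has descendants in `A_∞` in every later generation. -/
def Survives (α : ℝ) (u : Vertex d → ℝ) (x : Vertex d) : Prop :=
  ∀ m : ℕ, ∃ z : Vertex d, z.length = m ∧ x ++ z ∈ infiniteCluster α u

lemma Survives.mem {α : ℝ} {u : Vertex d → ℝ} {x : Vertex d} (h : Survives α u x) :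
    x ∈ infiniteCluster α u := by
  obtain ⟨z, hz, hx⟩ := h 0
  rw [List.length_eq_zero_iff] at hz
  simpa [hz] using hx

lemma Survives.of_append {α : ℝ} (hα : 0 < α) {u : Vertex d → ℝ} {x y : Vertex d}
    (h : Survives α u (x ++ y)) : Survives α u x := by
  intro m
  obtain ⟨z, hz, hx⟩ := h m
  refine ⟨(y ++ z).take m, by simp [hz], ?_⟩
  refine mem_infiniteCluster_of_append hα (z := (y ++ z).drop m) ?_
  rw [List.append_assoc, List.take_append_drop, ← List.append_assoc]
  exact hx

/-- König's argument: if every child had finite progeny in `A_∞`, then, the children being finitely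
many, no descendant would survive one generation past the deepest of them. -/
lemma Survives.exists_concat {α : ℝ} (hα : 0 < α) {u : Vertex d → ℝ} {x : Vertex d}
    (h : Survives α u x) : ∃ c, Survives α u (x ++ [c]) := by
  by_contra! hc
  simp only [Survives, not_forall, not_exists, not_and] at hc
  choose m hm using hc
  obtain ⟨z, hz, hx⟩ := h (Finset.univ.sup m + 1)
  cases z with
  | nil => simp at hz
  | cons c z =>
    have hmc : m c ≤ Finset.univ.sup m := Finset.le_sup (Finset.mem_univ c)
    have hz' : z.length = Finset.univ.sup m := by simpa using hz
    refine hm c (z.take (m c)) (by simp [hz', hmc]) ?_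
    refine mem_infiniteCluster_of_append hα (z := z.drop (m c)) ?_
    simpa using hx

lemma Survives.exists_line {α : ℝ} (hα : 0 < α) {u : Vertex d → ℝ} {x : Vertex d}
    (h : Survives α u x) : ∃ ξ, IsLineOfDescent α u ξ ∧ ξ x.length = x := by
  classical
  choose f hf using fun y : {y : Vertex d // Survives α u y} => y.2.exists_concat hα
  let ζ : ℕ → {y : Vertex d // Survives α u y} := fun n =>
    Nat.rec ⟨x, h⟩ (fun _ y => ⟨y.1 ++ [f y], hf y⟩) n
  have hζ : ∀ n, (ζ (n + 1)).1 = (ζ n).1 ++ [f (ζ n)] := fun n => rfl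
  have hlen : ∀ n, (ζ n).1.length = x.length + n := by
    intro n
    induction n with
    | zero => rfl
    | succ n ih => rw [hζ, List.length_append, ih]; rfl
  have hpre : ∀ n, x <+: (ζ n).1 := by
    intro n
    induction n with
    | zero => exact List.prefix_rfl
    | succ n ih => rw [hζ]; exact ih.trans (List.prefix_append _ _)
  -- `ζ n` lies in generation `|x| + n`; truncating it at length `n` gives a line started at the
  -- root that runs through `x`.
  refine ⟨fun n => (ζ n).1.take n, fun n => ⟨?_, ?_, ?_⟩, ?_⟩
  · simp [hlen]
  · refine mem_infiniteCluster_of_append hα (z := (ζ n).1.drop n) ?_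
    rw [List.take_append_drop]
    exact (ζ n).2.mem
  · dsimp only
    have h1 : n ≤ (ζ n).1.length := by simp [hlen]
    rw [hζ, List.dropLast_eq_take, List.take_take, List.length_take, List.length_append,
      List.length_singleton, min_eq_left (by omega), min_eq_left (by omega), Nat.add_sub_cancel,
      List.take_append_of_le_length h1]
  · exact (List.prefix_iff_eq_take.1 (hpre _)).symm

lemma IsLineOfDescent.exists_append {α : ℝ} {u : Vertex d → ℝ} {ξ : ℕ → Vertex d}
    (h : IsLineOfDescent α u ξ) (n m : ℕ) : ∃ z, z.length = m ∧ ξ (n + m) = ξ n ++ z := by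
  induction m with
  | zero => exact ⟨[], rfl, by simp⟩
  | succ m ih =>
    obtain ⟨z, hz, hξ⟩ := ih
    have hne : ξ (n + m + 1) ≠ [] := by
      intro h0
      have := (h (n + m + 1)).1
      rw [h0] at this
      simp at this
    refine ⟨z ++ [(ξ (n + m + 1)).getLast hne], by simp [hz], ?_⟩
    rw [← List.append_assoc, ← hξ, (h (n + m)).2.2, ← add_assoc]
    exact (List.dropLast_append_getLast hne).symm

lemma IsLineOfDescent.survives {α : ℝ} {u : Vertex d → ℝ} {ξ : ℕ → Vertex d}
    (h : IsLineOfDescent α u ξ) (n : ℕ) : Survives α u (ξ n) := by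
  intro m
  obtain ⟨z, hz, hξ⟩ := h.exists_append n m
  exact ⟨z, hz, hξ ▸ (h (n + m)).2.1⟩

/-- Existence and uniqueness in an uncountable set of sequences becomes a condition generation by
generation, over countably many vertices. This form makes the event measurable. -/
lemma existsUnique_line_iff {α : ℝ} (hα : 0 < α) (u : Vertex d → ℝ) :
    (∃! ξ, IsLineOfDescent α u ξ) ↔
      ∀ n : ℕ, ∃ x : Vertex d, (x.length = n ∧ Survives α u x) ∧
        ∀ y : Vertex d, y.length = n → Survives α u y → y = x := by
  constructor
  · rintro ⟨ξ, hξ, huniq⟩ n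
    refine ⟨ξ n, ⟨(hξ n).1, hξ.survives n⟩, fun y hy hs => ?_⟩
    obtain ⟨ζ, hζ, hζy⟩ := hs.exists_line hα
    rw [← hζy, huniq ζ hζ, hy]
  · intro h
    choose ξ hξ huniq using h
    refine ⟨ξ, fun n => ⟨(hξ n).1, (hξ n).2.mem, ?_⟩, fun ζ hζ => ?_⟩
    · symm
      refine huniq n _ (by simp [(hξ (n + 1)).1]) ?_
      have hne : ξ (n + 1) ≠ [] := by
        intro h0
        have := (hξ (n + 1)).1
        rw [h0] at this
        simp at this
      refine Survives.of_append hα (y := [(ξ (n + 1)).getLast hne]) ?_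
      rw [List.dropLast_append_getLast]
      exact (hξ (n + 1)).2
    · funext n
      exact huniq n _ (hζ n).1 (hζ.survives n)

lemma backbone_isLine {α : ℝ} {u : Vertex d → ℝ} (h : ∃! ξ, IsLineOfDescent α u ξ) :
    IsLineOfDescent α u (backbone α u) := by
  rw [backbone, dif_pos h]
  exact h.choose_spec.1

lemma existsUnique_of_backbone_ne_nil {α : ℝ} {u : Vertex d → ℝ} {n : ℕ}
    (h : backbone α u n ≠ []) : ∃! ξ, IsLineOfDescent α u ξ := by
  by_contra h'
  rw [backbone, dif_neg h'] at h
  exact h rfl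

lemma backbone_zero (α : ℝ) (u : Vertex d → ℝ) : backbone α u 0 = [] := by
  by_contra h
  have := (backbone_isLine (existsUnique_of_backbone_ne_nil h) 0).1
  exact h (List.length_eq_zero_iff.1 this)

/-- The root is excluded because it is also the default value of the backbone: any other value
certifies that the line of descent exists and is unique. -/
lemma backbone_eq_iff {α : ℝ} (hα : 0 < α) (u : Vertex d → ℝ) {n : ℕ} {x : Vertex d} (hx : x ≠ []) :
    backbone α u n = x ↔ (∃! ξ, IsLineOfDescent α u ξ) ∧ x.length = n ∧ Survives α u x := by
  constructor
  · intro h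
    have hu := existsUnique_of_backbone_ne_nil (h.trans_ne hx)
    have hl := backbone_isLine hu
    exact ⟨hu, h ▸ (hl n).1, h ▸ hl.survives n⟩
  · rintro ⟨hu, hlen, hs⟩
    have hl := backbone_isLine hu
    obtain ⟨y, -, hy⟩ := (existsUnique_line_iff hα u).1 hu n
    rw [hy x hlen hs]
    exact hy _ (hl n).1 (hl.survives n)

/-- Every vertex of the line is wet before `T(∞)`, so the infimum over each later generation is at
most `T(∞)`. The other inequality holds at every vertex. -/
lemma IsLineOfDescent.totalTime_eq {α : ℝ} (hα : 0 < α) {u : Vertex d → ℝ} {ξ : ℕ → Vertex d}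
    (h : IsLineOfDescent α u ξ) (n : ℕ) : totalTime α u (ξ n) = timeToInfinity α u := by
  refine le_antisymm ?_ (timeToInfinity_le_totalTime hα u _)
  rw [totalTime_eq_iSup hα]
  refine iSup_le fun m => ?_
  obtain ⟨z, hz, hξ⟩ := h.exists_append n m
  refine (iInf₂_le z hz).trans ?_
  rw [← hξ]
  exact (h (n + m)).2.1.le

/-- Along the backbone the time from a vertex is the time through the next edge. -/
lemma scaledTime_eq_edgeTime_of_backbone {α : ℝ} (hα : 0 < α) {u : Vertex d → ℝ} {n : ℕ}
    {x : Vertex d} {c : Fin d} (h : backbone α u (n + 1) = x ++ [c]) :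
    backbone α u n = x ∧ scaledTime α u x = edgeTime α u (x ++ [c]) := by
  have hl := backbone_isLine (existsUnique_of_backbone_ne_nil (h.trans_ne (by simp)))
  have hx : backbone α u n = x := by rw [(hl n).2.2, h, List.dropLast_concat]
  refine ⟨hx, ?_⟩
  have h1 := hl.totalTime_eq hα n
  rw [← hl.totalTime_eq hα (n + 1), h, hx, totalTime_concat hα, totalTime,
    ENNReal.add_right_inj (passageTime_ne_top _ _ _), timeFrom_eq_mul_scaledTime hα] at h1
  have h0 : ENNReal.ofReal (α ^ (x.length + 1)) ≠ 0 := by simpa using pow_pos hα _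
  exact (ENNReal.mul_right_inj h0 ENNReal.ofReal_ne_top).1 h1

/-! ### Generic weights: the backbone as the unique minimiser of the total time. -/

/-- Conditions on the weights under which the backbone is well defined. -/
structure IsGeneric (α : ℝ) (u : Vertex d → ℝ) : Prop where
  scaledTime_pos : ∀ x, 0 < scaledTime α u x
  scaledTime_ne_top : ∀ x, scaledTime α u x ≠ ∞
  totalTime_ne : ∀ x y : Vertex d, x.length = y.length → x ≠ y → totalTime α u x ≠ totalTime α u y

lemma IsGeneric.passageTime_lt {α : ℝ} (hα : 0 < α) {u : Vertex d → ℝ} (h : IsGeneric α u)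
    (x : Vertex d) : passageTime α u x < totalTime α u x := by
  rw [totalTime, timeFrom_eq_mul_scaledTime hα]
  refine ENNReal.lt_add_right (passageTime_ne_top _ _ _) (mul_ne_zero ?_ (h.scaledTime_pos x).ne')
  simpa using pow_pos hα _

/-- Among finitely many children one attains the minimum, so a vertex of minimal total time has
minimal descendants in every generation. Their positive time to infinity makes them wet strictly
before `T(∞)`. -/
lemma IsGeneric.survives_of_totalTime_eq {α : ℝ} (hα : 0 < α) (hd : 1 ≤ d) {u : Vertex d → ℝ}
    (h : IsGeneric α u) {x : Vertex d} (hx : totalTime α u x = timeToInfinity α u) :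
    Survives α u x := by
  have : Nonempty (Fin d) := ⟨⟨0, hd⟩⟩
  have key : ∀ m : ℕ, ∃ z : Vertex d, z.length = m ∧
      totalTime α u (x ++ z) = timeToInfinity α u := by
    intro m
    induction m with
    | zero => exact ⟨[], rfl, by simpa using hx⟩
    | succ m ih =>
      obtain ⟨z, hz, hxz⟩ := ih
      obtain ⟨c, hc⟩ := exists_eq_ciInf_of_finite (f := fun c => totalTime α u ((x ++ z) ++ [c]))
      refine ⟨z ++ [c], by simp [hz], ?_⟩
      rw [← List.append_assoc, hc, ← totalTime_eq_iInf hα, hxz]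
  intro m
  obtain ⟨z, hz, hxz⟩ := key m
  refine ⟨z, hz, ?_⟩
  show passageTime α u (x ++ z) < timeToInfinity α u
  rw [← hxz]
  exact h.passageTime_lt hα _

lemma IsGeneric.existsUnique_line {α : ℝ} (hα : 0 < α) (hd : 1 ≤ d) {u : Vertex d → ℝ}
    (h : IsGeneric α u) : ∃! ξ, IsLineOfDescent α u ξ := by
  have h0 : totalTime α u ([] : Vertex d) = timeToInfinity α u := (timeToInfinity_eq hα u).symm
  obtain ⟨ξ, hξ, -⟩ := (h.survives_of_totalTime_eq hα hd h0).exists_line hα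
  refine ⟨ξ, hξ, fun ζ hζ => funext fun n => ?_⟩
  by_contra hne
  refine h.totalTime_ne (ζ n) (ξ n) (by rw [(hζ n).1, (hξ n).1]) hne ?_
  rw [hζ.totalTime_eq hα, hξ.totalTime_eq hα]

/-- Expresses the position of the backbone by comparisons within a single generation, which the past
of `x` and `W(x)` can decide. -/
lemma IsGeneric.backbone_eq_iff {α : ℝ} (hα : 0 < α) (hd : 1 ≤ d) {u : Vertex d → ℝ}
    (h : IsGeneric α u) {n : ℕ} {x : Vertex d} (hx : x.length = n) :
    backbone α u n = x ↔
      ∀ y : Vertex d, y.length = n → y ≠ x → totalTime α u x < totalTime α u y := by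
  have hl := backbone_isLine (h.existsUnique_line hα hd)
  constructor
  · intro hb y hy hyx
    refine lt_of_le_of_ne ?_ (h.totalTime_ne x y (hx.trans hy.symm) hyx.symm)
    rw [← hb, hl.totalTime_eq hα]
    exact timeToInfinity_le_totalTime hα u y
  · intro hmin
    by_contra hne
    have h1 := hmin _ (hl n).1 hne
    rw [hl.totalTime_eq hα] at h1
    exact absurd (timeToInfinity_le_totalTime hα u x) (not_le.2 h1)

end TreeDLA
end

noncomputable section

namespace TreeDLA

variable {d : ℕ}

/-! ### Measurability -/

section Measurability

variable {Ω : Type*} [MeasurableSpace Ω] {α : ℝ}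

/-- No measurability is asked of the root weight, because the excess does not use it. Applied with a
smaller `σ`-field, this is the source of the independence of `U_x` and `W(x)`. -/
lemma measurable_excess {V : Vertex d → Ω → ℝ} (hV : ∀ z ≠ [], Measurable (V z)) (z : Vertex d) :
    Measurable fun ω => excess α (fun y => V y ω) z := by
  induction z generalizing V with
  | nil => exact measurable_const
  | cons c z ih =>
    simp only [excess]
    refine (hV [c] (by simp)).ennreal_ofReal.add (Measurable.const_mul ?_ _)
    exact ih (V := fun y => V (c :: y)) fun y _ => hV _ (by simp)

lemma measurable_hitTime {V : Vertex d → Ω → ℝ} (hV : ∀ z ≠ [], Measurable (V z)) :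
    Measurable fun ω => hitTime α (fun y => V y ω) := by
  unfold hitTime minExcess
  exact .iSup fun n => .iInf fun z => .iInf fun _ => measurable_excess hV z

lemma measurable_scaledTime (hα : 0 < α) {U : Vertex d → Ω → ℝ} {x : Vertex d}
    (hU : ∀ z ≠ [], Measurable (U (x ++ z))) :
    Measurable fun ω => scaledTime α (fun y => U y ω) x := by
  simp only [scaledTime_eq hα]
  exact measurable_hitTime (V := fun z => U (x ++ z)) hU

lemma measurable_edgeTime (hα : 0 < α) {U : Vertex d → Ω → ℝ} {x : Vertex d}
    (hU : ∀ z, Measurable (U (x ++ z))) :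
    Measurable fun ω => edgeTime α (fun y => U y ω) x := by
  unfold edgeTime
  refine Measurable.add ?_ ((measurable_scaledTime hα fun z _ => hU z).const_mul _)
  simpa using (hU []).ennreal_ofReal

lemma measurable_passageTime {U : Vertex d → Ω → ℝ} {x : Vertex d}
    (hU : ∀ k, Measurable (U (x.take k))) :
    Measurable fun ω => passageTime α (fun y => U y ω) x := by
  unfold passageTime
  exact Finset.measurable_sum _ fun k _ => ((hU k).const_mul _).ennreal_ofReal

lemma measurable_totalTime (hα : 0 < α) {U : Vertex d → Ω → ℝ} {x : Vertex d}
    (hU : ∀ k, Measurable (U (x.take k))) (hU' : ∀ z ≠ [], Measurable (U (x ++ z))) :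
    Measurable fun ω => totalTime α (fun y => U y ω) x := by
  simp only [totalTime, timeFrom_eq_mul_scaledTime hα]
  exact (measurable_passageTime hU).add ((measurable_scaledTime hα hU').const_mul _)

lemma measurableSet_survives (hα : 0 < α) {U : Vertex d → Ω → ℝ} (hU : ∀ z, Measurable (U z))
    (x : Vertex d) : MeasurableSet {ω | Survives α (fun y => U y ω) x} := by
  have h : ∀ y : Vertex d, MeasurableSet {ω | y ∈ infiniteCluster α (fun z => U z ω)} := by
    intro y
    simp only [infiniteCluster, Set.mem_ofPred_eq, timeToInfinity_eq hα]
    exact measurableSet_lt (measurable_passageTime fun k => hU _)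
      (measurable_totalTime hα (fun k => hU _) fun z _ => hU _)
  simp only [Survives, Set.ofPred_forall, Set.ofPred_exists, Set.ofPred_and]
  refine MeasurableSet.iInter fun m => MeasurableSet.iUnion fun z => ?_
  exact (MeasurableSet.const (z.length = m)).inter (h _)

lemma measurableSet_existsUnique_line (hα : 0 < α) {U : Vertex d → Ω → ℝ}
    (hU : ∀ z, Measurable (U z)) :
    MeasurableSet {ω | ∃! ξ, IsLineOfDescent α (fun y => U y ω) ξ} := by
  simp only [existsUnique_line_iff hα, Set.ofPred_forall, Set.ofPred_exists, Set.ofPred_and]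
  refine MeasurableSet.iInter fun n => MeasurableSet.iUnion fun x => ?_
  refine ((MeasurableSet.const _).inter (measurableSet_survives hα hU x)).inter ?_
  refine MeasurableSet.iInter fun y => MeasurableSet.iInter fun _ => ?_
  exact MeasurableSet.imp (measurableSet_survives hα hU y) (MeasurableSet.const _)

lemma measurableSet_backbone_eq (hα : 0 < α) {U : Vertex d → Ω → ℝ}
    (hU : ∀ z, Measurable (U z)) (n : ℕ) (x : Vertex d) :
    MeasurableSet {ω | backbone α (fun y => U y ω) n = x} := by
  have key : ∀ y : Vertex d, y ≠ [] →
      MeasurableSet {ω | backbone α (fun z => U z ω) n = y} := by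
    intro y hy
    simp only [backbone_eq_iff hα _ hy, Set.ofPred_and]
    exact (measurableSet_existsUnique_line hα hU).inter
      ((MeasurableSet.const _).inter (measurableSet_survives hα hU y))
  by_cases hx : x = []
  · have : {ω | backbone α (fun y => U y ω) n = x} =
        (⋃ y : {y : Vertex d // y ≠ []}, {ω | backbone α (fun z => U z ω) n = y.1})ᶜ := by
      ext ω
      simp only [hx, Set.mem_ofPred_eq, Set.mem_compl_iff, Set.mem_iUnion, Subtype.exists,
        exists_prop, not_exists, not_and]
      exact ⟨fun h a ha h' => ha (h'.symm.trans h), fun h => by_contra fun h' => h _ h' rfl⟩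
    rw [this]
    exact (MeasurableSet.iUnion fun y : {y : Vertex d // y ≠ []} => key y.1 y.2).compl
  · exact key x hx

lemma measurable_W (hα : 0 < α) {U : Vertex d → Ω → ℝ} (hU : ∀ z, Measurable (U z)) (n : ℕ) :
    Measurable (W α U n) := by
  intro B hB
  have : W α U n ⁻¹' B = ⋃ x : Vertex d, {ω | backbone α (fun y => U y ω) n = x} ∩
      (fun ω => (scaledTime α (fun y => U y ω) x).toReal) ⁻¹' B := by
    ext ω
    simp [W, backboneTime]
  rw [this]
  exact MeasurableSet.iUnion fun x => (measurableSet_backbone_eq hα hU n x).inter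
    ((measurable_scaledTime hα fun z _ => hU _).ennreal_toReal hB)

end Measurability

/-! ### The exponential law -/

lemma expMeasure_eq (r : ℝ) : expMeasure r = volume.withDensity (exponentialPDF r) := rfl

instance : IsProbabilityMeasure (expMeasure 1) := isProbabilityMeasure_expMeasure one_pos

lemma measurable_exponentialPDF (r : ℝ) : Measurable (exponentialPDF r) :=
  (measurable_exponentialPDFReal r).ennreal_ofReal

lemma expMeasure_Iic_zero : expMeasure 1 (Set.Iic 0) = 0 := by
  rw [expMeasure_eq, withDensity_apply _ measurableSet_Iic, setLIntegral_congr Iio_ae_eq_Iic.symm]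
  exact lintegral_exponentialPDF_of_nonpos le_rfl

instance : NullSingletonClass (expMeasure 1) := by
  rw [expMeasure_eq]; infer_instance

lemma lintegral_exp_expMeasure {θ : ℝ} (hθ : θ < 1) :
    ∫⁻ u, ENNReal.ofReal (Real.exp (θ * u)) ∂(expMeasure 1) = ENNReal.ofReal (1 / (1 - θ)) := by
  have h1 : 0 < 1 - θ := by linarith
  rw [expMeasure_eq, lintegral_withDensity_eq_lintegral_mul _ (measurable_exponentialPDF 1)
    (by fun_prop)]
  have : ∀ u : ℝ, (exponentialPDF 1 * fun u => ENNReal.ofReal (Real.exp (θ * u))) u =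
      ENNReal.ofReal (1 / (1 - θ)) * exponentialPDF (1 - θ) u := by
    intro u
    simp only [Pi.mul_apply, exponentialPDF_eq]
    rw [← ENNReal.ofReal_mul' (by positivity), ← ENNReal.ofReal_mul (by positivity)]
    congr 1
    split_ifs
    · rw [one_mul, one_mul, ← mul_assoc, one_div_mul_cancel h1.ne', one_mul, ← Real.exp_add]
      ring_nf
    · simp
  simp only [this]
  rw [lintegral_const_mul _ (measurable_exponentialPDF _), lintegral_exponentialPDF_eq_one h1,
    mul_one]

/-- The bound on the exponential moment is put in the form `exp (const · θ)` so that the product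
over generations, where `θ` runs through `θ, αθ, α²θ, …`, becomes a geometric series in the
exponent. -/
lemma one_div_one_sub_le_exp {α θ : ℝ} (hα1 : α < 1) (h0 : 0 ≤ θ) (hθ : θ ≤ α) :
    1 / (1 - θ) ≤ Real.exp (θ / (1 - α)) := by
  have h1 : 0 < 1 - θ := by linarith
  have h2 : 0 < 1 - α := by linarith
  calc 1 / (1 - θ) = θ / (1 - θ) + 1 := by field_simp; ring
    _ ≤ Real.exp (θ / (1 - θ)) := Real.add_one_le_exp _
    _ ≤ _ := by
      apply Real.exp_le_exp.2
      exact div_le_div_of_nonneg_left h0 h2 (by linarith)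

/-! ### Independence in the environment -/

section Environment

variable {Ω : Type*} [mΩ : MeasurableSpace Ω] {P : Measure Ω}
  {U : Vertex d → Ω → ℝ} {α : ℝ}

/-- The `σ`-field generated by the weights off the subtree of `y`. -/
@[reducible] def offSubtree (U : Vertex d → Ω → ℝ) (y : Vertex d) : MeasurableSpace Ω :=
  ⨆ z ∈ {z : Vertex d | ¬ y <+: z}, MeasurableSpace.comap (U z) inferInstance

/-- The `σ`-field generated by the weights on the subtree of `y`. -/
@[reducible] def onSubtree (U : Vertex d → Ω → ℝ) (y : Vertex d) : MeasurableSpace Ω :=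
  ⨆ z ∈ {z : Vertex d | y <+: z}, MeasurableSpace.comap (U z) inferInstance

lemma measurable_biSup_comap {Ω : Type*} {U : Vertex d → Ω → ℝ} {S : Set (Vertex d)}
    {z : Vertex d} (hz : z ∈ S) :
    Measurable[⨆ z ∈ S, MeasurableSpace.comap (U z) inferInstance] (U z) := by
  rw [measurable_iff_comap_le]
  exact le_iSup₂ (f := fun z (_ : z ∈ S) => MeasurableSpace.comap (U z) inferInstance) z hz

lemma IsExpEnvironment.biSup_comap_le (hU : IsExpEnvironment U P) (S : Set (Vertex d)) :
    ⨆ z ∈ S, MeasurableSpace.comap (U z) inferInstance ≤ mΩ :=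
  iSup₂_le fun z _ => (hU.measurable z).comap_le

lemma IsExpEnvironment.isProbabilityMeasure (hU : IsExpEnvironment U P) :
    IsProbabilityMeasure P := hU.indep.isProbabilityMeasure

lemma IsExpEnvironment.indep_subtree (hU : IsExpEnvironment U P) (y : Vertex d) :
    Indep (offSubtree U y) (onSubtree U y) P := by
  refine indep_iSup_of_disjoint (fun z => (hU.measurable z).comap_le) hU.indep ?_
  rw [Set.disjoint_left]
  exact fun z hz hz' => hz hz'

lemma IsExpEnvironment.shift (hU : IsExpEnvironment U P) (x : Vertex d) :
    IsExpEnvironment (fun z => U (x ++ z)) P where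
  measurable _ := hU.measurable _
  indep := hU.indep.precomp (List.append_right_injective x)
  law _ := hU.law _

lemma IsExpEnvironment.ae_pos (hU : IsExpEnvironment U P) : ∀ᵐ ω ∂P, ∀ x, 0 < U x ω := by
  rw [ae_all_iff]
  intro x
  have h := expMeasure_Iic_zero
  rw [← hU.law x, Measure.map_apply (hU.measurable x) measurableSet_Iic] at h
  rw [ae_iff]
  convert h using 2
  ext ω
  simp

/-! ### The canonical environment and the law of the rescaled time. -/

/-- The canonical law of the weights. -/
def envMeasure (d : ℕ) : Measure (Vertex d → ℝ) := Measure.infinitePi fun _ => expMeasure 1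

instance : IsProbabilityMeasure (envMeasure d) := by unfold envMeasure; infer_instance

lemma isExpEnvironment_canonical (d : ℕ) :
    IsExpEnvironment (fun (x : Vertex d) (u : Vertex d → ℝ) => u x) (envMeasure d) where
  measurable x := measurable_pi_apply x
  indep := iIndepFun_infinitePi (X := fun _ u => u) fun _ => measurable_id
  law x := by
    unfold envMeasure
    exact Measure.infinitePi_map_eval _ x

lemma IsExpEnvironment.map_eq (hU : IsExpEnvironment U P) :
    P.map (fun ω x => U x ω) = envMeasure d := by
  rw [hU.indep.map_fun_eq_infinitePi_map hU.measurable]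
  unfold envMeasure
  congr 1
  funext x
  exact hU.law x

/-- The law of `W(x)`. -/
def rootLaw (d : ℕ) (α : ℝ) : Measure ℝ :=
  (envMeasure d).map fun u => (scaledTime α u []).toReal

lemma IsExpEnvironment.map_scaledTime (hU : IsExpEnvironment U P) (hα : 0 < α) (x : Vertex d) :
    P.map (fun ω => (scaledTime α (fun z => U z ω) x).toReal) = rootLaw d α := by
  rw [rootLaw, ← (hU.shift x).map_eq, Measure.map_map]
  · congr 1
    funext ω
    simp only [Function.comp_apply, scaledTime_eq hα, List.nil_append]
  · exact (measurable_scaledTime (U := fun (z : Vertex d) (u : Vertex d → ℝ) => u z) hα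
      fun z _ => measurable_pi_apply _).ennreal_toReal
  · exact measurable_pi_lambda _ fun _ => hU.measurable _

lemma isProbabilityMeasure_rootLaw (d : ℕ) {α : ℝ} (hα : 0 < α) :
    IsProbabilityMeasure (rootLaw d α) :=
  Measure.isProbabilityMeasure_map ((measurable_scaledTime
    (U := fun (z : Vertex d) (u : Vertex d → ℝ) => u z) hα
      fun _ _ => measurable_pi_apply _).ennreal_toReal.aemeasurable)

/-! ### Exponential moments -/

lemma excess_ne_top (u : Vertex d → ℝ) (z : Vertex d) : excess α u z ≠ ∞ := by
  induction z generalizing u with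
  | nil => simp [excess]
  | cons c z ih =>
    exact ENNReal.add_ne_top.2 ⟨ENNReal.ofReal_ne_top,
      ENNReal.mul_ne_top ENNReal.ofReal_ne_top (ih _)⟩

/-- The ray that always takes the same child suffices for an upper bound. One generation costs `exp
(θ/(1-α))` and the rest is the same problem at parameter `θα`; the exponent closes up because
`θ/(1-α) + θα/(1-α)² = θ/(1-α)²`. -/
lemma IsExpEnvironment.lintegral_exp_excess_le (hU : IsExpEnvironment U P) (hα : 0 < α)
    (hα1 : α < 1) (c : Fin d) (n : ℕ) {θ : ℝ} (h0 : 0 ≤ θ) (hθ : θ ≤ α) :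
    ∫⁻ ω, ENNReal.ofReal (Real.exp (θ *
      (excess α (fun z => U z ω) (List.replicate n c)).toReal)) ∂P ≤
      ENNReal.ofReal (Real.exp (θ / (1 - α) ^ 2)) := by
  have := hU.isProbabilityMeasure
  have h2 : 0 < 1 - α := by linarith
  induction n generalizing U θ with
  | zero =>
    simp only [List.replicate_zero, excess, ENNReal.toReal_zero, mul_zero, Real.exp_zero,
      lintegral_const, measure_univ, mul_one]
    apply ENNReal.ofReal_le_ofReal
    exact Real.one_le_exp (by positivity)
  | succ n ih =>
    have hV := hU.shift [c]
    have hm1 : Measurable fun ω => ENNReal.ofReal (Real.exp (θ * U [c] ω)) := by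
      have := hU.measurable [c]
      fun_prop
    have hm2 : Measurable[⨆ z ∈ {z : Vertex d | z ≠ [c]},
        MeasurableSpace.comap (U z) inferInstance] fun ω => ENNReal.ofReal (Real.exp (θ * α *
          (excess α (fun z => U (c :: z) ω) (List.replicate n c)).toReal)) := by
      refine Measurable.ennreal_ofReal (Real.measurable_exp.comp (Measurable.const_mul ?_ _))
      refine (Measurable.ennreal_toReal ?_)
      refine @measurable_excess d Ω (⨆ z ∈ {z : Vertex d | z ≠ [c]},
        MeasurableSpace.comap (U z) inferInstance) α (fun z => U (c :: z)) (fun z hz => ?_) _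
      exact measurable_biSup_comap (by simpa using hz)
    have hm2' := hm2.mono (hU.biSup_comap_le _) le_rfl
    have hind : IndepFun (fun ω => ENNReal.ofReal (Real.exp (θ * U [c] ω)))
        (fun ω => ENNReal.ofReal (Real.exp (θ * α *
          (excess α (fun z => U (c :: z) ω) (List.replicate n c)).toReal))) P := by
      have := indep_iSup_of_disjoint (fun z => (hU.measurable z).comap_le) hU.indep
        (S := {[c]}) (T := {z | z ≠ [c]}) (by simp)
      refine indep_of_indep_of_le_left (indep_of_indep_of_le_right this hm2.comap_le) ?_
      refine Measurable.comap_le ?_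
      have h3 : Measurable[⨆ z ∈ ({[c]} : Set (Vertex d)),
        MeasurableSpace.comap (U z) inferInstance] (U [c]) := measurable_biSup_comap rfl
      exact (Real.measurable_exp.comp (h3.const_mul θ)).ennreal_ofReal
    calc ∫⁻ ω, ENNReal.ofReal (Real.exp (θ *
          (excess α (fun z => U z ω) (List.replicate (n + 1) c)).toReal)) ∂P
        = ∫⁻ ω, (ENNReal.ofReal (Real.exp (θ * U [c] ω))) * (ENNReal.ofReal (Real.exp (θ * α *
          (excess α (fun z => U (c :: z) ω) (List.replicate n c)).toReal))) ∂P := by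
          refine lintegral_congr_ae ?_
          filter_upwards [hU.ae_pos] with ω hω
          rw [← ENNReal.ofReal_mul (by positivity), ← Real.exp_add, List.replicate_succ, excess,
            ENNReal.toReal_add ENNReal.ofReal_ne_top
              (ENNReal.mul_ne_top ENNReal.ofReal_ne_top (excess_ne_top _ _)),
            ENNReal.toReal_mul, ENNReal.toReal_ofReal hα.le, ENNReal.toReal_ofReal (hω [c]).le]
          ring_nf
      _ = ENNReal.ofReal (1 / (1 - θ)) * ∫⁻ ω, (ENNReal.ofReal (Real.exp (θ * α *
          (excess α (fun z => U (c :: z) ω) (List.replicate n c)).toReal))) ∂P := by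
          rw [lintegral_mul_eq_lintegral_mul_lintegral_of_indepFun'' hm1.aemeasurable
              hm2'.aemeasurable hind,
            ← lintegral_exp_expMeasure (by linarith), ← hU.law [c],
            lintegral_map (by fun_prop) (hU.measurable _)]
      _ ≤ ENNReal.ofReal (Real.exp (θ / (1 - α))) *
          ENNReal.ofReal (Real.exp (θ * α / (1 - α) ^ 2)) := by
          gcongr
          · exact one_div_one_sub_le_exp hα1 h0 hθ
          · exact ih hV (by positivity) (by nlinarith)
      _ = _ := by
          rw [← ENNReal.ofReal_mul (by positivity), ← Real.exp_add]
          congr 2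
          field_simp
          ring

lemma hitTime_le_of_excess_le {u : Vertex d → ℝ} (c : Fin d) {b : ℝ≥0∞}
    (h : ∀ n, excess α u (List.replicate n c) ≤ b) : hitTime α u ≤ b := by
  refine iSup_le fun n => ?_
  exact (iInf₂_le (List.replicate n c) (by simp)).trans (h n)

/-- Finiteness and the bound are proved together, since `toReal` would send an infinite time to `0`
and make the bound alone worthless. -/
lemma exp_hitTime_le {u : Vertex d → ℝ} (c : Fin d) {θ : ℝ} (hθ : 0 < θ) {s : ℝ≥0∞} (hs : s ≠ ∞)
    (h : ∀ n, ENNReal.ofReal (Real.exp (θ * (excess α u (List.replicate n c)).toReal)) ≤ s) :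
    hitTime α u ≠ ∞ ∧ ENNReal.ofReal (Real.exp (θ * (hitTime α u).toReal)) ≤ s := by
  have h1 : ∀ n, Real.exp (θ * (excess α u (List.replicate n c)).toReal) ≤ s.toReal := fun n =>
    (ENNReal.ofReal_le_iff_le_toReal hs).1 (h n)
  have hs1 : 1 ≤ s.toReal := by simpa [excess] using h1 0
  have h2 : ∀ n, (excess α u (List.replicate n c)).toReal ≤ Real.log s.toReal / θ := fun n => by
    rw [le_div_iff₀ hθ, mul_comm]
    exact (Real.le_log_iff_exp_le (by linarith)).2 (h1 n)
  have hl : 0 ≤ Real.log s.toReal / θ := div_nonneg (Real.log_nonneg hs1) hθ.le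
  have h3 : hitTime α u ≤ ENNReal.ofReal (Real.log s.toReal / θ) :=
    hitTime_le_of_excess_le c fun n =>
      (ENNReal.le_ofReal_iff_toReal_le (excess_ne_top _ _) hl).2 (h2 n)
  have hne : hitTime α u ≠ ∞ := ne_top_of_le_ne_top ENNReal.ofReal_ne_top h3
  refine ⟨hne, (ENNReal.ofReal_le_iff_le_toReal hs).2 ?_⟩
  rw [← Real.le_log_iff_exp_le (by linarith), mul_comm, ← le_div_iff₀ hθ]
  exact (ENNReal.le_ofReal_iff_toReal_le hne hl).1 h3

lemma IsExpEnvironment.hitTime_moment (hU : IsExpEnvironment U P) (hα : 0 < α) (hα1 : α < 1)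
    (hd : 1 ≤ d) : (∀ᵐ ω ∂P, hitTime α (fun z => U z ω) ≠ ∞) ∧
    ∫⁻ ω, ENNReal.ofReal (Real.exp (α * (hitTime α (fun z => U z ω)).toReal)) ∂P ≠ ∞ := by
  have := hU.isProbabilityMeasure
  let c : Fin d := ⟨0, hd⟩
  let f : ℕ → Ω → ℝ≥0∞ := fun n ω => ENNReal.ofReal (Real.exp (α *
      (excess α (fun z => U z ω) (List.replicate n c)).toReal))
  have hf : ∀ n, Measurable (f n) := fun n => by
    have := measurable_excess (α := α) (fun z _ => hU.measurable z) (List.replicate n c)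
    exact (Real.measurable_exp.comp (this.ennreal_toReal.const_mul α)).ennreal_ofReal
  -- The excess grows along the ray, so monotone convergence gives a finite mean to the supremum of
  -- the exponentials.
  have hmono : Monotone f := by
    refine monotone_nat_of_le_succ fun n ω => ?_
    refine ENNReal.ofReal_le_ofReal (Real.exp_le_exp.2 (mul_le_mul_of_nonneg_left ?_ hα.le))
    refine ENNReal.toReal_mono (excess_ne_top _ _) ?_
    rw [List.replicate_succ']
    exact excess_le_append _ _ _ _
  have hint : ∫⁻ ω, ⨆ n, f n ω ∂P ≠ ∞ := by
    rw [lintegral_iSup hf hmono]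
    refine ne_top_of_le_ne_top (b := ENNReal.ofReal (Real.exp (α / (1 - α) ^ 2)))
      ENNReal.ofReal_ne_top ?_
    exact iSup_le fun n => hU.lintegral_exp_excess_le hα hα1 c n hα.le le_rfl
  have hfin : ∀ᵐ ω ∂P, ⨆ n, f n ω < ∞ := ae_lt_top (.iSup hf) hint
  constructor
  · filter_upwards [hfin] with ω hω
    exact (exp_hitTime_le c hα hω.ne fun n => le_iSup (fun n => f n ω) n).1
  · refine ne_top_of_le_ne_top hint (lintegral_mono_ae ?_)
    filter_upwards [hfin] with ω hω
    exact (exp_hitTime_le c hα hω.ne fun n => le_iSup (fun n => f n ω) n).2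

lemma IsExpEnvironment.ae_scaledTime_ne_top (hU : IsExpEnvironment U P) (hα : 0 < α)
    (hα1 : α < 1) (hd : 1 ≤ d) : ∀ᵐ ω ∂P, ∀ x, scaledTime α (fun z => U z ω) x ≠ ∞ := by
  rw [ae_all_iff]
  intro x
  simp only [scaledTime_eq hα]
  exact ((hU.shift x).hitTime_moment hα hα1 hd).1

lemma IsExpEnvironment.ae_scaledTime_pos (hU : IsExpEnvironment U P) (hα : 0 < α)
    (hd : 1 ≤ d) : ∀ᵐ ω ∂P, ∀ x, 0 < scaledTime α (fun z => U z ω) x := by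
  filter_upwards [hU.ae_pos] with ω hω x
  have : Nonempty (Fin d) := ⟨⟨0, hd⟩⟩
  obtain ⟨c, hc⟩ := exists_eq_ciInf_of_finite
    (f := fun c => edgeTime α (fun z => U z ω) (x ++ [c]))
  rw [scaledTime_eq_iInf hα, ← hc]
  exact lt_of_lt_of_le (ENNReal.ofReal_pos.2 (hω _)) le_self_add

lemma rootLaw_Iic_zero (hα : 0 < α) (hα1 : α < 1) (hd : 1 ≤ d) :
    rootLaw d α (Set.Iic 0) = 0 := by
  have hU := isExpEnvironment_canonical d
  rw [rootLaw, Measure.map_apply _ measurableSet_Iic]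
  · have h := (hU.ae_scaledTime_pos hα hd).and (hU.ae_scaledTime_ne_top hα hα1 hd)
    refine measure_mono_null ?_ (ae_iff.1 h)
    intro u hu
    simp only [Set.mem_preimage, Set.mem_Iic] at hu
    simp only [Set.mem_ofPred_eq, not_and_or]
    by_contra! hc
    exact absurd hu (not_le.2 (ENNReal.toReal_pos (hc.1 []).ne' (hc.2 [])))
  · exact (measurable_scaledTime (U := fun (z : Vertex d) (u : Vertex d → ℝ) => u z) hα
      fun z _ => measurable_pi_apply _).ennreal_toReal

lemma lintegral_exp_rootLaw_ne_top (hα : 0 < α) (hα1 : α < 1) (hd : 1 ≤ d) :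
    ∫⁻ w, ENNReal.ofReal (Real.exp (α * w)) ∂(rootLaw d α) ≠ ∞ := by
  have hU := isExpEnvironment_canonical d
  rw [rootLaw, lintegral_map (by fun_prop)]
  · simp only [scaledTime_eq hα, List.nil_append]
    exact (hU.hitTime_moment hα hα1 hd).2
  · exact (measurable_scaledTime (U := fun (z : Vertex d) (u : Vertex d → ℝ) => u z) hα
      fun z _ => measurable_pi_apply _).ennreal_toReal

end Environment

end TreeDLA
end

noncomputable section

namespace TreeDLA

variable {d : ℕ}

/-! ### The law of the time through an edge -/

/-- The law of `U + α W` for `U` exponential of mean one and `W` independent of law `F`. -/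
def edgeLaw (α : ℝ) (F : Measure ℝ) : Measure ℝ :=
  ((expMeasure 1).prod F).map fun p => p.1 + α * p.2

instance (α : ℝ) (F : Measure ℝ) [IsProbabilityMeasure F] : IsProbabilityMeasure (edgeLaw α F) :=
  Measure.isProbabilityMeasure_map (by fun_prop)

instance (α : ℝ) (F : Measure ℝ) [IsProbabilityMeasure F] :
    NullSingletonClass (edgeLaw α F) where
  measure_singleton t := by
    have hm : Measurable fun p : ℝ × ℝ => p.1 + α * p.2 := by fun_prop
    rw [edgeLaw, Measure.map_apply hm (measurableSet_singleton t),
      Measure.prod_apply_symm (hm (measurableSet_singleton t))]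
    have : ∀ w : ℝ, expMeasure 1 ((fun u => (u, w)) ⁻¹'
        ((fun p : ℝ × ℝ => p.1 + α * p.2) ⁻¹' {t})) = 0 := by
      intro w
      refine measure_mono_null (t := {t - α * w}) ?_ (measure_singleton _)
      intro u hu
      simp only [Set.mem_preimage, Set.mem_singleton_iff] at hu ⊢
      linarith
    simp [this]

/-- The properties of the law of `W_0` that are used below. -/
structure IsTreeLaw (d : ℕ) (α : ℝ) (F : Measure ℝ) : Prop where
  isProbabilityMeasure : IsProbabilityMeasure F
  measure_Iic_zero : F (Set.Iic 0) = 0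
  lintegral_exp_ne_top : ∫⁻ w, ENNReal.ofReal (Real.exp (α * w)) ∂F ≠ ∞
  measure_Ioi : ∀ t, F (Set.Ioi t) = edgeLaw α F (Set.Ioi t) ^ d

section Environment

variable {Ω : Type*} {α : ℝ}

lemma measurable_scaledTime_onSubtree (hα : 0 < α) (U : Vertex d → Ω → ℝ) (y : Vertex d) :
    Measurable[onSubtree U y] fun ω => scaledTime α (fun z => U z ω) y :=
  @measurable_scaledTime d Ω (onSubtree U y) α hα U y fun z _ =>
    measurable_biSup_comap (List.prefix_append y z)

lemma measurable_edgeTime_onSubtree (hα : 0 < α) (U : Vertex d → Ω → ℝ) (y : Vertex d) :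
    Measurable[onSubtree U y] fun ω => edgeTime α (fun z => U z ω) y :=
  @measurable_edgeTime d Ω (onSubtree U y) α hα U y fun z =>
    measurable_biSup_comap (List.prefix_append y z)

/-- Neither the ancestors nor the descendants of another vertex of the same generation lie in the
subtree of `y`. -/
lemma measurable_totalTime_offSubtree (hα : 0 < α) (U : Vertex d → Ω → ℝ) {y y' : Vertex d}
    (hlen : y'.length = y.length) (hne : y' ≠ y) :
    Measurable[offSubtree U y] fun ω => totalTime α (fun z => U z ω) y' := by
  refine @measurable_totalTime d Ω (offSubtree U y) α hα U y' (fun k => ?_) fun z _ => ?_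
  · refine measurable_biSup_comap fun h => hne ?_
    exact (h.trans (List.take_prefix k y')).eq_of_length hlen.symm |>.symm
  · refine measurable_biSup_comap fun h => hne ?_
    exact (List.prefix_of_prefix_length_le h (List.prefix_append y' z)
      hlen.symm.le).eq_of_length hlen.symm |>.symm

lemma measurable_passageTime_offSubtree (U : Vertex d → Ω → ℝ) (x : Vertex d)
    (c : Fin d) : Measurable[offSubtree U (x ++ [c])] fun ω => passageTime α (fun z => U z ω) x := by
  refine @measurable_passageTime d Ω (offSubtree U (x ++ [c])) α U x fun k => ?_
  refine measurable_biSup_comap fun h => ?_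
  have := (h.trans (List.take_prefix k x)).length_le
  simp at this

variable [mΩ : MeasurableSpace Ω] {P : Measure Ω} {U : Vertex d → Ω → ℝ}

lemma IsExpEnvironment.map_prod (hU : IsExpEnvironment U P) (hα : 0 < α) (y : Vertex d) :
    P.map (fun ω => (U y ω, (scaledTime α (fun z => U z ω) y).toReal)) =
      (expMeasure 1).prod (rootLaw d α) := by
  have := hU.isProbabilityMeasure
  have hm : Measurable[⨆ z ∈ ({y}ᶜ : Set (Vertex d)), MeasurableSpace.comap (U z) inferInstance]
      fun ω => (scaledTime α (fun z => U z ω) y).toReal := by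
    refine Measurable.ennreal_toReal ?_
    refine @measurable_scaledTime d Ω (⨆ z ∈ ({y}ᶜ : Set (Vertex d)),
      MeasurableSpace.comap (U z) inferInstance) α hα U y fun z hz => ?_
    exact measurable_biSup_comap (by simpa using hz)
  have hind : IndepFun (U y) (fun ω => (scaledTime α (fun z => U z ω) y).toReal) P := by
    have := indep_iSup_of_disjoint (fun z => (hU.measurable z).comap_le) hU.indep
      (S := {y}) (T := {y}ᶜ) disjoint_compl_right
    refine indep_of_indep_of_le_left (indep_of_indep_of_le_right this hm.comap_le) ?_
    have h3 : Measurable[⨆ z ∈ ({y} : Set (Vertex d)),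
      MeasurableSpace.comap (U z) inferInstance] (U y) := measurable_biSup_comap rfl
    exact h3.comap_le
  rw [hind.map_prod_eq_prod_map_map (hU.measurable y).aemeasurable
    (hm.mono (hU.biSup_comap_le _) le_rfl).aemeasurable, hU.law, hU.map_scaledTime hα]

lemma IsExpEnvironment.ae_edgeTime_toReal (hU : IsExpEnvironment U P) (hα : 0 < α) (hα1 : α < 1)
    (hd : 1 ≤ d) : ∀ᵐ ω ∂P, ∀ y, edgeTime α (fun z => U z ω) y ≠ ∞ ∧
      (edgeTime α (fun z => U z ω) y).toReal =
        U y ω + α * (scaledTime α (fun z => U z ω) y).toReal := by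
  filter_upwards [hU.ae_pos, hU.ae_scaledTime_ne_top hα hα1 hd] with ω h1 h2 y
  have h3 : ENNReal.ofReal α * scaledTime α (fun z => U z ω) y ≠ ∞ :=
    ENNReal.mul_ne_top ENNReal.ofReal_ne_top (h2 y)
  rw [edgeTime]
  refine ⟨ENNReal.add_ne_top.2 ⟨ENNReal.ofReal_ne_top, h3⟩, ?_⟩
  rw [ENNReal.toReal_add ENNReal.ofReal_ne_top h3, ENNReal.toReal_mul,
    ENNReal.toReal_ofReal (h1 y).le, ENNReal.toReal_ofReal hα.le]

lemma IsExpEnvironment.map_edgeTime_prod (hU : IsExpEnvironment U P) (hα : 0 < α) (hα1 : α < 1)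
    (hd : 1 ≤ d) (y : Vertex d) :
    P.map (fun ω => ((edgeTime α (fun z => U z ω) y).toReal,
        (scaledTime α (fun z => U z ω) y).toReal)) =
      ((expMeasure 1).prod (rootLaw d α)).map fun p => (p.1 + α * p.2, p.2) := by
  rw [← hU.map_prod hα y, Measure.map_map (by fun_prop)]
  · refine Measure.map_congr ?_
    filter_upwards [hU.ae_edgeTime_toReal hα hα1 hd] with ω hω
    simp only [Function.comp_apply]
    rw [(hω y).2]
  · exact (hU.measurable y).prodMk
      (measurable_scaledTime hα fun z _ => hU.measurable _).ennreal_toReal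

lemma IsExpEnvironment.map_edgeTime (hU : IsExpEnvironment U P) (hα : 0 < α) (hα1 : α < 1)
    (hd : 1 ≤ d) (y : Vertex d) :
    P.map (fun ω => (edgeTime α (fun z => U z ω) y).toReal) = edgeLaw α (rootLaw d α) := by
  have h1 := (measurable_edgeTime hα (U := U) (x := y) fun z => hU.measurable _).ennreal_toReal
  have h2 := (measurable_scaledTime hα (U := U) (x := y) fun z _ => hU.measurable _).ennreal_toReal
  have h := congrArg (Measure.map Prod.fst) (hU.map_edgeTime_prod hα hα1 hd y)
  rw [Measure.map_map measurable_fst (h1.prodMk h2),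
    Measure.map_map measurable_fst (by fun_prop)] at h
  exact h

lemma measure_eq_of_indepFun {X Y : Ω → ℝ} [IsProbabilityMeasure P] (hX : Measurable X)
    (hY : Measurable Y) (h : IndepFun X Y P) [NullSingletonClass (P.map X)] :
    P {ω | X ω = Y ω} = 0 := by
  have h1 := (indepFun_iff_map_prod_eq_prod_map_map hX.aemeasurable hY.aemeasurable).1 h
  have hD : MeasurableSet {p : ℝ × ℝ | p.1 = p.2} := measurableSet_eq_fun measurable_fst
    measurable_snd
  have h2 : P {ω | X ω = Y ω} = P.map (fun ω => (X ω, Y ω)) {p : ℝ × ℝ | p.1 = p.2} := by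
    rw [Measure.map_apply (hX.prodMk hY) hD]
    rfl
  have := Measure.isProbabilityMeasure_map (μ := P) hX.aemeasurable
  have := Measure.isProbabilityMeasure_map (μ := P) hY.aemeasurable
  rw [h2, h1, Measure.prod_apply_symm hD]
  simp

/-- A tie would determine the time through the edge into `y` by the weights off the subtree of `y`.
The two are independent and the law of the edge time has no atoms. -/
lemma IsExpEnvironment.ae_totalTime_ne (hU : IsExpEnvironment U P) (hα : 0 < α) (hα1 : α < 1)
    (hd : 1 ≤ d) {y y' : Vertex d} (hlen : y'.length = y.length) (hne : y' ≠ y) :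
    ∀ᵐ ω ∂P, totalTime α (fun z => U z ω) y ≠ totalTime α (fun z => U z ω) y' := by
  have := hU.isProbabilityMeasure
  obtain ⟨x, c, rfl⟩ : ∃ x c, y = x ++ [c] := by
    rcases List.eq_nil_or_concat y with h | ⟨x, c, h⟩
    · subst h
      exact absurd (List.length_eq_zero_iff.1 hlen) hne
    · exact ⟨x, c, by simpa using h⟩
  have hm1 := (measurable_edgeTime_onSubtree hα U (x ++ [c])).ennreal_toReal
  have hm2 : Measurable[offSubtree U (x ++ [c])] fun ω =>
      ((totalTime α (fun z => U z ω) y').toReal - (passageTime α (fun z => U z ω) x).toReal) /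
        α ^ (x.length + 1) :=
    ((measurable_totalTime_offSubtree hα U hlen hne).ennreal_toReal.sub
      (measurable_passageTime_offSubtree U x c).ennreal_toReal).div_const _
  have hind : IndepFun (fun ω => (edgeTime α (fun z => U z ω) (x ++ [c])).toReal) (fun ω =>
      ((totalTime α (fun z => U z ω) y').toReal - (passageTime α (fun z => U z ω) x).toReal) /
        α ^ (x.length + 1)) P :=
    (indep_of_indep_of_le_left (indep_of_indep_of_le_right (hU.indep_subtree _)
      hm1.comap_le) hm2.comap_le).symm
  have : NullSingletonClass (P.map fun ω => (edgeTime α (fun z => U z ω) (x ++ [c])).toReal) := by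
    have := isProbabilityMeasure_rootLaw d hα
    rw [hU.map_edgeTime hα hα1 hd]
    infer_instance
  have h0 := measure_eq_of_indepFun (hm1.mono (hU.biSup_comap_le _) le_rfl)
    (hm2.mono (hU.biSup_comap_le _) le_rfl) hind
  have h0' := measure_eq_zero_iff_ae_notMem.1 h0
  filter_upwards [h0', hU.ae_edgeTime_toReal hα hα1 hd] with ω hω h1 heq
  apply hω
  have hp : 0 < α ^ (x.length + 1) := by positivity
  rw [← heq, totalTime_concat hα, ENNReal.toReal_add (passageTime_ne_top _ _ _)
    (ENNReal.mul_ne_top ENNReal.ofReal_ne_top (h1 _).1), ENNReal.toReal_mul,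
    ENNReal.toReal_ofReal hp.le]
  field_simp
  ring

theorem IsExpEnvironment.ae_isGeneric (hU : IsExpEnvironment U P) (hα : 0 < α) (hα1 : α < 1)
    (hd : 1 ≤ d) : ∀ᵐ ω ∂P, IsGeneric α fun z => U z ω := by
  have h : ∀ᵐ ω ∂P, ∀ y y' : Vertex d, y.length = y'.length → y ≠ y' →
      totalTime α (fun z => U z ω) y ≠ totalTime α (fun z => U z ω) y' := by
    simp only [ae_all_iff]
    intro y y' hlen hne
    exact hU.ae_totalTime_ne hα hα1 hd hlen.symm hne.symm
  filter_upwards [h, hU.ae_scaledTime_pos hα hd, hU.ae_scaledTime_ne_top hα hα1 hd]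
    with ω h1 h2 h3
  exact ⟨h2, h3, h1⟩

/-! ### The distributional identity for the root. -/

lemma IsExpEnvironment.measure_edgeTime_gt (hU : IsExpEnvironment U P) (hα : 0 < α) (hα1 : α < 1)
    (hd : 1 ≤ d) (t : ℝ) (s : Finset (Fin d)) :
    P {ω | ∀ c ∈ s, t < (edgeTime α (fun z => U z ω) [c]).toReal} =
      edgeLaw α (rootLaw d α) (Set.Ioi t) ^ s.card := by
  classical
  have := hU.isProbabilityMeasure
  induction s using Finset.induction_on with
  | empty => simp
  | insert c s hc ih =>
    have h1 : {ω | ∀ c' ∈ insert c s, t < (edgeTime α (fun z => U z ω) [c']).toReal} =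
        {ω | ∀ c' ∈ s, t < (edgeTime α (fun z => U z ω) [c']).toReal} ∩
        {ω | t < (edgeTime α (fun z => U z ω) [c]).toReal} := by
      ext ω
      simp [and_comm]
    have hm1 : MeasurableSet[onSubtree U [c]] {ω | t < (edgeTime α (fun z => U z ω) [c]).toReal} :=
      (measurable_edgeTime_onSubtree hα U [c]).ennreal_toReal measurableSet_Ioi
    have hm2 : MeasurableSet[offSubtree U [c]]
        {ω | ∀ c' ∈ s, t < (edgeTime α (fun z => U z ω) [c']).toReal} := by
      simp only [Set.ofPred_forall]
      refine MeasurableSet.biInter s.countable_toSet fun c' hc' => ?_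
      have : Measurable[offSubtree U [c]] fun ω => edgeTime α (fun z => U z ω) [c'] := by
        refine @measurable_edgeTime d Ω (offSubtree U [c]) α hα U [c'] fun z => ?_
        refine measurable_biSup_comap fun h => hc ?_
        have : c = c' := by simpa [List.cons_prefix_cons] using h
        exact this ▸ hc'
      exact this.ennreal_toReal measurableSet_Ioi
    rw [h1, (Indep_iff _ _ P).1 (hU.indep_subtree [c]) _ _ hm2 hm1, ih,
      Finset.card_insert_of_notMem hc, pow_succ, ← hU.map_edgeTime hα hα1 hd [c],
      Measure.map_apply ?_ measurableSet_Ioi]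
    · rfl
    · exact (measurable_edgeTime hα fun z => hU.measurable _).ennreal_toReal

theorem isTreeLaw_rootLaw (hα : 0 < α) (hα1 : α < 1) (hd : 1 ≤ d) :
    IsTreeLaw d α (rootLaw d α) where
  isProbabilityMeasure := isProbabilityMeasure_rootLaw d hα
  measure_Iic_zero := rootLaw_Iic_zero hα hα1 hd
  lintegral_exp_ne_top := lintegral_exp_rootLaw_ne_top hα hα1 hd
  measure_Ioi t := by
    have hU := isExpEnvironment_canonical d
    have : Nonempty (Fin d) := ⟨⟨0, hd⟩⟩
    have h := hU.measure_edgeTime_gt hα hα1 hd t Finset.univ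
    rw [Finset.card_univ, Fintype.card_fin] at h
    rw [← h, rootLaw, Measure.map_apply ?_ measurableSet_Ioi]
    · refine measure_congr ?_
      filter_upwards [hU.ae_edgeTime_toReal hα hα1 hd] with u hu
      refine propext ?_
      show t < (scaledTime α u []).toReal ↔
        ∀ c ∈ Finset.univ, t < (edgeTime α u [c]).toReal
      rw [scaledTime_eq_iInf hα]
      obtain ⟨c, hc⟩ := exists_eq_ciInf_of_finite (f := fun c => edgeTime α u ([] ++ [c]))
      constructor
      · exact fun h c _ => h.trans_le (ENNReal.toReal_mono (hu [c]).1 (iInf_le _ c))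
      · intro h
        rw [← hc]
        exact h c (Finset.mem_univ c)
    · exact (measurable_scaledTime (U := fun (z : Vertex d) (u : Vertex d → ℝ) => u z) hα
        fun z _ => measurable_pi_apply _).ennreal_toReal

end Environment

end TreeDLA
end

noncomputable section

namespace TreeDLA

variable {d : ℕ} {α : ℝ} {F : Measure ℝ}

/-! ### The exponentially weighted law and the kernel -/

/-- The measure `e^{α w} F(dw)`, which is proportional to `tiltedLaw α F`. -/
def expWeight (α : ℝ) (F : Measure ℝ) : Measure ℝ :=
  F.withDensity fun w => ENNReal.ofReal (Real.exp (α * w))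

/-- The transition kernel built from the law `F`. -/
def treeKernel (α : ℝ) (F : Measure ℝ) : Kernel ℝ ℝ := condKernel α (tiltedLaw α F)

lemma condKernel_apply (α : ℝ) (L : Measure ℝ) (w : ℝ) :
    condKernel α L w = L[|Set.Ioo 0 (w / α)] := rfl

instance (α : ℝ) (L : Measure ℝ) : IsFiniteKernel (condKernel α L) where
  exists_univ_le := by
    refine ⟨1, ENNReal.one_lt_top, fun w => ?_⟩
    rw [condKernel_apply, cond_apply measurableSet_Ioo, Set.inter_univ]
    exact ENNReal.inv_mul_le_one _

instance (α : ℝ) (F : Measure ℝ) : IsFiniteKernel (treeKernel α F) := by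
  unfold treeKernel; infer_instance

/-- Conditioning is insensitive to normalisation, so the unnormalised weight `e^{αw} F(dw)` can
replace `Λ` everywhere. -/
lemma cond_smul {μ : Measure ℝ} {c : ℝ≥0∞} (h0 : c ≠ 0) (h1 : c ≠ ∞) (s : Set ℝ) :
    (c • μ)[|s] = μ[|s] := by
  rw [ProbabilityTheory.cond, ProbabilityTheory.cond, Measure.smul_apply, smul_eq_mul, Measure.restrict_smul, smul_smul,
    ENNReal.mul_inv (Or.inl h0) (Or.inl h1), mul_right_comm, ENNReal.inv_mul_cancel h0 h1, one_mul]

lemma expWeight_apply {B : Set ℝ} (hB : MeasurableSet B) :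
    expWeight α F B = ∫⁻ w in B, ENNReal.ofReal (Real.exp (α * w)) ∂F :=
  withDensity_apply _ hB

lemma measurable_expWeight_Ioo (α : ℝ) (F : Measure ℝ) (B : Set ℝ) :
    Measurable fun v : ℝ => expWeight α F (Set.Ioo 0 (v / α) ∩ B) := by
  have hm : Monotone fun t : ℝ => expWeight α F (Set.Ioo 0 t ∩ B) := fun a b hab =>
    measure_mono (Set.inter_subset_inter_left _ (Set.Ioo_subset_Ioo_right hab))
  exact hm.measurable.comp (measurable_id.div_const α)

namespace IsTreeLaw

variable (hF : IsTreeLaw d α F)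
include hF

lemma integrable_exp : Integrable (fun w => Real.exp (α * w)) F := by
  refine ⟨by fun_prop, ?_⟩
  rw [hasFiniteIntegral_iff_ofReal (Eventually.of_forall fun w => (Real.exp_pos _).le)]
  exact hF.lintegral_exp_ne_top.lt_top

lemma isFiniteMeasure_expWeight : IsFiniteMeasure (expWeight α F) := by
  refine ⟨?_⟩
  rw [expWeight_apply MeasurableSet.univ, setLIntegral_univ]
  exact hF.lintegral_exp_ne_top.lt_top

lemma treeKernel_apply (w : ℝ) :
    treeKernel α F w = (expWeight α F)[|Set.Ioo 0 (w / α)] := by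
  have := hF.isProbabilityMeasure
  have hpos : 0 < ∫ w, Real.exp (α * w) ∂F := integral_exp_pos hF.integrable_exp
  have hlaw : tiltedLaw α F = (ENNReal.ofReal (∫ w, Real.exp (α * w) ∂F))⁻¹ • expWeight α F := by
    rw [tiltedLaw, Measure.tilted, expWeight, ← withDensity_smul _ (by fun_prop)]
    congr 1
    funext w
    rw [ENNReal.ofReal_div_of_pos hpos, Pi.smul_apply, smul_eq_mul, div_eq_mul_inv,
      mul_comm (ENNReal.ofReal _)]
  rw [treeKernel, condKernel_apply, hlaw, cond_smul]
  · exact ENNReal.inv_ne_zero.2 ENNReal.ofReal_ne_top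
  · exact ENNReal.inv_ne_top.2 (ENNReal.ofReal_pos.2 hpos).ne'

lemma treeKernel_apply_apply (w : ℝ) (B : Set ℝ) :
    treeKernel α F w B = (expWeight α F (Set.Ioo 0 (w / α)))⁻¹ *
      expWeight α F (Set.Ioo 0 (w / α) ∩ B) := by
  rw [hF.treeKernel_apply, cond_apply measurableSet_Ioo]

/-- Left limits of the identity for open half-lines. -/
lemma measure_Ici (t : ℝ) : F (Set.Ici t) = edgeLaw α F (Set.Ici t) ^ d := by
  have := hF.isProbabilityMeasure
  have hset : ∀ t : ℝ, Set.Ici t = ⋂ n : ℕ, Set.Ioi (t - 1 / (n + 1)) := by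
    intro t
    ext x
    simp only [Set.mem_Ici, Set.mem_iInter, Set.mem_Ioi]
    refine ⟨fun h n => ?_, fun h => ?_⟩
    · have : (0 : ℝ) < 1 / (n + 1) := by positivity
      linarith
    · refine le_of_forall_pos_le_add fun ε hε => ?_
      obtain ⟨n, hn⟩ := exists_nat_one_div_lt hε
      linarith [h n]
  have hanti : ∀ t : ℝ, Antitone fun n : ℕ => Set.Ioi (t - 1 / ((n : ℝ) + 1)) := by
    intro t m n hmn
    refine Set.Ioi_subset_Ioi ?_
    have : 1 / ((n : ℝ) + 1) ≤ 1 / (m + 1) := by gcongr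
    linarith
  have h : ∀ (μ : Measure ℝ) [IsProbabilityMeasure μ],
      Tendsto (fun n : ℕ => μ (Set.Ioi (t - 1 / ((n : ℝ) + 1)))) atTop (𝓝 (μ (Set.Ici t))) := by
    intro μ _
    rw [hset t]
    exact tendsto_measure_iInter_atTop (fun n => measurableSet_Ioi.nullMeasurableSet) (hanti t)
      ⟨0, measure_ne_top _ _⟩
  have h1 := h F
  have h2 := ((ENNReal.continuous_pow d).tendsto _).comp (h (edgeLaw α F))
  refine tendsto_nhds_unique h1 (h2.congr fun n => ?_)
  exact (hF.measure_Ioi _).symm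

/-- The open and closed half-line identities have equal right-hand sides because `edgeLaw` has no
atoms; hence `F` has none. -/
lemma nullSingletonClass : NullSingletonClass F where
  measure_singleton t := by
    have := hF.isProbabilityMeasure
    have h : F (Set.Ici t) = F (Set.Ioi t) := by
      rw [hF.measure_Ici, hF.measure_Ioi, measure_congr Ioi_ae_eq_Ici]
    have h2 : F (Set.Ici t) = F {t} + F (Set.Ioi t) := by
      rw [← Set.Icc_self t, ← measure_union _ measurableSet_Ioi]
      · rw [Set.Icc_union_Ioi_eq_Ici le_rfl]
      · rw [Set.disjoint_left]
        intro x hx hx'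
        exact absurd hx' (not_lt.2 hx.2)
    rw [h2] at h
    have h3 : F {t} + F (Set.Ioi t) = 0 + F (Set.Ioi t) := by rw [h, zero_add]
    exact (ENNReal.add_left_inj (measure_ne_top _ _)).1 h3

lemma nullSingletonClass_expWeight : NullSingletonClass (expWeight α F) := by
  have := hF.nullSingletonClass
  unfold expWeight
  infer_instance

lemma ae_pos : ∀ᵐ w ∂F, 0 < w := by
  rw [ae_iff]
  convert hF.measure_Iic_zero using 2
  ext w
  simp

/-- The joint law of `(U + α W, W)` disintegrated with respect to Lebesgue measure. -/
lemma map_prod_apply {S B : Set ℝ} (hS : MeasurableSet S)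
    (hB : MeasurableSet B) :
    (((expMeasure 1).prod F).map fun p => (p.1 + α * p.2, p.2)) (S ×ˢ B) =
      ∫⁻ v in S, ENNReal.ofReal (Real.exp (-v)) * expWeight α F ({w | α * w ≤ v} ∩ B) := by
  have := hF.isProbabilityMeasure
  have hm : Measurable fun p : ℝ × ℝ => (p.1 + α * p.2, p.2) := by fun_prop
  have hT : MeasurableSet {p : ℝ × ℝ | α * p.2 ≤ p.1} := measurableSet_le (by fun_prop) (by fun_prop)
  have hTv : ∀ v : ℝ, MeasurableSet {w : ℝ | α * w ≤ v} := fun v =>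
    measurableSet_le (by fun_prop) (by fun_prop)
  rw [Measure.map_apply hm (hS.prod hB), Measure.prod_apply_symm (hm (hS.prod hB))]
  -- For fixed `w`, substitute `v = u + αw`: the density `e^{-u}` on `u ≥ 0` becomes `e^{-v} e^{αw}`
  -- on `αw ≤ v`. This is where the exponential weight in `Λ` comes from.
  have h1 : ∀ w : ℝ, expMeasure 1 ((fun u => (u, w)) ⁻¹'
      ((fun p : ℝ × ℝ => (p.1 + α * p.2, p.2)) ⁻¹' (S ×ˢ B))) =
      B.indicator 1 w * ∫⁻ v, S.indicator 1 v * (ENNReal.ofReal (Real.exp (-v)) *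
        ({w | α * w ≤ v}.indicator (fun w => ENNReal.ofReal (Real.exp (α * w))) w)) := by
    intro w
    by_cases hw : w ∈ B
    · have : (fun u => (u, w)) ⁻¹' ((fun p : ℝ × ℝ => (p.1 + α * p.2, p.2)) ⁻¹' (S ×ˢ B)) =
          (fun u => u + α * w) ⁻¹' S := by
        ext u
        simp [hw]
      have hSw : MeasurableSet ((fun u => u + α * w) ⁻¹' S) :=
        (measurable_id.add_const (α * w)) hS
      rw [this, expMeasure_eq, withDensity_apply _ hSw, ← lintegral_indicator hSw,
        Set.indicator_of_mem hw, Pi.one_apply, one_mul,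
        ← lintegral_add_right_eq_self (fun v => S.indicator 1 v * (ENNReal.ofReal (Real.exp (-v)) *
          {w | α * w ≤ v}.indicator (fun w => ENNReal.ofReal (Real.exp (α * w))) w)) (α * w)]
      refine lintegral_congr fun u => ?_
      by_cases hu : u + α * w ∈ S
      · rw [Set.indicator_of_mem (show u ∈ (fun u => u + α * w) ⁻¹' S from hu),
          Set.indicator_of_mem hu, exponentialPDF_eq]
        by_cases hu0 : 0 ≤ u
        · rw [if_pos hu0, Set.indicator_of_mem (show w ∈ {w' | α * w' ≤ u + α * w} by
            simp [hu0]), ← ENNReal.ofReal_mul (by positivity), ← Real.exp_add]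
          simp
        · rw [if_neg hu0, Set.indicator_of_notMem (show w ∉ {w' | α * w' ≤ u + α * w} by
            simpa using hu0)]
          simp
      · rw [Set.indicator_of_notMem (show u ∉ (fun u => u + α * w) ⁻¹' S from hu),
          Set.indicator_of_notMem hu, zero_mul]
    · have : (fun u => (u, w)) ⁻¹' ((fun p : ℝ × ℝ => (p.1 + α * p.2, p.2)) ⁻¹' (S ×ˢ B)) = ∅ := by
        ext u
        simp [hw]
      rw [this, measure_empty, Set.indicator_of_notMem hw, zero_mul]
  simp only [h1]
  have hk : Measurable fun p : ℝ × ℝ => {p : ℝ × ℝ | α * p.2 ≤ p.1}.indicator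
      (fun p => ENNReal.ofReal (Real.exp (α * p.2))) p := by
    refine Measurable.indicator ?_ hT
    fun_prop
  have hk' : ∀ p : ℝ × ℝ, {p : ℝ × ℝ | α * p.2 ≤ p.1}.indicator
      (fun p => ENNReal.ofReal (Real.exp (α * p.2))) p =
      ({w | α * w ≤ p.1}.indicator (fun w => ENNReal.ofReal (Real.exp (α * w))) p.2) := fun p => rfl
  simp only [hk'] at hk
  have hBm : Measurable (B.indicator (1 : ℝ → ℝ≥0∞)) := measurable_one.indicator hB
  have hSm : Measurable (S.indicator (1 : ℝ → ℝ≥0∞)) := measurable_one.indicator hS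
  have hfull : Measurable fun p : ℝ × ℝ => S.indicator (1 : ℝ → ℝ≥0∞) p.1 *
      (ENNReal.ofReal (Real.exp (-p.1)) *
        ({w | α * w ≤ p.1}.indicator (fun w => ENNReal.ofReal (Real.exp (α * w))) p.2)) :=
    (hSm.comp measurable_fst).mul (Measurable.mul (by fun_prop) hk)
  have hslice : ∀ w : ℝ, Measurable fun v : ℝ => S.indicator (1 : ℝ → ℝ≥0∞) v *
      (ENNReal.ofReal (Real.exp (-v)) *
        ({w | α * w ≤ v}.indicator (fun w => ENNReal.ofReal (Real.exp (α * w))) w)) := fun w =>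
    hfull.comp (measurable_id.prodMk measurable_const)
  simp only [← lintegral_const_mul _ (hslice _)]
  rw [lintegral_lintegral_swap]
  · rw [← lintegral_indicator hS]
    refine lintegral_congr fun v => ?_
    by_cases hv : v ∈ S
    · rw [Set.indicator_of_mem hv, Set.indicator_of_mem hv, expWeight_apply ((hTv v).inter hB),
        ← lintegral_indicator ((hTv v).inter hB), ← lintegral_const_mul _ (by
        exact Measurable.indicator (by fun_prop) ((hTv v).inter hB))]
      refine lintegral_congr fun w => ?_
      rw [Set.inter_comm, ← Set.indicator_indicator, Pi.one_apply,
        one_mul]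
      by_cases hw : w ∈ B <;> simp [hw]
    · rw [Set.indicator_of_notMem hv]
      simp [hv]
  · exact ((hBm.comp measurable_fst).mul (hfull.comp measurable_swap)).aemeasurable

lemma expWeight_le_eq_Ioo (hα : 0 < α) (v : ℝ) (B : Set ℝ) :
    expWeight α F ({w | α * w ≤ v} ∩ B) = expWeight α F (Set.Ioo 0 (v / α) ∩ B) := by
  have := hF.nullSingletonClass_expWeight
  have h0 : expWeight α F (Set.Iic 0) = 0 :=
    withDensity_absolutelyContinuous _ _ hF.measure_Iic_zero
  have h1 : ∀ᵐ w ∂(expWeight α F), 0 < w := by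
    rw [ae_iff]
    convert h0 using 2
    ext w
    simp
  have h2 : ∀ᵐ w ∂(expWeight α F), w ≠ v / α := by
    rw [ae_iff]
    simp
  refine measure_congr ?_
  filter_upwards [h1, h2] with w hw1 hw2
  refine propext ?_
  show (α * w ≤ v ∧ w ∈ B) ↔ ((0 < w ∧ w < v / α) ∧ w ∈ B)
  have : α * w ≤ v ↔ w ≤ v / α := by rw [le_div_iff₀ hα, mul_comm]
  rw [this]
  constructor
  · rintro ⟨h, hB⟩
    exact ⟨⟨hw1, lt_of_le_of_ne h hw2⟩, hB⟩
  · rintro ⟨⟨-, h⟩, hB⟩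
    exact ⟨h.le, hB⟩

lemma edgeLaw_eq (hα : 0 < α) : edgeLaw α F = volume.withDensity fun v =>
    ENNReal.ofReal (Real.exp (-v)) * expWeight α F (Set.Ioo 0 (v / α)) := by
  ext S hS
  have hm : Measurable fun p : ℝ × ℝ => (p.1 + α * p.2, p.2) := by fun_prop
  have h := hF.map_prod_apply hS MeasurableSet.univ
  rw [withDensity_apply _ hS, edgeLaw, Measure.map_apply (by fun_prop) hS]
  rw [Measure.map_apply hm (hS.prod MeasurableSet.univ)] at h
  convert h using 1
  · congr 1
    ext p
    simp
  · refine lintegral_congr fun v => ?_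
    rw [hF.expWeight_le_eq_Ioo hα, Set.inter_univ]

/-- Given `U + α W`, the conditional law of `W` is the kernel. -/
theorem map_prod_eq_compProd (hα : 0 < α) :
    (((expMeasure 1).prod F).map fun p => (p.1 + α * p.2, p.2)) =
      (edgeLaw α F) ⊗ₘ (treeKernel α F) := by
  have := hF.isProbabilityMeasure
  have := hF.isFiniteMeasure_expWeight
  have hp : IsProbabilityMeasure
      (((expMeasure 1).prod F).map fun p : ℝ × ℝ => (p.1 + α * p.2, p.2)) :=
    Measure.isProbabilityMeasure_map (by fun_prop)
  refine Measure.ext_prod fun {S B} hS hB => ?_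
  have hm1 := measurable_expWeight_Ioo α F Set.univ
  simp only [Set.inter_univ] at hm1
  rw [hF.map_prod_apply hS hB, Measure.compProd_apply_prod hS hB, hF.edgeLaw_eq hα,
    setLIntegral_withDensity_eq_setLIntegral_mul _ ?_ (Kernel.measurable_coe _ hB) hS]
  · refine lintegral_congr fun v => ?_
    rw [hF.expWeight_le_eq_Ioo hα, Pi.mul_apply, hF.treeKernel_apply_apply, mul_assoc]
    congr 1
    -- Where the conditioning interval is null both sides vanish, so positivity of its mass is not
    -- needed yet.
    by_cases h0 : expWeight α F (Set.Ioo 0 (v / α)) = 0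
    · rw [h0, zero_mul]
      exact measure_mono_null Set.inter_subset_left h0
    · rw [← mul_assoc, ENNReal.mul_inv_cancel h0 (measure_ne_top _ _), one_mul]
  · exact Measurable.mul (by fun_prop) hm1

/-- Second marginals of the disintegration. Started from the law of `U + αW`, one step of the kernel
gives `F`, which makes this law a virtual state before `W_0`. -/
theorem edgeLaw_bind (hα : 0 < α) : (edgeLaw α F).bind (treeKernel α F) = F := by
  have := hF.isProbabilityMeasure
  have h := congrArg Measure.snd (hF.map_prod_eq_compProd hα)
  rw [Measure.snd_compProd] at h
  rw [← h, Measure.snd, Measure.map_map measurable_snd (by fun_prop)]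
  change ((expMeasure 1).prod F).map Prod.snd = F
  rw [Measure.map_snd_prod, measure_univ, one_smul]

/-! ### Positivity near the origin and the exponential tail -/

/-- The minimum of `d` copies is below `t` at least as often as a single `U + αW`, and this is below
`t` when `W < s` and `U` is at most half the gap `t - αs`. -/
lemma measure_Iio_pos_of (hd : 1 ≤ d) {s t : ℝ} (hs : 0 < F (Set.Iio s)) (hst : α * s < t)
    (hα : 0 < α) : 0 < F (Set.Iio t) := by
  have := hF.isProbabilityMeasure
  have h1 : edgeLaw α F (Set.Iio t) ≤ F (Set.Iio t) := by
    rw [← Set.compl_Ici, prob_compl_eq_one_sub measurableSet_Ici,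
      prob_compl_eq_one_sub measurableSet_Ici, hF.measure_Ici]
    refine tsub_le_tsub_left ?_ _
    exact pow_le_of_le_one zero_le prob_le_one (by omega)
  refine lt_of_lt_of_le ?_ h1
  have hr : 0 < (t - α * s) / 2 := by linarith
  have h2 : 0 < expMeasure 1 (Set.Iic ((t - α * s) / 2)) := by
    have h := cdf_expMeasure_eq one_pos ((t - α * s) / 2)
    rw [if_pos hr.le, cdf_eq_real] at h
    by_contra h0
    have h0' : expMeasure 1 (Set.Iic ((t - α * s) / 2)) = 0 := by simpa using h0
    rw [measureReal_def, h0', ENNReal.toReal_zero] at h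
    have : Real.exp (-(1 * ((t - α * s) / 2))) < 1 := Real.exp_lt_one_iff.2 (by linarith)
    linarith
  have hm : Measurable fun p : ℝ × ℝ => p.1 + α * p.2 := by fun_prop
  rw [edgeLaw, Measure.map_apply hm measurableSet_Iio]
  refine lt_of_lt_of_le (ENNReal.mul_pos h2.ne' hs.ne') ?_
  rw [← Measure.prod_prod]
  refine measure_mono ?_
  rintro ⟨u, w⟩ ⟨hu, hw⟩
  simp only [Set.mem_Iic, Set.mem_Iio, Set.mem_preimage] at hu hw ⊢
  nlinarith

theorem measure_Ioo_pos (hα : 0 < α) (hα1 : α < 1) (hd : 1 ≤ d) {t : ℝ} (ht : 0 < t) :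
    0 < F (Set.Ioo 0 t) := by
  have := hF.isProbabilityMeasure
  have hex : ∃ s : ℝ, 0 < s ∧ 0 < F (Set.Iio s) := by
    by_contra! h
    have hu : (Set.univ : Set ℝ) = ⋃ n : ℕ, Set.Iio ((n : ℝ) + 1) := by
      ext x
      obtain ⟨n, hn⟩ := exists_nat_gt x
      simp only [Set.mem_univ, Set.mem_iUnion, Set.mem_Iio, true_iff]
      exact ⟨n, by linarith⟩
    have h0 : F Set.univ = 0 := by
      rw [hu]
      exact measure_iUnion_null fun n => le_antisymm (h _ (by positivity)) zero_le
    simp at h0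
  obtain ⟨s, hs0, hs⟩ := hex
  -- Any ratio strictly between `α` and `1` works: the strict inequality feeds the previous lemma,
  -- and the powers still tend to zero.
  have hβ : α < (1 + α) / 2 := by linarith
  have hpow : ∀ n : ℕ, 0 < F (Set.Iio (((1 + α) / 2) ^ n * s)) := by
    intro n
    induction n with
    | zero => simpa using hs
    | succ n ih =>
      refine hF.measure_Iio_pos_of hd ih ?_ hα
      rw [pow_succ', mul_assoc]
      exact mul_lt_mul_of_pos_right hβ (by positivity)
  obtain ⟨n, hn⟩ := exists_pow_lt_of_lt_one (div_pos ht hs0)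
    (show (1 + α) / 2 < 1 by linarith)
  have h1 : 0 < F (Set.Iio t) := by
    refine (hpow n).trans_le (measure_mono (Set.Iio_subset_Iio ?_))
    rw [lt_div_iff₀ hs0] at hn
    exact hn.le
  have h2 : F (Set.Iio t) = F (Set.Ioo 0 t) := by
    refine measure_congr ?_
    filter_upwards [hF.ae_pos] with w hw
    refine propext ?_
    show w < t ↔ 0 < w ∧ w < t
    exact ⟨fun h => ⟨hw, h⟩, fun h => h.2⟩
  rwa [← h2]

theorem expWeight_Ioo_pos (hα : 0 < α) (hα1 : α < 1) (hd : 1 ≤ d) {t : ℝ} (ht : 0 < t) :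
    0 < expWeight α F (Set.Ioo 0 t) := by
  refine pos_iff_ne_zero.2 fun h => ?_
  rw [expWeight, withDensity_apply_eq_zero' (by fun_prop)] at h
  have h1 : {w : ℝ | ENNReal.ofReal (Real.exp (α * w)) ≠ 0} = Set.univ := by
    ext w
    simp [Real.exp_pos]
  rw [h1, Set.univ_inter] at h
  exact (hF.measure_Ioo_pos hα hα1 hd ht).ne' h

lemma isProbabilityMeasure_treeKernel (hα : 0 < α) (hα1 : α < 1) (hd : 1 ≤ d) {w : ℝ}
    (hw : 0 < w) : IsProbabilityMeasure (treeKernel α F w) := by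
  have := hF.isFiniteMeasure_expWeight
  rw [hF.treeKernel_apply]
  exact cond_isProbabilityMeasure (hF.expWeight_Ioo_pos hα hα1 hd (div_pos hw hα)).ne'

lemma edgeLaw_Ioi_le (hα : 0 < α) (t : ℝ) :
    edgeLaw α F (Set.Ioi t) ≤ ENNReal.ofReal (Real.exp (-t)) * expWeight α F Set.univ := by
  rw [hF.edgeLaw_eq hα, withDensity_apply _ measurableSet_Ioi]
  calc ∫⁻ v in Set.Ioi t, ENNReal.ofReal (Real.exp (-v)) * expWeight α F (Set.Ioo 0 (v / α))
      ≤ ∫⁻ v in Set.Ioi t, ENNReal.ofReal (Real.exp (-v)) * expWeight α F Set.univ := by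
        refine lintegral_mono fun v => ?_
        dsimp only
        gcongr
        exact Set.subset_univ _
    _ = _ := by
        rw [lintegral_mul_const _ (by fun_prop), ← ofReal_integral_eq_lintegral_ofReal
          (integrableOn_exp_neg_Ioi t) (Eventually.of_forall fun v => (Real.exp_pos _).le),
          integral_exp_neg_Ioi]

/-- One edge time has tail of order `e^{-w}`, because `e^{αW}` has finite mean; the minimum over `d`
independent edges raises this to the power `d`. -/
theorem exists_measure_Ici_le (hα : 0 < α) : ∃ c : ℝ, 0 < c ∧ ∀ w : ℝ,
    F.real (Set.Ici w) ≤ c * Real.exp (-(d * w)) := by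
  have := hF.isProbabilityMeasure
  have := hF.isFiniteMeasure_expWeight
  have := hF.nullSingletonClass
  refine ⟨(expWeight α F).real Set.univ ^ d + 1, by positivity, fun w => ?_⟩
  have h : F.real (Set.Ici w) ≤ (Real.exp (-w) * (expWeight α F).real Set.univ) ^ d := by
    rw [measureReal_def, ← measure_congr (Ioi_ae_eq_Ici (μ := F) (a := w)), hF.measure_Ioi,
      ENNReal.toReal_pow]
    refine pow_le_pow_left₀ ENNReal.toReal_nonneg ?_ d
    refine (ENNReal.toReal_mono ?_ (hF.edgeLaw_Ioi_le hα w)).trans ?_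
    · exact ENNReal.mul_ne_top ENNReal.ofReal_ne_top (measure_ne_top _ _)
    · rw [ENNReal.toReal_mul, ENNReal.toReal_ofReal (Real.exp_pos _).le]
      rfl
  refine h.trans ?_
  rw [mul_pow, ← Real.exp_nat_mul, mul_comm]
  have : (d : ℝ) * -w = -(d * w) := by ring
  rw [this]
  gcongr
  linarith

end IsTreeLaw

end TreeDLA
end

noncomputable section

namespace TreeDLA

variable {d : ℕ} {α : ℝ} {F : Measure ℝ}

/-! ### Small ball estimates -/

lemma one_sub_pow_le {x : ℝ} (hx1 : x ≤ 1) (d : ℕ) : 1 - (1 - x) ^ d ≤ d * x := by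
  have h := one_add_mul_le_pow (a := -x) (by linarith) d
  have : (1 + -x) = 1 - x := by ring
  rw [this] at h
  linarith

/-- With the Bernoulli bound above, this shows that near the origin `F` has mass asymptotic to `d`
times that of `edgeLaw`. -/
lemma mul_pow_le_one_sub_pow {x : ℝ} (hx0 : 0 ≤ x) (hx1 : x ≤ 1) {d : ℕ} (hd : 1 ≤ d) :
    d * x * (1 - x) ^ (d - 1) ≤ 1 - (1 - x) ^ d := by
  obtain ⟨m, rfl⟩ : ∃ m, d = m + 1 := ⟨d - 1, by omega⟩
  rw [Nat.add_sub_cancel]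
  induction m with
  | zero => simp
  | succ m ih =>
    have ih := ih (by omega)
    have h1 : 0 ≤ 1 - x := by linarith
    have h2 : (1 - x) ^ (m + 1) ≤ 1 := pow_le_one₀ h1 (by linarith)
    push_cast at ih ⊢
    have h3 := mul_le_mul_of_nonneg_left ih h1
    have e1 : (1 - x) * ((↑m + 1) * x * (1 - x) ^ m) = (↑m + 1) * x * (1 - x) ^ (m + 1) := by
      ring
    have e2 : (1 - x) * (1 - (1 - x) ^ (m + 1)) = (1 - x) - (1 - x) ^ (m + 1 + 1) := by ring
    rw [e1, e2] at h3
    nlinarith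

namespace IsTreeLaw

variable (hF : IsTreeLaw d α F)
include hF

lemma measureReal_le_expWeight (hα : 0 < α) (s : ℝ) :
    F.real (Set.Ioo 0 s) ≤ (expWeight α F).real (Set.Ioo 0 s) := by
  have := hF.isProbabilityMeasure
  have := hF.isFiniteMeasure_expWeight
  refine ENNReal.toReal_mono (measure_ne_top _ _) ?_
  rw [expWeight_apply measurableSet_Ioo, ← setLIntegral_one]
  refine setLIntegral_mono (by fun_prop) fun w hw => ?_
  rw [ENNReal.one_le_ofReal]
  exact Real.one_le_exp (mul_nonneg hα.le hw.1.le)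

lemma expWeight_le_exp_mul (hα : 0 < α) (s : ℝ) :
    (expWeight α F).real (Set.Ioo 0 s) ≤ Real.exp (α * s) * F.real (Set.Ioo 0 s) := by
  have := hF.isProbabilityMeasure
  have h : expWeight α F (Set.Ioo 0 s) ≤ ENNReal.ofReal (Real.exp (α * s)) * F (Set.Ioo 0 s) := by
    rw [expWeight_apply measurableSet_Ioo, ← setLIntegral_const]
    refine setLIntegral_mono (by fun_prop) fun w hw => ?_
    exact ENNReal.ofReal_le_ofReal (Real.exp_le_exp.2 (mul_le_mul_of_nonneg_left hw.2.le hα.le))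
  refine (ENNReal.toReal_mono ?_ h).trans ?_
  · exact ENNReal.mul_ne_top ENNReal.ofReal_ne_top (measure_ne_top _ _)
  · rw [ENNReal.toReal_mul, ENNReal.toReal_ofReal (Real.exp_pos _).le, measureReal_def]

lemma expWeight_mono {s t : ℝ} (hst : s ≤ t) :
    (expWeight α F).real (Set.Ioo 0 s) ≤ (expWeight α F).real (Set.Ioo 0 t) := by
  have := hF.isFiniteMeasure_expWeight
  exact measureReal_mono (Set.Ioo_subset_Ioo_right hst)

lemma measurable_expWeight_real : Measurable fun s => (expWeight α F).real (Set.Ioo 0 s) :=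
  (show Monotone _ from fun _ _ h => hF.expWeight_mono h).measurable

lemma intervalIntegrable_expWeight (hα : 0 < α) (a b : ℝ) :
    IntervalIntegrable (fun v => (expWeight α F).real (Set.Ioo 0 (v / α))) volume a b := by
  refine MonotoneOn.intervalIntegrable fun x _ y _ hxy => hF.expWeight_mono ?_
  gcongr

lemma edgeLaw_Iio (hα : 0 < α) {s : ℝ} (hs : 0 ≤ s) : (edgeLaw α F).real (Set.Iio s) =
    ∫ v in (0 : ℝ)..s, Real.exp (-v) * (expWeight α F).real (Set.Ioo 0 (v / α)) := by
  have := hF.isProbabilityMeasure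
  have := hF.isFiniteMeasure_expWeight
  have h0 : edgeLaw α F (Set.Iic 0) = 0 := by
    rw [hF.edgeLaw_eq hα, withDensity_apply _ measurableSet_Iic,
      setLIntegral_congr_fun (g := fun _ => 0) measurableSet_Iic ?_]
    · simp
    · intro v hv
      have hv' : v / α ≤ 0 := div_nonpos_of_nonpos_of_nonneg hv hα.le
      simp [Set.Ioo_eq_empty (not_lt.2 hv')]
  have h1 : edgeLaw α F (Set.Iio s) = edgeLaw α F (Set.Ioc 0 s) := by
    rw [measure_congr Iio_ae_eq_Iic]
    refine measure_congr ?_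
    have : ∀ᵐ v ∂(edgeLaw α F), 0 < v := by
      rw [ae_iff]
      convert h0 using 2
      ext w
      simp
    filter_upwards [this] with v hv
    refine propext ?_
    show v ≤ s ↔ 0 < v ∧ v ≤ s
    exact ⟨fun h => ⟨hv, h⟩, fun h => h.2⟩
  rw [intervalIntegral.integral_of_le hs, integral_eq_lintegral_of_nonneg_ae
    (Eventually.of_forall fun v => mul_nonneg (Real.exp_pos _).le measureReal_nonneg)]
  · rw [measureReal_def, h1, hF.edgeLaw_eq hα, withDensity_apply _ measurableSet_Ioc]
    congr 1
    refine lintegral_congr fun v => ?_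
    rw [ENNReal.ofReal_mul (Real.exp_pos _).le, ofReal_measureReal]
  · have := hF.measurable_expWeight_real
    refine Measurable.aestronglyMeasurable (Measurable.mul (by fun_prop) ?_)
    exact this.comp (measurable_id.div_const α)

lemma measureReal_Ioo_eq (s : ℝ) :
    F.real (Set.Ioo 0 s) = 1 - (1 - (edgeLaw α F).real (Set.Iio s)) ^ d := by
  have := hF.isProbabilityMeasure
  have h1 : F.real (Set.Ioo 0 s) = F.real (Set.Iio s) := by
    refine measureReal_congr ?_
    filter_upwards [hF.ae_pos] with v hv
    refine propext ?_
    show (0 < v ∧ v < s) ↔ v < s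
    exact ⟨fun h => h.2, fun h => ⟨hv, h⟩⟩
  have h2 : F.real (Set.Ici s) = (edgeLaw α F).real (Set.Ici s) ^ d := by
    rw [measureReal_def, hF.measure_Ici, ENNReal.toReal_pow, measureReal_def]
  rw [h1, ← probReal_compl_eq_one_sub measurableSet_Iio, Set.compl_Iio, ← h2,
    ← probReal_compl_eq_one_sub measurableSet_Ici, Set.compl_Ici]

/-- The gain of one power of `θ` is the Jacobian of `v ↦ θv` in the integral formula for `edgeLaw`.
The factor `e^s` pays for comparing `e^{-θv}` with `e^{-v}` when `v ≤ s`. -/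
lemma edgeLaw_Iio_mul_le (hα : 0 < α) {s θ ε : ℝ} {k : ℕ} (hs : 0 ≤ s) (hθ : 0 < θ) (hε : 0 ≤ ε)
    (h : ∀ v, 0 < v → v ≤ s → (expWeight α F).real (Set.Ioo 0 (θ * (v / α))) ≤
      (1 + ε) * θ ^ k * (expWeight α F).real (Set.Ioo 0 (v / α))) :
    (edgeLaw α F).real (Set.Iio (θ * s)) ≤
      Real.exp s * (1 + ε) * θ ^ (k + 1) * (edgeLaw α F).real (Set.Iio s) := by
  have hII := hF.intervalIntegrable_expWeight hα 0 s
  have hcont : Continuous fun v : ℝ => Real.exp (-v) := by fun_prop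
  have hcont' : Continuous fun v : ℝ => Real.exp (-(θ * v)) := by fun_prop
  have hIE : IntervalIntegrable
      (fun v => Real.exp (-v) * (expWeight α F).real (Set.Ioo 0 (v / α))) volume 0 s :=
    hII.continuousOn_mul hcont.continuousOn
  have hIθ : IntervalIntegrable
      (fun v => Real.exp (-(θ * v)) * (expWeight α F).real (Set.Ioo 0 (θ * v / α))) volume 0 s := by
    refine IntervalIntegrable.continuousOn_mul ?_ hcont'.continuousOn
    refine MonotoneOn.intervalIntegrable fun x _ y _ hxy => hF.expWeight_mono ?_
    gcongr
  rw [hF.edgeLaw_Iio hα hs, hF.edgeLaw_Iio hα (by positivity)]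
  have hsub := intervalIntegral.integral_comp_mul_left
    (f := fun v => Real.exp (-v) * (expWeight α F).real (Set.Ioo 0 (v / α))) (a := 0) (b := s) hθ.ne'
  rw [mul_zero, smul_eq_mul, eq_inv_mul_iff_mul_eq₀ hθ.ne'] at hsub
  rw [← hsub]
  have hle : ∫ v in (0 : ℝ)..s, Real.exp (-(θ * v)) *
        (expWeight α F).real (Set.Ioo 0 (θ * v / α)) ≤
      ∫ v in (0 : ℝ)..s, Real.exp s * (1 + ε) * θ ^ k *
        (Real.exp (-v) * (expWeight α F).real (Set.Ioo 0 (v / α))) := by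
    refine intervalIntegral.integral_mono_on_of_le_Ioo hs hIθ (hIE.const_mul _) fun v hv => ?_
    have h1 := h v hv.1 hv.2.le
    rw [← mul_div_assoc] at h1
    have h2 : Real.exp (-(θ * v)) ≤ 1 := Real.exp_le_one_iff.2 (by nlinarith [hv.1])
    have h3 : 1 ≤ Real.exp s * Real.exp (-v) := by
      rw [← Real.exp_add]
      exact Real.one_le_exp (by linarith [hv.2])
    have hn : 0 ≤ (expWeight α F).real (Set.Ioo 0 (v / α)) := measureReal_nonneg
    calc Real.exp (-(θ * v)) * (expWeight α F).real (Set.Ioo 0 (θ * v / α))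
        ≤ 1 * ((1 + ε) * θ ^ k * (expWeight α F).real (Set.Ioo 0 (v / α))) :=
          mul_le_mul h2 h1 measureReal_nonneg zero_le_one
      _ ≤ (Real.exp s * Real.exp (-v)) *
            ((1 + ε) * θ ^ k * (expWeight α F).real (Set.Ioo 0 (v / α))) :=
          mul_le_mul_of_nonneg_right h3 (by positivity)
      _ = _ := by ring
  rw [intervalIntegral.integral_const_mul] at hle
  calc _ ≤ θ * (Real.exp s * (1 + ε) * θ ^ k *
        ∫ v in (0 : ℝ)..s, Real.exp (-v) * (expWeight α F).real (Set.Ioo 0 (v / α))) :=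
        mul_le_mul_of_nonneg_left hle hθ.le
    _ = _ := by ring

lemma tendsto_edgeLaw_Iio (hα : 0 < α) :
    Tendsto (fun s => (edgeLaw α F).real (Set.Iio s)) (𝓝[>] 0) (𝓝 0) := by
  have := hF.isFiniteMeasure_expWeight
  have hM : ∀ s : ℝ, 0 < s → (edgeLaw α F).real (Set.Iio s) ≤
      (expWeight α F).real Set.univ * s := by
    intro s hs
    rw [hF.edgeLaw_Iio hα hs.le]
    have : ∫ v in (0 : ℝ)..s, (expWeight α F).real Set.univ =
        (expWeight α F).real Set.univ * s := by simp [mul_comm]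
    rw [← this]
    refine intervalIntegral.integral_mono_on_of_le_Ioo hs.le
      ((hF.intervalIntegrable_expWeight hα 0 s).continuousOn_mul (by fun_prop))
      intervalIntegrable_const fun v hv => ?_
    calc Real.exp (-v) * (expWeight α F).real (Set.Ioo 0 (v / α))
        ≤ 1 * (expWeight α F).real Set.univ :=
          mul_le_mul (Real.exp_le_one_iff.2 (by linarith [hv.1]))
            (measureReal_mono (Set.subset_univ _)) measureReal_nonneg zero_le_one
      _ = _ := one_mul _
  refine tendsto_of_tendsto_of_tendsto_of_le_of_le' tendsto_const_nhds ?_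
    (Eventually.of_forall fun s => measureReal_nonneg)
    (eventually_nhdsWithin_of_forall fun s hs => hM s hs)
  have : Tendsto (fun s => (expWeight α F).real Set.univ * s) (𝓝 0) (𝓝 0) := by
    have h : Continuous fun s : ℝ => (expWeight α F).real Set.univ * s := by fun_prop
    simpa using h.tendsto 0
  exact this.mono_left nhdsWithin_le_nhds

/-- The law is regularly small at the origin, to all orders. -/
theorem eventually_expWeight_mul_le (hα : 0 < α) (hα1 : α < 1) (hd : 1 ≤ d) (k : ℕ) {ε : ℝ}
    (hε : 0 < ε) : ∀ᶠ s in 𝓝[>] (0 : ℝ), ∀ θ, 0 < θ → θ ≤ 1 →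
      (expWeight α F).real (Set.Ioo 0 (θ * s)) ≤
        (1 + ε) * θ ^ k * (expWeight α F).real (Set.Ioo 0 s) := by
  induction k generalizing ε with
  | zero =>
    filter_upwards [self_mem_nhdsWithin] with s hs θ hθ hθ1
    have hs : 0 < s := hs
    have h1 := hF.expWeight_mono (s := θ * s) (t := s) (by nlinarith)
    have h2 : 0 ≤ (expWeight α F).real (Set.Ioo 0 s) := measureReal_nonneg
    rw [pow_zero, mul_one]
    nlinarith
  | succ k ih =>
    -- The previous order is used with `ε/2`; the other half absorbs the factors `e^{2s}` and `(1 -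
    -- g)^{d-1}`, both of which tend to `1`.
    obtain ⟨s₀, hs₀, ih⟩ := mem_nhdsGT_iff_exists_Ioo_subset.1 (ih (half_pos hε))
    have hg := hF.tendsto_edgeLaw_Iio hα
    have hlim1 : Tendsto (fun s => Real.exp (2 * s) * (1 + ε / 2)) (𝓝[>] 0) (𝓝 (1 + ε / 2)) := by
      have h : Continuous fun s : ℝ => Real.exp (2 * s) * (1 + ε / 2) := by fun_prop
      have := h.tendsto 0
      simp only [mul_zero, Real.exp_zero, one_mul] at this
      exact this.mono_left nhdsWithin_le_nhds
    have hlim2 : Tendsto (fun s => (1 + ε) * (1 - (edgeLaw α F).real (Set.Iio s)) ^ (d - 1))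
        (𝓝[>] 0) (𝓝 (1 + ε)) := by
      have := ((hg.const_sub 1).pow (d - 1)).const_mul (1 + ε)
      simpa using this
    -- Requiring `s < α s₀` brings `v/α` within the range of the induction hypothesis for all `v ≤
    -- s`.
    filter_upwards [hlim1.eventually_lt hlim2 (by linarith), self_mem_nhdsWithin,
      hg.eventually_lt_const one_pos, Ioo_mem_nhdsGT (mul_pos hα hs₀)] with s h1 hs hg1 hs1 θ hθ hθ1
    have hs : 0 < s := hs
    have := hF.isProbabilityMeasure
    have hE := hF.edgeLaw_Iio_mul_le hα hs.le hθ (half_pos hε).le (k := k) fun v hv hvs => by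
      refine ih ⟨div_pos hv hα, ?_⟩ θ hθ hθ1
      rw [div_lt_iff₀ hα]
      nlinarith [hs1.2]
    set g := (edgeLaw α F).real (Set.Iio s) with hgdef
    set gθ := (edgeLaw α F).real (Set.Iio (θ * s)) with hgθ
    have hg0 : 0 ≤ g := measureReal_nonneg
    have hq : 0 < (1 - g) ^ (d - 1) := pow_pos (by linarith) _
    have hfθ : F.real (Set.Ioo 0 (θ * s)) ≤ d * gθ := by
      rw [hF.measureReal_Ioo_eq]
      exact one_sub_pow_le measureReal_le_one d
    have hf : d * g * (1 - g) ^ (d - 1) ≤ F.real (Set.Ioo 0 s) := by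
      rw [hF.measureReal_Ioo_eq]
      exact mul_pow_le_one_sub_pow hg0 hg1.le hd
    have hnθ := hF.expWeight_le_exp_mul hα (θ * s)
    have hn := hF.measureReal_le_expWeight hα s
    have hexp : Real.exp (α * (θ * s)) ≤ Real.exp s := by
      apply Real.exp_le_exp.2
      have : α * θ ≤ 1 := by nlinarith
      nlinarith
    refine le_of_mul_le_mul_right ?_ hq
    -- Go from the exponential weight to `F`, from `F` to `edgeLaw`, scale there to gain a power of
    -- `θ`, and return by the reverse bounds at `s`.
    calc (expWeight α F).real (Set.Ioo 0 (θ * s)) * (1 - g) ^ (d - 1)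
        ≤ (Real.exp s * (d * (Real.exp s * (1 + ε / 2) * θ ^ (k + 1) * g))) *
          (1 - g) ^ (d - 1) := by
          refine mul_le_mul_of_nonneg_right (hnθ.trans ?_) hq.le
          exact mul_le_mul hexp (hfθ.trans (mul_le_mul_of_nonneg_left hE (by positivity)))
            measureReal_nonneg (Real.exp_pos _).le
      _ = (Real.exp (2 * s) * (1 + ε / 2)) * θ ^ (k + 1) * (d * g * (1 - g) ^ (d - 1)) := by
          rw [two_mul, Real.exp_add]; ring
      _ ≤ ((1 + ε) * (1 - g) ^ (d - 1)) * θ ^ (k + 1) *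
          (expWeight α F).real (Set.Ioo 0 s) := by
          refine mul_le_mul ?_ (hf.trans hn) (by positivity) (by positivity)
          exact mul_le_mul_of_nonneg_right h1.le (by positivity)
      _ = _ := by ring

end IsTreeLaw

end TreeDLA
end

noncomputable section

namespace TreeDLA

variable {d : ℕ} {α : ℝ} {F : Measure ℝ}

/-! ### Negative moments -/

/-- The function `v ↦ v^{-p}` with value `∞` on `(-∞, 0]`. -/
def negPow (p v : ℝ) : ℝ≥0∞ := ENNReal.ofReal v ^ (-p)

lemma continuous_negPow (p : ℝ) : Continuous (negPow p) := by
  unfold negPow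
  exact ENNReal.continuous_rpow_const.comp ENNReal.continuous_ofReal

lemma measurable_negPow (p : ℝ) : Measurable (negPow p) := (continuous_negPow p).measurable

lemma negPow_of_pos {p v : ℝ} (hv : 0 < v) : negPow p v = ENNReal.ofReal (v⁻¹ ^ p) := by
  rw [negPow, ENNReal.ofReal_rpow_of_pos hv, Real.rpow_neg hv.le, Real.inv_rpow hv.le]

lemma negPow_of_nonpos {p v : ℝ} (hp : 0 < p) (hv : v ≤ 0) : negPow p v = ∞ := by
  rw [negPow, ENNReal.ofReal_of_nonpos hv, ENNReal.zero_rpow_of_neg (by linarith)]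

lemma negPow_antitone {p : ℝ} (hp : 0 < p) : Antitone (negPow p) := by
  intro v w hvw
  unfold negPow
  rw [ENNReal.rpow_neg, ENNReal.rpow_neg, ENNReal.inv_le_inv]
  exact ENNReal.rpow_le_rpow (ENNReal.ofReal_le_ofReal hvw) hp.le

lemma lintegral_Ioc_rpow {p a : ℝ} (hp : 0 < p) (ha : 0 < a) :
    ∫⁻ t in Set.Ioc 0 a, ENNReal.ofReal (t ^ (p - 1)) = ENNReal.ofReal (a ^ p / p) := by
  have h1 : IntegrableOn (fun t : ℝ => t ^ (p - 1)) (Set.Ioc 0 a) :=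
    (intervalIntegral.intervalIntegrable_rpow' (by linarith)).1
  rw [← ofReal_integral_eq_lintegral_ofReal h1, ← intervalIntegral.integral_of_le ha.le,
    integral_rpow (Or.inl (by linarith))]
  · rw [sub_add_cancel, Real.zero_rpow hp.ne', sub_zero]
  · rw [EventuallyLE, ae_restrict_iff' measurableSet_Ioc]
    exact Eventually.of_forall fun t ht => Real.rpow_nonneg ht.1.le _

lemma lintegral_Ioi_rpow {q a : ℝ} (hq : q < 0) (ha : 0 < a) :
    ∫⁻ t in Set.Ioi a, ENNReal.ofReal (t ^ (q - 1)) = ENNReal.ofReal (a ^ q / (-q)) := by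
  have h1 : IntegrableOn (fun t : ℝ => t ^ (q - 1)) (Set.Ioi a) :=
    integrableOn_Ioi_rpow_of_lt (by linarith) ha
  rw [← ofReal_integral_eq_lintegral_ofReal h1, integral_Ioi_rpow_of_lt (by linarith) ha]
  · rw [sub_add_cancel, neg_div, div_neg]
  · rw [EventuallyLE, ae_restrict_iff' measurableSet_Ioi]
    exact Eventually.of_forall fun t ht => Real.rpow_nonneg (ha.trans ht).le _

/-- The law after `n` steps of the chain started from `F`. -/
def stepLaw (α : ℝ) (F : Measure ℝ) : ℕ → Measure ℝ
  | 0 => F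
  | n + 1 => (stepLaw α F n).bind (treeKernel α F)

namespace IsTreeLaw

variable (hF : IsTreeLaw d α F)
include hF

lemma treeKernel_compl_Ioo (w : ℝ) : ∀ᵐ v ∂(treeKernel α F w), v ∈ Set.Ioo 0 (w / α) := by
  rw [hF.treeKernel_apply]
  exact ae_cond_mem measurableSet_Ioo

lemma treeKernel_pos (w : ℝ) : ∀ᵐ v ∂(treeKernel α F w), 0 < v :=
  (hF.treeKernel_compl_Ioo w).mono fun _ hv => hv.1

/-- Layer cake for `1/v`, with `s = w/α`: up to level `1/s` the tail is at most `1`, beyond it the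
hypothesis bounds the tail at `t` by `2 (ts)^{-k}`. The two pieces, multiplied by `p`, give `1` and
`2p/(k-p)`. -/
lemma lintegral_negPow_treeKernel_le (hα : 0 < α) (hα1 : α < 1) (hd : 1 ≤ d) {p w : ℝ} {k : ℕ}
    (hp : 0 < p) (hpk : p < k) (hw : 0 < w)
    (h : ∀ θ, 0 < θ → θ ≤ 1 → (expWeight α F).real (Set.Ioo 0 (θ * (w / α))) ≤
      2 * θ ^ k * (expWeight α F).real (Set.Ioo 0 (w / α))) :
    ∫⁻ v, negPow p v ∂(treeKernel α F w) ≤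
      ENNReal.ofReal ((1 + 2 * p / (k - p)) * (w / α)⁻¹ ^ p) := by
  have := hF.isFiniteMeasure_expWeight
  have := hF.isProbabilityMeasure_treeKernel hα hα1 hd hw
  set s := w / α with hs
  have hs0 : 0 < s := div_pos hw hα
  have hkp : (0 : ℝ) < k - p := by linarith
  have hpos := hF.treeKernel_pos w
  have hM := hF.expWeight_Ioo_pos hα hα1 hd hs0
  have h1 : ∫⁻ v, negPow p v ∂(treeKernel α F w) =
      ∫⁻ v, ENNReal.ofReal (v⁻¹ ^ p) ∂(treeKernel α F w) :=
    lintegral_congr_ae (hpos.mono fun v hv => negPow_of_pos hv)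
  rw [h1, lintegral_rpow_eq_lintegral_meas_lt_mul _ (hpos.mono fun v hv => (inv_pos.2 hv).le)
    (by fun_prop) hp]
  have hsplit : Set.Ioi (0 : ℝ) = Set.Ioc 0 s⁻¹ ∪ Set.Ioi s⁻¹ :=
    (Set.Ioc_union_Ioi_eq_Ioi (inv_pos.2 hs0).le).symm
  have hA : ∫⁻ t in Set.Ioc 0 s⁻¹, treeKernel α F w {v | t < v⁻¹} * ENNReal.ofReal (t ^ (p - 1)) ≤
      ENNReal.ofReal (s⁻¹ ^ p / p) := by
    rw [← lintegral_Ioc_rpow hp (inv_pos.2 hs0)]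
    exact lintegral_mono fun t => mul_le_of_le_one_left zero_le prob_le_one
  have hB : ∫⁻ t in Set.Ioi s⁻¹, treeKernel α F w {v | t < v⁻¹} * ENNReal.ofReal (t ^ (p - 1)) ≤
      ENNReal.ofReal (2 * s⁻¹ ^ p / (k - p)) := by
    calc ∫⁻ t in Set.Ioi s⁻¹, treeKernel α F w {v | t < v⁻¹} * ENNReal.ofReal (t ^ (p - 1))
        ≤ ∫⁻ t in Set.Ioi s⁻¹, ENNReal.ofReal (2 * s⁻¹ ^ k) *
            ENNReal.ofReal (t ^ ((p - k) - 1)) := by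
          refine setLIntegral_mono (by fun_prop) fun t ht => ?_
          have ht0 : 0 < t := (inv_pos.2 hs0).trans ht
          have hθ : 0 < (t * s)⁻¹ := by positivity
          have hts : 1 < t * s := by
            have := mul_lt_mul_of_pos_right (show s⁻¹ < t from ht) hs0
            rwa [inv_mul_cancel₀ hs0.ne'] at this
          have hθ1 : (t * s)⁻¹ ≤ 1 := inv_le_one_of_one_le₀ hts.le
          have h2 := h _ hθ hθ1
          have h3 : (t * s)⁻¹ * s = t⁻¹ := by field_simp
          rw [h3] at h2
          have h4 : treeKernel α F w {v | t < v⁻¹} ≤ ENNReal.ofReal (2 * ((t * s)⁻¹) ^ k) := by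
            rw [hF.treeKernel_apply_apply, ← hs, mul_comm, ← div_eq_mul_inv]
            refine ENNReal.div_le_of_le_mul ?_
            refine (measure_mono (t := Set.Ioo 0 t⁻¹) ?_).trans ?_
            · rintro v ⟨hv, hv'⟩
              exact ⟨hv.1, (lt_inv_comm₀ ht0 hv.1).1 hv'⟩
            · rw [← ofReal_measureReal (μ := expWeight α F) (s := Set.Ioo 0 s),
                ← ofReal_measureReal (μ := expWeight α F) (s := Set.Ioo 0 t⁻¹),
                ← ENNReal.ofReal_mul (by positivity)]
              exact ENNReal.ofReal_le_ofReal h2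
          refine (mul_le_mul_left h4 _).trans ?_
          rw [← ENNReal.ofReal_mul (by positivity), ← ENNReal.ofReal_mul (by positivity)]
          refine ENNReal.ofReal_le_ofReal (le_of_eq ?_)
          have h5 : t ^ ((p - k) - 1) = t ^ (p - 1) * (t⁻¹) ^ k := by
            rw [show (p - k) - 1 = (p - 1) - (k : ℝ) by ring, Real.rpow_sub ht0,
              Real.rpow_natCast, div_eq_mul_inv, inv_pow]
          rw [h5, mul_inv, mul_pow]
          ring
      _ = ENNReal.ofReal (2 * s⁻¹ ^ k) * ENNReal.ofReal (s⁻¹ ^ (p - k) / (-(p - k))) := by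
          rw [lintegral_const_mul _ (by fun_prop),
            lintegral_Ioi_rpow (by linarith) (inv_pos.2 hs0)]
      _ ≤ _ := by
          rw [← ENNReal.ofReal_mul (by positivity)]
          refine ENNReal.ofReal_le_ofReal (le_of_eq ?_)
          have h6 : s⁻¹ ^ (p - k) * s⁻¹ ^ k = s⁻¹ ^ p := by
            rw [← Real.rpow_natCast, ← Real.rpow_add (inv_pos.2 hs0)]
            congr 1
            ring
          rw [← h6, neg_sub]
          ring
  rw [hsplit, lintegral_union measurableSet_Ioi (by
    rw [Set.disjoint_left]; exact fun x hx hx' => absurd hx' (not_lt.2 hx.2))]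
  refine (mul_le_mul_right (add_le_add hA hB) _).trans ?_
  rw [← ENNReal.ofReal_add (by positivity) (by positivity), ← ENNReal.ofReal_mul hp.le]
  refine ENNReal.ofReal_le_ofReal (le_of_eq ?_)
  field_simp

/-- Near the origin the kernel contracts negative moments. -/
lemma exists_contraction (hα : 0 < α) (hα1 : α < 1) (hd : 1 ≤ d) {p : ℝ} (hp : 0 < p) :
    ∃ s₀ : ℝ, 0 < s₀ ∧ ∀ w, 0 < w → w / α ≤ s₀ →
      ∫⁻ v, negPow p v ∂(treeKernel α F w) ≤ ENNReal.ofReal ((α ^ p + 1) / 2) * negPow p w := by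
  have hαp : 0 < α ^ p := Real.rpow_pos_of_pos hα p
  have hαp1 : α ^ p < 1 := Real.rpow_lt_one hα.le hα1 hp
  -- Chosen so that `(1 + δ) α^p = (α^p + 1)/2 < 1`; a large order `k` then brings `2p/(k-p)` below
  -- `δ`.
  set δ := ((α ^ p)⁻¹ - 1) / 2 with hδdef
  have hδ : 0 < δ := by
    have : 1 < (α ^ p)⁻¹ := (one_lt_inv₀ hαp).2 hαp1
    rw [hδdef]; linarith
  obtain ⟨k, hk⟩ := exists_nat_gt (p + 2 * p / δ)
  have h2 : 0 < 2 * p / δ := by positivity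
  have hpk : p < k := by linarith
  have hkp : (0 : ℝ) < k - p := by linarith
  have hδk : 2 * p / (k - p) ≤ δ := by
    rw [div_le_iff₀ hkp]
    have : 2 * p / δ ≤ k - p := by linarith
    rw [div_le_iff₀ hδ] at this
    linarith
  obtain ⟨s₀, hs₀, h⟩ := mem_nhdsGT_iff_exists_Ioo_subset.1
    (hF.eventually_expWeight_mul_le hα hα1 hd k one_pos)
  have hs₀ : 0 < s₀ := hs₀
  refine ⟨s₀ / 2, by positivity, fun w hw hws => ?_⟩
  have hs : w / α ∈ Set.Ioo 0 s₀ := ⟨div_pos hw hα, by linarith⟩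
  refine (hF.lintegral_negPow_treeKernel_le hα hα1 hd hp hpk hw fun θ hθ hθ1 => ?_).trans ?_
  · have := h hs θ hθ hθ1
    linarith
  · rw [negPow_of_pos hw, ← ENNReal.ofReal_mul (by positivity)]
    refine ENNReal.ofReal_le_ofReal ?_
    have h3 : (w / α)⁻¹ ^ p = α ^ p * w⁻¹ ^ p := by
      rw [inv_div, div_eq_mul_inv, Real.mul_rpow hα.le (inv_pos.2 hw).le]
    rw [h3, ← mul_assoc]
    refine mul_le_mul_of_nonneg_right ?_ (Real.rpow_nonneg (inv_pos.2 hw).le _)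
    calc (1 + 2 * p / (k - p)) * α ^ p ≤ (1 + δ) * α ^ p := by gcongr
      _ = (α ^ p + 1) / 2 := by
        rw [hδdef]
        field_simp
        ring

lemma lintegral_negPow_treeKernel (w p : ℝ) : ∫⁻ v, negPow p v ∂(treeKernel α F w) =
    (expWeight α F (Set.Ioo 0 (w / α)))⁻¹ *
      ∫⁻ v in Set.Ioo 0 (w / α), negPow p v ∂(expWeight α F) := by
  rw [hF.treeKernel_apply, ProbabilityTheory.cond, lintegral_smul_measure, smul_eq_mul]

/-- The kernel at the single state `α s₀` is the normalised weight on `(0, s₀)`, so the contraction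
estimate there already shows integrability at the origin. Away from it the integrand is bounded. -/
lemma lintegral_negPow_expWeight_ne_top (hα : 0 < α) (hα1 : α < 1) (hd : 1 ≤ d) {p : ℝ}
    (hp : 0 < p) : ∫⁻ v in Set.Ioi 0, negPow p v ∂(expWeight α F) ≠ ∞ := by
  have := hF.isFiniteMeasure_expWeight
  obtain ⟨s₀, hs₀, h⟩ := hF.exists_contraction hα hα1 hd hp
  have hw : 0 < α * s₀ := mul_pos hα hs₀
  have hdiv : α * s₀ / α = s₀ := by field_simp
  have h1 := h (α * s₀) hw hdiv.le
  have hM := hF.expWeight_Ioo_pos hα hα1 hd hs₀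
  rw [hF.lintegral_negPow_treeKernel, hdiv, negPow_of_pos hw] at h1
  have h2 : ∫⁻ v in Set.Ioo 0 s₀, negPow p v ∂(expWeight α F) ≠ ∞ := by
    intro htop
    rw [htop, ENNReal.mul_top (ENNReal.inv_ne_zero.2 (measure_ne_top _ _)), top_le_iff] at h1
    exact ENNReal.mul_ne_top ENNReal.ofReal_ne_top ENNReal.ofReal_ne_top h1
  have h3 : ∫⁻ v in Set.Ici s₀, negPow p v ∂(expWeight α F) ≠ ∞ := by
    refine ne_top_of_le_ne_top (b := negPow p s₀ * expWeight α F (Set.Ici s₀)) ?_ ?_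
    · rw [negPow_of_pos hs₀]
      exact ENNReal.mul_ne_top ENNReal.ofReal_ne_top (measure_ne_top _ _)
    · rw [← setLIntegral_const]
      exact setLIntegral_mono measurable_const fun v hv => negPow_antitone hp hv
  rw [← Set.Ioo_union_Ici_eq_Ioi hs₀]
  exact ne_top_of_le_ne_top (ENNReal.add_ne_top.2 ⟨h2, h3⟩) (lintegral_union_le _ _ _)

lemma lintegral_negPow_ne_top (hα : 0 < α) (hα1 : α < 1) (hd : 1 ≤ d) {p : ℝ} (hp : 0 < p) :
    ∫⁻ v, negPow p v ∂F ≠ ∞ := by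
  refine ne_top_of_le_ne_top (hF.lintegral_negPow_expWeight_ne_top hα hα1 hd hp) ?_
  have h : ∫⁻ v, negPow p v ∂F = ∫⁻ v in Set.Ioi 0, negPow p v ∂F := by
    rw [← setLIntegral_univ]
    refine setLIntegral_congr ?_
    filter_upwards [hF.ae_pos] with v hv
    exact propext ⟨fun _ => hv, fun _ => trivial⟩
  rw [h, expWeight, setLIntegral_withDensity_eq_setLIntegral_mul _ (by fun_prop)
    (measurable_negPow p) measurableSet_Ioi]
  refine setLIntegral_mono ((by fun_prop : Measurable _).mul (measurable_negPow p)) fun v hv => ?_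
  rw [Pi.mul_apply]
  refine le_mul_of_one_le_left zero_le ?_
  rw [ENNReal.one_le_ofReal]
  exact Real.one_le_exp (mul_nonneg hα.le (le_of_lt hv))

/-- The drift inequality for negative moments. -/
theorem exists_drift (hα : 0 < α) (hα1 : α < 1) (hd : 1 ≤ d) {p : ℝ} (hp : 0 < p) :
    ∃ K : ℝ≥0∞, K ≠ ∞ ∧ ∀ w, 0 < w → ∫⁻ v, negPow p v ∂(treeKernel α F w) ≤
      ENNReal.ofReal ((α ^ p + 1) / 2) * negPow p w + K := by
  have := hF.isFiniteMeasure_expWeight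
  obtain ⟨s₀, hs₀, h⟩ := hF.exists_contraction hα hα1 hd hp
  have hM := hF.expWeight_Ioo_pos hα hα1 hd hs₀
  refine ⟨(expWeight α F (Set.Ioo 0 s₀))⁻¹ * ∫⁻ v in Set.Ioi 0, negPow p v ∂(expWeight α F),
    ENNReal.mul_ne_top (ENNReal.inv_ne_top.2 hM.ne')
      (hF.lintegral_negPow_expWeight_ne_top hα hα1 hd hp), fun w hw => ?_⟩
  -- For small `w` the contraction applies; for larger `w` the normalising mass is at least that of
  -- `(0, s₀)`, and the constant takes over.
  rcases le_total (w / α) s₀ with hws | hws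
  · exact (h w hw hws).trans le_self_add
  · refine le_trans ?_ le_add_self
    rw [hF.lintegral_negPow_treeKernel]
    refine mul_le_mul' (ENNReal.inv_le_inv.2 (measure_mono (Set.Ioo_subset_Ioo_right hws))) ?_
    exact lintegral_mono_set Set.Ioo_subset_Ioi_self

/-! ### The laws of the chain -/

lemma isProbabilityMeasure_bind (hα : 0 < α) (hα1 : α < 1) (hd : 1 ≤ d) {μ : Measure ℝ}
    [IsProbabilityMeasure μ] (hμ : ∀ᵐ w ∂μ, 0 < w) :
    IsProbabilityMeasure (μ.bind (treeKernel α F)) := by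
  refine ⟨?_⟩
  rw [Measure.bind_apply MeasurableSet.univ (treeKernel α F).aemeasurable,
    lintegral_congr_ae (g := fun _ => 1)]
  · simp
  · filter_upwards [hμ] with w hw
    have := hF.isProbabilityMeasure_treeKernel hα hα1 hd hw
    exact measure_univ

lemma bind_ae_pos (μ : Measure ℝ) [SFinite μ] : ∀ᵐ w ∂(μ.bind (treeKernel α F)), 0 < w :=
  Measure.ae_comp_of_ae_ae measurableSet_Ioi (Eventually.of_forall fun w => hF.treeKernel_pos w)

lemma stepLaw_spec (hα : 0 < α) (hα1 : α < 1) (hd : 1 ≤ d) (n : ℕ) :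
    IsProbabilityMeasure (stepLaw α F n) ∧ ∀ᵐ w ∂(stepLaw α F n), 0 < w := by
  induction n with
  | zero => exact ⟨hF.isProbabilityMeasure, hF.ae_pos⟩
  | succ n ih =>
    have := ih.1
    exact ⟨hF.isProbabilityMeasure_bind hα hα1 hd ih.2, hF.bind_ae_pos _⟩

/-- Negative moments are bounded along the chain. -/
theorem exists_moment_bound (hα : 0 < α) (hα1 : α < 1) (hd : 1 ≤ d) {p : ℝ} (hp : 0 < p) :
    ∃ C : ℝ≥0∞, C ≠ ∞ ∧ ∀ n, ∫⁻ v, negPow p v ∂(stepLaw α F n) ≤ C := by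
  obtain ⟨K, hK, h⟩ := hF.exists_drift hα hα1 hd hp
  have hαp : 0 < α ^ p := Real.rpow_pos_of_pos hα p
  have hαp1 : α ^ p < 1 := Real.rpow_lt_one hα.le hα1 hp
  set ρ := (α ^ p + 1) / 2 with hρ
  have hρ0 : 0 < ρ := by positivity
  have hρ1 : 0 < 1 - ρ := by rw [hρ]; linarith
  -- The initial moment plus `K/(1-ρ)`, so that `ρC + K ≤ C` and the bound is preserved at each
  -- step.
  set C : ℝ≥0∞ := ∫⁻ v, negPow p v ∂F + (ENNReal.ofReal (1 - ρ))⁻¹ * K with hC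
  refine ⟨C, ENNReal.add_ne_top.2 ⟨hF.lintegral_negPow_ne_top hα hα1 hd hp,
    ENNReal.mul_ne_top (ENNReal.inv_ne_top.2 (ENNReal.ofReal_pos.2 hρ1).ne') hK⟩, fun n => ?_⟩
  have hKC : K ≤ ENNReal.ofReal (1 - ρ) * C := by
    rw [hC, mul_add, ← mul_assoc, ENNReal.mul_inv_cancel (ENNReal.ofReal_pos.2 hρ1).ne'
      ENNReal.ofReal_ne_top, one_mul]
    exact le_add_self
  induction n with
  | zero => exact le_self_add
  | succ n ih =>
    obtain ⟨hprob, hpos⟩ := hF.stepLaw_spec hα hα1 hd n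
    rw [stepLaw, Measure.lintegral_bind (treeKernel α F).aemeasurable
      (measurable_negPow p).aemeasurable]
    calc ∫⁻ w, ∫⁻ v, negPow p v ∂(treeKernel α F w) ∂(stepLaw α F n)
        ≤ ∫⁻ w, ENNReal.ofReal ρ * negPow p w + K ∂(stepLaw α F n) :=
          lintegral_mono_ae (hpos.mono fun w hw => h w hw)
      _ = ENNReal.ofReal ρ * ∫⁻ w, negPow p w ∂(stepLaw α F n) + K := by
          rw [lintegral_add_right _ measurable_const, lintegral_const_mul _ (measurable_negPow p),
            lintegral_const, measure_univ, mul_one]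
      _ ≤ ENNReal.ofReal ρ * C + ENNReal.ofReal (1 - ρ) * C := by gcongr
      _ = C := by
          rw [← add_mul, ← ENNReal.ofReal_add hρ0.le hρ1.le]
          simp

end IsTreeLaw

end TreeDLA
end

noncomputable section

namespace TreeDLA

/-! ### Quantiles and the stochastic order -/

/-- The quantile function of a law on the line, set to be `0` outside `(0, 1)`. -/
def quantile (ν : Measure ℝ) (s : ℝ) : ℝ :=
  open Classical in if s ∈ Set.Ioo (0 : ℝ) 1 then sInf {t | s ≤ ν.real (Set.Iic t)} else 0

/-- The uniform law on `(0, 1)`. -/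
def unifLaw : Measure ℝ := volume.restrict (Set.Ioo 0 1)

instance : IsProbabilityMeasure unifLaw := ⟨by simp [unifLaw]⟩

lemma unifLaw_ae_mem : ∀ᵐ s ∂unifLaw, s ∈ Set.Ioo (0 : ℝ) 1 := ae_restrict_mem measurableSet_Ioo

/-- The infimum is attained because the distribution function is right-continuous; the restriction
to `(0, 1)` makes the set bounded below and nonempty. -/
lemma quantile_le_iff {ν : Measure ℝ} [IsProbabilityMeasure ν] {s : ℝ}
    (hs : s ∈ Set.Ioo (0 : ℝ) 1) (t : ℝ) : quantile ν s ≤ t ↔ s ≤ ν.real (Set.Iic t) := by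
  rw [quantile, if_pos hs]
  simp only [← cdf_eq_real]
  have hbdd : BddBelow {t | s ≤ cdf ν t} := by
    obtain ⟨b, hb⟩ := ((tendsto_cdf_atBot ν).eventually_lt_const hs.1).exists
    refine ⟨b, fun t ht => ?_⟩
    by_contra! h
    exact absurd (ht.trans (monotone_cdf ν h.le)) (not_le.2 hb)
  have hne : {t | s ≤ cdf ν t}.Nonempty := by
    obtain ⟨b, hb⟩ := ((tendsto_cdf_atTop ν).eventually_const_lt hs.2).exists
    exact ⟨b, hb.le⟩
  constructor
  · intro h
    have h1 : ∀ t', t < t' → s ≤ cdf ν t' := by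
      intro t' ht'
      obtain ⟨r, hr, hrt⟩ := exists_lt_of_csInf_lt hne (h.trans_lt ht')
      exact le_trans hr (monotone_cdf ν hrt.le)
    have h2 : Tendsto (cdf ν) (𝓝[>] t) (𝓝 (cdf ν t)) :=
      ((cdf ν).right_continuous t).mono_left (nhdsWithin_mono _ Set.Ioi_subset_Ici_self)
    exact ge_of_tendsto h2 (eventually_nhdsWithin_of_forall h1)
  · exact fun h => csInf_le hbdd h

lemma measurable_quantile (ν : Measure ℝ) [IsProbabilityMeasure ν] : Measurable (quantile ν) := by
  refine measurable_of_Iic fun t => ?_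
  have : quantile ν ⁻¹' Set.Iic t =
      (Set.Ioo 0 1 ∩ Set.Iic (ν.real (Set.Iic t))) ∪ ((Set.Ioo 0 1)ᶜ ∩ {_s | 0 ≤ t}) := by
    ext s
    by_cases hs : s ∈ Set.Ioo (0 : ℝ) 1
    · have := quantile_le_iff (ν := ν) hs t
      simp only [Set.mem_preimage, Set.mem_Iic, Set.mem_union, Set.mem_inter_iff, hs, true_and,
        Set.mem_compl_iff, not_true, false_and, or_false, this]
    · have h0 : quantile ν s = 0 := by rw [quantile, if_neg hs]
      simp only [Set.mem_preimage, Set.mem_Iic, Set.mem_union, Set.mem_inter_iff, hs, false_and,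
        Set.mem_compl_iff, not_false_eq_true, true_and, false_or, h0, Set.mem_ofPred_eq]
  rw [this]
  exact (measurableSet_Ioo.inter measurableSet_Iic).union
    (measurableSet_Ioo.compl.inter (MeasurableSet.const _))

lemma map_quantile (ν : Measure ℝ) [IsProbabilityMeasure ν] : unifLaw.map (quantile ν) = ν := by
  have := Measure.isProbabilityMeasure_map (μ := unifLaw) (measurable_quantile ν).aemeasurable
  refine Measure.ext_of_Iic _ _ fun t => ?_
  rw [Measure.map_apply (measurable_quantile ν) measurableSet_Iic]
  have h1 : unifLaw (quantile ν ⁻¹' Set.Iic t) = unifLaw (Set.Iic (ν.real (Set.Iic t))) := by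
    refine measure_congr ?_
    filter_upwards [unifLaw_ae_mem] with s hs
    exact propext (quantile_le_iff hs t)
  have hc : ν.real (Set.Iic t) ≤ 1 := measureReal_le_one
  rw [h1, unifLaw, Measure.restrict_congr_set Ioo_ae_eq_Ioc, Measure.restrict_apply measurableSet_Iic,
    Set.inter_comm, Set.Ioc_inter_Iic, min_eq_right hc, Real.volume_Ioc, sub_zero,
    ofReal_measureReal]

/-- Monotone coupling: a pointwise comparison of distribution functions becomes a pointwise
comparison of variables built from one uniform. -/
lemma quantile_antitone {μ ν : Measure ℝ} [IsProbabilityMeasure μ] [IsProbabilityMeasure ν]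
    (h : ∀ t, ν.real (Set.Iic t) ≤ μ.real (Set.Iic t)) (s : ℝ) : quantile μ s ≤ quantile ν s := by
  by_cases hs : s ∈ Set.Ioo (0 : ℝ) 1
  · rw [quantile_le_iff hs]
    exact ((quantile_le_iff hs _).1 le_rfl).trans (h _)
  · rw [quantile, quantile, if_neg hs, if_neg hs]

lemma integrable_of_bound {μ : Measure ℝ} [IsFiniteMeasure μ] {ψ : ℝ → ℝ} {C : ℝ}
    (hm : Measurable ψ) (hC : ∀ x, |ψ x| ≤ C) : Integrable ψ μ :=
  Integrable.of_bound hm.aestronglyMeasurable C (Eventually.of_forall hC)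

lemma stochLE_of_Iic {μ ν : Measure ℝ} [IsProbabilityMeasure μ] [IsProbabilityMeasure ν]
    (h : ∀ t, ν.real (Set.Iic t) ≤ μ.real (Set.Iic t)) : StochLE μ ν := by
  rintro ψ hψ hmono ⟨C, hC⟩
  rw [← map_quantile μ, ← map_quantile ν,
    integral_map (measurable_quantile μ).aemeasurable hψ.aestronglyMeasurable,
    integral_map (measurable_quantile ν).aemeasurable hψ.aestronglyMeasurable]
  refine integral_mono ?_ ?_ fun s => hmono (quantile_antitone h s)
  · exact integrable_of_bound (hψ.comp (measurable_quantile μ)) fun s => hC _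
  · exact integrable_of_bound (hψ.comp (measurable_quantile ν)) fun s => hC _

lemma StochLE.Iic_le {μ ν : Measure ℝ} [IsProbabilityMeasure μ] [IsProbabilityMeasure ν]
    (h : StochLE μ ν) (t : ℝ) : ν.real (Set.Iic t) ≤ μ.real (Set.Iic t) := by
  have h1 := h ((Set.Ioi t).indicator 1) (measurable_one.indicator measurableSet_Ioi) ?_
    ⟨1, fun x => ?_⟩
  · rw [integral_indicator_one measurableSet_Ioi, integral_indicator_one measurableSet_Ioi,
      ← Set.compl_Iic, probReal_compl_eq_one_sub measurableSet_Iic,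
      probReal_compl_eq_one_sub measurableSet_Iic] at h1
    linarith
  · intro x y hxy
    by_cases hx : x ∈ Set.Ioi t
    · have hy : y ∈ Set.Ioi t := lt_of_lt_of_le (show t < x from hx) hxy
      rw [Set.indicator_of_mem hx, Set.indicator_of_mem hy]
      rfl
    · rw [Set.indicator_of_notMem hx]
      exact Set.indicator_nonneg (fun _ _ => zero_le_one) y
  · by_cases hx : x ∈ Set.Ioi t <;> simp [hx]

lemma integral_bind_kernel {μ : Measure ℝ} [SFinite μ] {κ : Kernel ℝ ℝ} [IsSFiniteKernel κ]
    {f : ℝ → ℝ} (hf : Integrable f (μ.bind κ)) :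
    ∫ x, f x ∂(μ.bind κ) = ∫ w, ∫ x, f x ∂(κ w) ∂μ := by
  rw [Measure.comp_eq_comp_const_apply] at hf ⊢
  rw [Kernel.integral_comp hf, Kernel.const_apply]

variable {d : ℕ} {α : ℝ} {F : Measure ℝ}

namespace IsTreeLaw

variable (hF : IsTreeLaw d α F)
include hF

lemma integral_treeKernel (w : ℝ) (ψ : ℝ → ℝ) : ∫ x, ψ x ∂(treeKernel α F w) =
    ((expWeight α F).real (Set.Ioo 0 (w / α)))⁻¹ *
      ∫ x in Set.Ioo 0 (w / α), ψ x ∂(expWeight α F) := by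
  rw [hF.treeKernel_apply, ProbabilityTheory.cond, integral_smul_measure, ENNReal.toReal_inv,
    smul_eq_mul]
  rfl

lemma expWeight_real_pos (hα : 0 < α) (hα1 : α < 1) (hd : 1 ≤ d) {t : ℝ} (ht : 0 < t) :
    0 < (expWeight α F).real (Set.Ioo 0 t) := by
  have := hF.isFiniteMeasure_expWeight
  exact ENNReal.toReal_pos (hF.expWeight_Ioo_pos hα hα1 hd ht).ne' (measure_ne_top _ _)

/-- The kernel is stochastically monotone. -/
lemma integral_treeKernel_mono (hα : 0 < α) (hα1 : α < 1) (hd : 1 ≤ d) {a b : ℝ} (ha : 0 < a)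
    (hab : a ≤ b) {ψ : ℝ → ℝ} {C : ℝ} (hψ : Measurable ψ) (hmono : Monotone ψ)
    (hC : ∀ x, |ψ x| ≤ C) :
    ∫ x, ψ x ∂(treeKernel α F a) ≤ ∫ x, ψ x ∂(treeKernel α F b) := by
  have := hF.isFiniteMeasure_expWeight
  have := hF.isProbabilityMeasure_treeKernel hα hα1 hd ha
  have := hF.isProbabilityMeasure_treeKernel hα hα1 hd (ha.trans_le hab)
  set s := a / α with hs
  set t := b / α with ht
  have hs0 : 0 < s := div_pos ha hα
  have hst : s ≤ t := by rw [hs, ht]; gcongr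
  have hint : ∀ μ : Measure ℝ, IsFiniteMeasure μ → Integrable ψ μ := fun μ _ =>
    integrable_of_bound hψ hC
  -- After subtracting `ψ s`, the integrand is nonpositive below `s` and nonnegative above.
  -- Enlarging the interval from `s` to `t` raises the integral, and dividing by the larger mass
  -- makes the negative integral over `(0, s)` less negative.
  have hint' : Integrable (fun x => ψ x - ψ s) (expWeight α F) :=
    (hint _ inferInstance).sub (integrable_const _)
  have key : ∫ x, (ψ x - ψ s) ∂(treeKernel α F a) ≤ ∫ x, (ψ x - ψ s) ∂(treeKernel α F b) := by
    rw [hF.integral_treeKernel, hF.integral_treeKernel, ← hs, ← ht]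
    have hA : ∫ x in Set.Ioo 0 s, (ψ x - ψ s) ∂(expWeight α F) ≤ 0 :=
      setIntegral_nonpos measurableSet_Ioo fun x hx => sub_nonpos.2 (hmono hx.2.le)
    have hB : ∫ x in Set.Ioo 0 s, (ψ x - ψ s) ∂(expWeight α F) ≤
        ∫ x in Set.Ioo 0 t, (ψ x - ψ s) ∂(expWeight α F) := by
      have hu : Set.Ioo 0 t = Set.Ioo 0 s ∪ Set.Ico s t := (Set.Ioo_union_Ico_eq_Ioo hs0 hst).symm
      rw [hu, setIntegral_union _ measurableSet_Ico hint'.integrableOn hint'.integrableOn]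
      · have : 0 ≤ ∫ x in Set.Ico s t, (ψ x - ψ s) ∂(expWeight α F) :=
          setIntegral_nonneg measurableSet_Ico fun x hx => sub_nonneg.2 (hmono hx.1)
        linarith
      · rw [Set.disjoint_left]
        exact fun x hx hx' => absurd hx.2 (not_lt.2 hx'.1)
    have hms := hF.expWeight_real_pos hα hα1 hd hs0
    have hmst := hF.expWeight_mono hst
    have hinv : ((expWeight α F).real (Set.Ioo 0 t))⁻¹ ≤ ((expWeight α F).real (Set.Ioo 0 s))⁻¹ :=
      inv_anti₀ hms hmst
    have hpos : 0 ≤ ((expWeight α F).real (Set.Ioo 0 t))⁻¹ := by positivity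
    nlinarith
  rw [integral_sub (hint _ inferInstance) (integrable_const _),
    integral_sub (hint _ inferInstance) (integrable_const _)] at key
  simpa using key

lemma abs_integral_treeKernel_le (w : ℝ) {ψ : ℝ → ℝ} {C : ℝ} (hC0 : 0 ≤ C)
    (hC : ∀ x, |ψ x| ≤ C) : |∫ x, ψ x ∂(treeKernel α F w)| ≤ C := by
  have h := norm_integral_le_of_norm_le_const (μ := treeKernel α F w)
    (Eventually.of_forall (show ∀ x, ‖ψ x‖ ≤ C from hC))
  have h1 : (treeKernel α F w).real Set.univ ≤ 1 := by
    have : treeKernel α F w Set.univ ≤ 1 := by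
      rw [hF.treeKernel_apply_apply, Set.inter_univ]
      exact ENNReal.inv_mul_le_one _
    exact ENNReal.toReal_le_of_le_ofReal zero_le_one (by simpa using this)
  rw [Real.norm_eq_abs] at h
  nlinarith

theorem stochLE_bind (hα : 0 < α) (hα1 : α < 1) (hd : 1 ≤ d) {μ ν : Measure ℝ}
    [IsProbabilityMeasure μ] [IsProbabilityMeasure ν] (hμ : ∀ᵐ w ∂μ, 0 < w) (hν : ∀ᵐ w ∂ν, 0 < w)
    (h : StochLE μ ν) : StochLE (μ.bind (treeKernel α F)) (ν.bind (treeKernel α F)) := by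
  rintro ψ hψ hmono ⟨C, hC⟩
  have hC0 : 0 ≤ C := (abs_nonneg _).trans (hC 0)
  have := hF.isProbabilityMeasure_bind hα hα1 hd hμ
  have := hF.isProbabilityMeasure_bind hα hα1 hd hν
  rw [integral_bind_kernel (integrable_of_bound hψ hC),
    integral_bind_kernel (integrable_of_bound hψ hC)]
  classical
  -- At `w ≤ 0` the conditioning interval is empty and the kernel is the zero measure, so the raw
  -- integral need not be monotone. The value `-C` restores monotonicity, on a set which the two
  -- laws do not charge.
  set Ψ : ℝ → ℝ := fun w => if 0 < w then ∫ x, ψ x ∂(treeKernel α F w) else -C with hΨ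
  have hle : ∀ w, |∫ x, ψ x ∂(treeKernel α F w)| ≤ C := fun w =>
    hF.abs_integral_treeKernel_le w hC0 hC
  have hm : Measurable Ψ := by
    refine Measurable.ite measurableSet_Ioi ?_ measurable_const
    exact (hψ.stronglyMeasurable.integral_kernel (κ := treeKernel α F)).measurable
  have hΨmono : Monotone Ψ := by
    intro a b hab
    simp only [hΨ]
    split_ifs with h1 h2 h2
    · exact hF.integral_treeKernel_mono hα hα1 hd h1 hab hψ hmono hC
    · linarith
    · exact (abs_le.1 (hle b)).1
    · exact le_rfl
  have hb : ∀ x, |Ψ x| ≤ C := by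
    intro x
    simp only [hΨ]
    split_ifs
    · exact hle x
    · rw [abs_neg, abs_of_nonneg hC0]
  have hfin := h Ψ hm hΨmono ⟨C, hb⟩
  have hcongr : ∀ ρ : Measure ℝ, (∀ᵐ w ∂ρ, 0 < w) →
      ∫ w, Ψ w ∂ρ = ∫ w, ∫ x, ψ x ∂(treeKernel α F w) ∂ρ := fun ρ hρ =>
    integral_congr_ae (hρ.mono fun w hw => by simp only [hΨ]; exact if_pos hw)
  rwa [hcongr μ hμ, hcongr ν hν] at hfin

lemma edgeLaw_ae_pos (hα : 0 < α) : ∀ᵐ v ∂(edgeLaw α F), 0 < v := by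
  have := hF.isProbabilityMeasure
  have hm : Measurable fun p : ℝ × ℝ => p.1 + α * p.2 := by fun_prop
  rw [edgeLaw, ae_map_iff hm.aemeasurable measurableSet_Ioi]
  have h1 : ∀ᵐ u ∂(expMeasure 1), 0 < u := by
    rw [ae_iff]
    convert expMeasure_Iic_zero using 2
    ext u
    simp
  filter_upwards [Measure.quasiMeasurePreserving_fst.ae h1,
    Measure.quasiMeasurePreserving_snd.ae hF.ae_pos] with p hp1 hp2
  positivity

lemma stochLE_edgeLaw (hd : 1 ≤ d) : StochLE F (edgeLaw α F) := by
  have := hF.isProbabilityMeasure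
  refine stochLE_of_Iic fun t => ?_
  have h : F.real (Set.Ioi t) ≤ (edgeLaw α F).real (Set.Ioi t) := by
    refine ENNReal.toReal_mono (measure_ne_top _ _) ?_
    rw [hF.measure_Ioi]
    exact pow_le_of_le_one zero_le prob_le_one (by omega)
  rw [← Set.compl_Iic, probReal_compl_eq_one_sub measurableSet_Iic,
    probReal_compl_eq_one_sub measurableSet_Iic] at h
  linarith

/-- The base case applies the monotone kernel to the comparison of `F` with `edgeLaw`: the kernel
turns `edgeLaw` into `F` and `F` into the next law. Induction applies the kernel again. -/
theorem stochLE_stepLaw (hα : 0 < α) (hα1 : α < 1) (hd : 1 ≤ d) (n : ℕ) :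
    StochLE (stepLaw α F (n + 1)) (stepLaw α F n) := by
  have := hF.isProbabilityMeasure
  induction n with
  | zero =>
    have h := hF.stochLE_bind hα hα1 hd hF.ae_pos (hF.edgeLaw_ae_pos hα) (hF.stochLE_edgeLaw hd)
    rwa [hF.edgeLaw_bind hα] at h
  | succ n ih =>
    have h1 := hF.stepLaw_spec hα hα1 hd n
    have h2 := hF.stepLaw_spec hα hα1 hd (n + 1)
    have := h1.1
    have := h2.1
    exact hF.stochLE_bind hα hα1 hd h2.2 h1.2 ih

end IsTreeLaw

end TreeDLA
end

noncomputable section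

namespace TreeDLA

variable {d : ℕ} {α : ℝ} {F : Measure ℝ}

/-! ### The limit law -/

/-- The pointwise limit of the quantile functions of the laws of the chain. -/
def limitQuantile (α : ℝ) (F : Measure ℝ) (s : ℝ) : ℝ := ⨅ n, quantile (stepLaw α F n) s

/-- The limit of the laws of the chain started from `F`. -/
def limitLaw (α : ℝ) (F : Measure ℝ) : Measure ℝ := unifLaw.map (limitQuantile α F)

namespace IsTreeLaw

variable (hF : IsTreeLaw d α F)
include hF

lemma quantile_stepLaw_pos (hα : 0 < α) (hα1 : α < 1) (hd : 1 ≤ d) (n : ℕ) {s : ℝ}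
    (hs : s ∈ Set.Ioo (0 : ℝ) 1) : 0 < quantile (stepLaw α F n) s := by
  obtain ⟨hprob, hpos⟩ := hF.stepLaw_spec hα hα1 hd n
  by_contra! h
  have h1 := (quantile_le_iff hs 0).1 h
  have h2 : (stepLaw α F n).real (Set.Iic 0) = 0 := by
    rw [measureReal_eq_zero_iff]
    rw [ae_iff] at hpos
    convert hpos using 2
    ext w
    simp
  linarith [hs.1]

lemma tendsto_limitQuantile (hα : 0 < α) (hα1 : α < 1) (hd : 1 ≤ d) {s : ℝ}
    (hs : s ∈ Set.Ioo (0 : ℝ) 1) :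
    Tendsto (fun n => quantile (stepLaw α F n) s) atTop (𝓝 (limitQuantile α F s)) := by
  refine tendsto_atTop_ciInf (antitone_nat_of_succ_le fun n => ?_) ⟨0, ?_⟩
  · have := (hF.stepLaw_spec hα hα1 hd n).1
    have := (hF.stepLaw_spec hα hα1 hd (n + 1)).1
    exact quantile_antitone (hF.stochLE_stepLaw hα hα1 hd n).Iic_le s
  · rintro _ ⟨n, rfl⟩
    exact (hF.quantile_stepLaw_pos hα hα1 hd n hs).le

lemma ae_tendsto_limitQuantile (hα : 0 < α) (hα1 : α < 1) (hd : 1 ≤ d) :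
    ∀ᵐ s ∂unifLaw,
      Tendsto (fun n => quantile (stepLaw α F n) s) atTop (𝓝 (limitQuantile α F s)) :=
  unifLaw_ae_mem.mono fun _ hs => hF.tendsto_limitQuantile hα hα1 hd hs

lemma measurable_limitQuantile (hα : 0 < α) (hα1 : α < 1) (hd : 1 ≤ d) :
    Measurable (limitQuantile α F) :=
  Measurable.iInf fun n =>
    have := (hF.stepLaw_spec hα hα1 hd n).1
    measurable_quantile _

lemma isProbabilityMeasure_limitLaw (hα : 0 < α) (hα1 : α < 1) (hd : 1 ≤ d) :
    IsProbabilityMeasure (limitLaw α F) :=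
  Measure.isProbabilityMeasure_map (hF.measurable_limitQuantile hα hα1 hd).aemeasurable

/-- Fatou's lemma in the quantile coupling, with the uniform moment bound along the chain. -/
lemma lintegral_negPow_limitLaw_ne_top (hα : 0 < α) (hα1 : α < 1) (hd : 1 ≤ d) {p : ℝ}
    (hp : 0 < p) : ∫⁻ v, negPow p v ∂(limitLaw α F) ≠ ∞ := by
  obtain ⟨C, hC, h⟩ := hF.exists_moment_bound hα hα1 hd hp
  refine ne_top_of_le_ne_top hC ?_
  rw [limitLaw, lintegral_map (measurable_negPow p) (hF.measurable_limitQuantile hα hα1 hd)]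
  have hq : ∀ n, Measurable (quantile (stepLaw α F n)) := fun n =>
    have := (hF.stepLaw_spec hα hα1 hd n).1
    measurable_quantile _
  calc ∫⁻ s, negPow p (limitQuantile α F s) ∂unifLaw
      = ∫⁻ s, liminf (fun n => negPow p (quantile (stepLaw α F n) s)) atTop ∂unifLaw := by
        refine lintegral_congr_ae ?_
        filter_upwards [hF.ae_tendsto_limitQuantile hα hα1 hd] with s hs
        exact (((continuous_negPow p).tendsto _).comp hs).liminf_eq.symm
    _ ≤ liminf (fun n => ∫⁻ s, negPow p (quantile (stepLaw α F n) s) ∂unifLaw) atTop :=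
        lintegral_liminf_le fun n => (measurable_negPow p).comp (hq n)
    _ ≤ C := by
        refine (liminf_le_liminf (Eventually.of_forall fun n => ?_)).trans
          (liminf_const (f := atTop (α := ℕ)) C).le
        have := (hF.stepLaw_spec hα hα1 hd n).1
        rw [← lintegral_map (measurable_negPow p) (hq n), map_quantile]
        exact h n

/-- The function `negPow` is infinite on `(-∞, 0]`, so one finite negative moment rules out mass
there. -/
lemma limitLaw_Iic_zero (hα : 0 < α) (hα1 : α < 1) (hd : 1 ≤ d) :
    limitLaw α F (Set.Iic 0) = 0 := by
  have h := ae_lt_top (measurable_negPow 1)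
    (hF.lintegral_negPow_limitLaw_ne_top hα hα1 hd one_pos)
  rw [ae_iff] at h
  refine measure_mono_null (fun v hv => ?_) h
  simp only [Set.mem_ofPred_eq, not_lt, top_le_iff]
  exact negPow_of_nonpos one_pos hv

lemma limitLaw_ae_pos (hα : 0 < α) (hα1 : α < 1) (hd : 1 ≤ d) :
    ∀ᵐ w ∂(limitLaw α F), 0 < w := by
  rw [ae_iff]
  convert hF.limitLaw_Iic_zero hα hα1 hd using 2
  ext w
  simp

theorem exists_limitLaw_Ioc_le (hα : 0 < α) (hα1 : α < 1) (hd : 1 ≤ d) {p : ℝ} (hp : 0 < p) :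
    ∃ c : ℝ, 0 < c ∧ ∀ w : ℝ, 0 ≤ w → (limitLaw α F).real (Set.Ioc 0 w) ≤ c * w ^ p := by
  have := hF.isProbabilityMeasure_limitLaw hα hα1 hd
  have hC := hF.lintegral_negPow_limitLaw_ne_top hα hα1 hd hp
  set C := ∫⁻ v, negPow p v ∂(limitLaw α F) with hCdef
  refine ⟨C.toReal + 1, by positivity, fun w hw => ?_⟩
  rcases hw.eq_or_lt with rfl | hw
  · simp [Real.zero_rpow hp.ne']
  have h1 := mul_meas_ge_le_lintegral (μ := limitLaw α F) (measurable_negPow p) (negPow p w)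
  have h2 : negPow p w * limitLaw α F (Set.Ioc 0 w) ≤ C :=
    (mul_le_mul_right (measure_mono fun v hv => negPow_antitone hp hv.2) _).trans h1
  have h3 := ENNReal.toReal_mono hC h2
  rw [ENNReal.toReal_mul, negPow_of_pos hw, ENNReal.toReal_ofReal (by positivity),
    Real.inv_rpow hw.le] at h3
  have hwp : 0 < w ^ p := Real.rpow_pos_of_pos hw p
  rw [inv_mul_le_iff₀ hwp] at h3
  change (limitLaw α F (Set.Ioc 0 w)).toReal ≤ _
  nlinarith

/-- The limiting quantile is at most that of the initial law `F`, whose tail is known. -/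
theorem exists_limitLaw_Ici_le (hα : 0 < α) (hα1 : α < 1) (hd : 1 ≤ d) :
    ∃ c : ℝ, 0 < c ∧ ∀ w : ℝ, (limitLaw α F).real (Set.Ici w) ≤ c * Real.exp (-(d * w)) := by
  obtain ⟨c, hc, h⟩ := hF.exists_measure_Ici_le hα
  refine ⟨c, hc, fun w => le_trans ?_ (h w)⟩
  have := hF.isProbabilityMeasure
  refine ENNReal.toReal_mono (measure_ne_top _ _) ?_
  rw [limitLaw, Measure.map_apply (hF.measurable_limitQuantile hα hα1 hd) measurableSet_Ici]
  conv_rhs => rw [← map_quantile F, Measure.map_apply (measurable_quantile F) measurableSet_Ici]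
  refine measure_mono_ae ?_
  filter_upwards [unifLaw_ae_mem] with s hs hw
  refine le_trans hw (ciInf_le (f := fun n => quantile (stepLaw α F n) s) ⟨0, ?_⟩ 0)
  rintro _ ⟨n, rfl⟩
  exact (hF.quantile_stepLaw_pos hα hα1 hd n hs).le

/-- Continuity is asked only on `(0, ∞)`, where the limit law lives: averages against the kernel may
jump at zero, and the stationarity proof needs such test functions. -/
lemma tendsto_integral_stepLaw (hα : 0 < α) (hα1 : α < 1) (hd : 1 ≤ d) {g : ℝ → ℝ}
    (hg : Measurable g) (hc : ∀ w, 0 < w → ContinuousAt g w) {C : ℝ} (hC : ∀ w, |g w| ≤ C) :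
    Tendsto (fun n => ∫ w, g w ∂(stepLaw α F n)) atTop (𝓝 (∫ w, g w ∂(limitLaw α F))) := by
  have hq : ∀ n, Measurable (quantile (stepLaw α F n)) := fun n =>
    have := (hF.stepLaw_spec hα hα1 hd n).1
    measurable_quantile _
  have hlq := hF.measurable_limitQuantile hα hα1 hd
  have hpos : ∀ᵐ s ∂unifLaw, 0 < limitQuantile α F s :=
    ae_of_ae_map hlq.aemeasurable (hF.limitLaw_ae_pos hα hα1 hd)
  have h1 : ∀ n, ∫ w, g w ∂(stepLaw α F n) = ∫ s, g (quantile (stepLaw α F n) s) ∂unifLaw := by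
    intro n
    have := (hF.stepLaw_spec hα hα1 hd n).1
    rw [← integral_map (hq n).aemeasurable hg.aestronglyMeasurable, map_quantile]
  simp only [h1]
  rw [limitLaw, integral_map hlq.aemeasurable hg.aestronglyMeasurable]
  refine tendsto_integral_of_dominated_convergence (fun _ => C)
    (fun n => (hg.comp (hq n)).aestronglyMeasurable) (integrable_const C)
    (fun n => Eventually.of_forall fun s => hC _) ?_
  filter_upwards [hF.ae_tendsto_limitQuantile hα hα1 hd, hpos] with s hs hs'
  exact (hc _ hs').tendsto.comp hs

/-- Numerator and denominator are primitives against an atomless measure, and the denominator is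
positive. -/
lemma continuousAt_integral_treeKernel (hα : 0 < α) (hα1 : α < 1) (hd : 1 ≤ d) {f : ℝ → ℝ}
    (hf : Measurable f) {C : ℝ} (hC : ∀ x, |f x| ≤ C) {w : ℝ} (hw : 0 < w) :
    ContinuousAt (fun w => ∫ x, f x ∂(treeKernel α F w)) w := by
  have := hF.isFiniteMeasure_expWeight
  have := hF.nullSingletonClass_expWeight
  have key : ∀ g : ℝ → ℝ, Integrable g (expWeight α F) →
      ContinuousAt (fun t => ∫ x in Set.Ioo 0 t, g x ∂(expWeight α F)) (w / α) := by
    intro g hg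
    refine (hg.continuous_primitive 0).continuousAt.congr ?_
    filter_upwards [lt_mem_nhds (div_pos hw hα)] with t ht
    rw [intervalIntegral.integral_of_le ht.le, integral_Ioc_eq_integral_Ioo]
  simp only [hF.integral_treeKernel]
  have hdiv : ContinuousAt (fun w : ℝ => w / α) w := by fun_prop
  refine ContinuousAt.mul (ContinuousAt.inv₀ ?_ ?_) ?_
  · have h1 := key (fun _ => 1) (integrable_const 1)
    have h2 := ContinuousAt.comp (f := fun w : ℝ => w / α) (x := w) h1 hdiv
    refine h2.congr (Eventually.of_forall fun t => ?_)
    simp [Function.comp]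
  · exact (hF.expWeight_real_pos hα hα1 hd (div_pos hw hα)).ne'
  · exact ContinuousAt.comp (f := fun w : ℝ => w / α) (x := w)
      (key f (integrable_of_bound hf hC)) hdiv

theorem limitLaw_bind (hα : 0 < α) (hα1 : α < 1) (hd : 1 ≤ d) :
    (limitLaw α F).bind (treeKernel α F) = limitLaw α F := by
  have := hF.isProbabilityMeasure_limitLaw hα hα1 hd
  have := hF.isProbabilityMeasure_bind hα hα1 hd (hF.limitLaw_ae_pos hα hα1 hd)
  refine ext_of_forall_integral_eq_of_IsFiniteMeasure fun f => ?_
  have hfm : Measurable f := f.continuous.measurable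
  have hfC : ∀ x, |f x| ≤ ‖f‖ := f.norm_coe_le_norm
  rw [integral_bind_kernel (integrable_of_bound hfm hfC)]
  have h1 := hF.tendsto_integral_stepLaw hα hα1 hd
    (hfm.stronglyMeasurable.integral_kernel (κ := treeKernel α F)).measurable
    (fun w hw => hF.continuousAt_integral_treeKernel hα hα1 hd hfm hfC hw)
    (fun w => hF.abs_integral_treeKernel_le w (norm_nonneg f) hfC)
  have h2 := (hF.tendsto_integral_stepLaw hα hα1 hd hfm
    (fun w _ => f.continuous.continuousAt) hfC).comp (tendsto_add_atTop_nat 1)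
  refine tendsto_nhds_unique h1 (h2.congr fun n => ?_)
  have := (hF.stepLaw_spec hα hα1 hd n).1
  have := (hF.stepLaw_spec hα hα1 hd (n + 1)).1
  have h3 : Integrable f ((stepLaw α F n).bind (treeKernel α F)) :=
    integrable_of_bound (μ := stepLaw α F (n + 1)) hfm hfC
  exact integral_bind_kernel h3

/-! ### Overlap and uniqueness of invariant measures -/

/-- Some level set `[a, ∞)` has positive mass. From every state in it the kernel dominates a fixed
multiple of the exponential weight on `(0, a/α)`. -/
lemma exists_smul_le_of_bind_le (hα : 0 < α) {μ : Measure ℝ} [IsFiniteMeasure μ]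
    (hμ0 : μ (Set.Iic 0) = 0) (hμ : μ ≠ 0) (hinv : μ.bind (treeKernel α F) ≤ μ) :
    ∃ ε : ℝ, 0 < ε ∧ ∃ c : ℝ≥0∞, c ≠ 0 ∧ c • (expWeight α F).restrict (Set.Ioo 0 ε) ≤ μ := by
  have := hF.isFiniteMeasure_expWeight
  obtain ⟨a, ha, hμa⟩ : ∃ a : ℝ, 0 < a ∧ μ (Set.Ici a) ≠ 0 := by
    by_contra! h
    refine hμ (Measure.measure_univ_eq_zero.1 ?_)
    have hu : (Set.univ : Set ℝ) = Set.Iic 0 ∪ ⋃ n : ℕ, Set.Ici (1 / ((n : ℝ) + 1)) := by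
      refine (Set.eq_univ_of_forall fun x => ?_).symm
      rcases le_or_gt x 0 with hx | hx
      · exact Or.inl hx
      · obtain ⟨n, hn⟩ := exists_nat_one_div_lt hx
        exact Or.inr (Set.mem_iUnion.2 ⟨n, hn.le⟩)
    rw [hu]
    exact measure_union_null hμ0 (measure_iUnion_null fun n => h _ (by positivity))
  refine ⟨a / α, div_pos ha hα, (expWeight α F Set.univ)⁻¹ * μ (Set.Ici a),
    mul_ne_zero (ENNReal.inv_ne_zero.2 (measure_ne_top _ _)) hμa, ?_⟩
  refine le_trans (Measure.le_iff.2 fun B hB => ?_) hinv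
  rw [Measure.smul_apply, smul_eq_mul, Measure.restrict_apply hB,
    Measure.bind_apply hB (treeKernel α F).aemeasurable]
  calc (expWeight α F Set.univ)⁻¹ * μ (Set.Ici a) * expWeight α F (B ∩ Set.Ioo 0 (a / α))
      = ∫⁻ _ in Set.Ici a, (expWeight α F Set.univ)⁻¹ *
          expWeight α F (B ∩ Set.Ioo 0 (a / α)) ∂μ := by
        rw [setLIntegral_const]; ring
    _ ≤ ∫⁻ w in Set.Ici a, treeKernel α F w B ∂μ := by
        refine setLIntegral_mono ((treeKernel α F).measurable_coe hB) fun w hw => ?_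
        rw [hF.treeKernel_apply_apply, Set.inter_comm B]
        refine mul_le_mul' (ENNReal.inv_le_inv.2 (measure_mono (Set.subset_univ _)))
          (measure_mono (Set.inter_subset_inter_left _ (Set.Ioo_subset_Ioo_right ?_)))
        exact div_le_div_of_nonneg_right hw hα.le
    _ ≤ ∫⁻ w, treeKernel α F w B ∂μ := setLIntegral_le_lintegral _ _

/-- Two non-zero invariant measures on `(0, ∞)` dominate a common non-zero measure. -/
theorem exists_common_le (hα : 0 < α) (hα1 : α < 1) (hd : 1 ≤ d) {μ ν : Measure ℝ}
    [IsFiniteMeasure μ] [IsFiniteMeasure ν] (hμ0 : μ (Set.Iic 0) = 0) (hν0 : ν (Set.Iic 0) = 0)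
    (hμ : μ ≠ 0) (hν : ν ≠ 0) (hμinv : μ.bind (treeKernel α F) ≤ μ)
    (hνinv : ν.bind (treeKernel α F) ≤ ν) : ∃ ρ : Measure ℝ, ρ ≠ 0 ∧ ρ ≤ μ ∧ ρ ≤ ν := by
  obtain ⟨ε, hε, c, hc, h⟩ := hF.exists_smul_le_of_bind_le hα hμ0 hμ hμinv
  obtain ⟨ε', hε', c', hc', h'⟩ := hF.exists_smul_le_of_bind_le hα hν0 hν hνinv
  refine ⟨min c c' • (expWeight α F).restrict (Set.Ioo 0 (min ε ε')), fun h0 => ?_, ?_, ?_⟩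
  · have h1 := congrArg (fun m : Measure ℝ => m Set.univ) h0
    simp only [Measure.smul_apply, smul_eq_mul, Measure.restrict_apply_univ, Measure.coe_zero,
      Pi.zero_apply, mul_eq_zero] at h1
    rcases h1 with h1 | h1
    · rcases min_choice c c' with h2 | h2 <;> rw [h2] at h1 <;> contradiction
    · exact (hF.expWeight_Ioo_pos hα hα1 hd (lt_min hε hε')).ne' h1
  · refine le_trans (Measure.le_iff.2 fun B hB => ?_) h
    rw [Measure.smul_apply, Measure.smul_apply, smul_eq_mul, smul_eq_mul]
    exact mul_le_mul' (min_le_left _ _)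
      (Measure.restrict_mono (Set.Ioo_subset_Ioo_right (min_le_left _ _)) le_rfl B)
  · refine le_trans (Measure.le_iff.2 fun B hB => ?_) h'
    rw [Measure.smul_apply, Measure.smul_apply, smul_eq_mul, smul_eq_mul]
    exact mul_le_mul' (min_le_right _ _)
      (Measure.restrict_mono (Set.Ioo_subset_Ioo_right (min_le_right _ _)) le_rfl B)

end IsTreeLaw

lemma bind_mono {κ : Kernel ℝ ℝ} {μ ν : Measure ℝ} (h : μ ≤ ν) : μ.bind κ ≤ ν.bind κ := by
  refine Measure.le_iff.2 fun B hB => ?_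
  rw [Measure.bind_apply hB κ.aemeasurable, Measure.bind_apply hB κ.aemeasurable]
  exact lintegral_mono' h le_rfl

lemma sub_bind {κ : Kernel ℝ ℝ} {μ θ : Measure ℝ} [IsFiniteMeasure μ] [IsFiniteMeasure θ] (hle : θ ≤ μ)
    (hμ : μ.bind κ = μ) (hθ : θ.bind κ = θ) :
    (μ - θ).bind κ = μ - θ := by
  have h1 : μ - θ + θ = μ := Measure.sub_add_cancel_of_le hle
  have h2 : (μ - θ).bind κ + θ = μ - θ + θ := by
    rw [h1]
    conv_rhs => rw [← hμ, ← h1]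
    refine Measure.ext fun B hB => ?_
    have h3 : θ B = ∫⁻ w, κ w B ∂θ := by
      rw [← Measure.bind_apply hB κ.aemeasurable, hθ]
    rw [Measure.add_apply, h3]
    simp only [Measure.bind_apply hB κ.aemeasurable, lintegral_add_measure]
  refine Measure.ext fun B hB => ?_
  have h3 := congrArg (fun m : Measure ℝ => m B) h2
  simp only [Measure.add_apply] at h3
  exact (ENNReal.add_left_inj (measure_ne_top θ B)).1 h3

namespace IsTreeLaw

variable (hF : IsTreeLaw d α F)
include hF

lemma bind_univ (hα : 0 < α) (hα1 : α < 1) (hd : 1 ≤ d) {μ : Measure ℝ}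
    (hμ0 : μ (Set.Iic 0) = 0) : μ.bind (treeKernel α F) Set.univ = μ Set.univ := by
  have hpos : ∀ᵐ w ∂μ, 0 < w := by
    rw [ae_iff]
    convert hμ0 using 2
    ext w
    simp
  rw [Measure.bind_apply MeasurableSet.univ (treeKernel α F).aemeasurable,
    lintegral_congr_ae (g := fun _ => 1)]
  · simp
  · filter_upwards [hpos] with w hw
    have := hF.isProbabilityMeasure_treeKernel hα hα1 hd hw
    exact measure_univ

/-- The kernel preserves total mass on `(0, ∞)`, so a finite measure that does not increase under it
is invariant. -/
lemma bind_eq_of_bind_le (hα : 0 < α) (hα1 : α < 1) (hd : 1 ≤ d) {μ : Measure ℝ}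
    [IsFiniteMeasure μ] (hμ0 : μ (Set.Iic 0) = 0) (h : μ.bind (treeKernel α F) ≤ μ) :
    μ.bind (treeKernel α F) = μ := by
  have : IsFiniteMeasure (μ.bind (treeKernel α F)) := isFiniteMeasure_of_le μ h
  exact Measure.eq_of_le_of_measure_univ_eq h (hF.bind_univ hα hα1 hd hμ0)

/-- The kernel has at most one invariant probability on `(0, ∞)`. -/
theorem eq_of_invariant (hα : 0 < α) (hα1 : α < 1) (hd : 1 ≤ d) {μ ν : Measure ℝ}
    [IsProbabilityMeasure μ] [IsProbabilityMeasure ν] (hμ0 : μ (Set.Iic 0) = 0)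
    (hν0 : ν (Set.Iic 0) = 0) (hμ : μ.bind (treeKernel α F) = μ)
    (hν : ν.bind (treeKernel α F) = ν) : μ = ν := by
  -- The infimum in the lattice of measures is excessive on the right side, hence invariant, and so
  -- are the two differences. If both were nonzero, a common minorant could be added to `θ`,
  -- contradicting maximality.
  set θ := μ ⊓ ν with hθdef
  have hθμ : θ ≤ μ := inf_le_left
  have hθν : θ ≤ ν := inf_le_right
  have : IsFiniteMeasure θ := isFiniteMeasure_of_le μ hθμ
  have hθ0 : θ (Set.Iic 0) = 0 := le_antisymm ((hθμ _).trans hμ0.le) zero_le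
  have hθ : θ.bind (treeKernel α F) = θ := by
    refine hF.bind_eq_of_bind_le hα hα1 hd hθ0 (le_inf ?_ ?_)
    · exact (bind_mono hθμ).trans hμ.le
    · exact (bind_mono hθν).trans hν.le
  have hsub : ∀ ρ : Measure ℝ, ρ (Set.Iic 0) = 0 → (ρ - θ) (Set.Iic 0) = 0 := fun ρ hρ =>
    le_antisymm ((Measure.sub_le (μ := ρ) (ν := θ) _).trans hρ.le) zero_le
  have hor : μ - θ = 0 ∨ ν - θ = 0 := by
    by_contra! h
    obtain ⟨ρ, hρ, h1, h2⟩ := hF.exists_common_le hα hα1 hd (hsub μ hμ0) (hsub ν hν0) h.1 h.2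
      (sub_bind hθμ hμ hθ).le (sub_bind hθν hν hθ).le
    have h3 : ρ + θ ≤ θ := by
      refine le_inf ?_ ?_
      · calc ρ + θ ≤ μ - θ + θ := add_le_add_left h1 θ
          _ = μ := Measure.sub_add_cancel_of_le hθμ
      · calc ρ + θ ≤ ν - θ + θ := add_le_add_left h2 θ
          _ = ν := Measure.sub_add_cancel_of_le hθν
    refine hρ (Measure.measure_univ_eq_zero.1 ?_)
    have h4 := h3 Set.univ
    rw [Measure.add_apply] at h4
    exact le_zero_iff.1 ((ENNReal.add_le_add_iff_right (measure_ne_top θ _)).1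
      (h4.trans_eq (zero_add _).symm))
  rcases hor with h | h
  · have h1 : θ = μ := by rw [← Measure.sub_add_cancel_of_le hθμ, h, zero_add]
    exact Measure.eq_of_le_of_isProbabilityMeasure (h1 ▸ hθν)
  · have h1 : θ = ν := by rw [← Measure.sub_add_cancel_of_le hθν, h, zero_add]
    exact (Measure.eq_of_le_of_isProbabilityMeasure (h1 ▸ hθμ)).symm

end IsTreeLaw

end TreeDLA
end

noncomputable section

namespace TreeDLA

/-! ### Conditional probabilities and independence -/

section CondProb

variable {Ω : Type*} {m mΩ : MeasurableSpace Ω} {P : Measure Ω} [IsProbabilityMeasure P]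

lemma condExp_indicator_ae_eq (hm : m ≤ mΩ) {T : Set Ω} (hT : MeasurableSet T) {g : Ω → ℝ≥0∞}
    (hg : Measurable[m] g) (hg1 : ∀ ω, g ω ≤ 1)
    (h : ∀ A, MeasurableSet[m] A → P (A ∩ T) = ∫⁻ ω in A, g ω ∂P) :
    P⟦T | m⟧ =ᵐ[P] fun ω => (g ω).toReal := by
  have hgm : Measurable g := hg.mono hm le_rfl
  have hint : Integrable (fun ω => (g ω).toReal) P := by
    refine Integrable.of_bound hgm.ennreal_toReal.aestronglyMeasurable 1
      (Eventually.of_forall fun ω => ?_)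
    rw [Real.norm_of_nonneg ENNReal.toReal_nonneg]
    exact ENNReal.toReal_le_of_le_ofReal zero_le_one (by simpa using hg1 ω)
  refine (ae_eq_condExp_of_forall_setIntegral_eq hm ?_ (fun _ _ _ => hint.integrableOn) ?_
    (hg.ennreal_toReal.stronglyMeasurable.aestronglyMeasurable)).symm
  · exact (integrable_const 1).indicator hT
  · intro A hA _
    rw [integral_toReal hgm.aemeasurable
      (Eventually.of_forall fun ω => (hg1 ω).trans_lt ENNReal.one_lt_top), ← h A hA,
      setIntegral_indicator hT, setIntegral_const, smul_eq_mul, mul_one]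
    rfl

lemma measure_inter_of_condExp_ae_eq (hm : m ≤ mΩ) {T : Set Ω} (hT : MeasurableSet T)
    {g : Ω → ℝ≥0∞} (hg : Measurable g) (hg1 : ∀ ω, g ω ≤ 1)
    (h : P⟦T | m⟧ =ᵐ[P] fun ω => (g ω).toReal) {A : Set Ω} (hA : MeasurableSet[m] A) :
    P (A ∩ T) = ∫⁻ ω in A, g ω ∂P := by
  have h1 : ∫ ω in A, (g ω).toReal ∂P = ∫ ω in A, T.indicator (fun _ => (1 : ℝ)) ω ∂P := by
    rw [← setIntegral_condExp hm ((integrable_const (1 : ℝ)).indicator hT) hA]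
    exact setIntegral_congr_ae (hm A hA) (h.mono fun ω hω _ => hω.symm)
  rw [integral_toReal hg.aemeasurable
    (Eventually.of_forall fun ω => (hg1 ω).trans_lt ENNReal.one_lt_top),
    setIntegral_indicator hT, setIntegral_const, smul_eq_mul, mul_one] at h1
  refine ((ENNReal.toReal_eq_toReal_iff' ?_ (measure_ne_top _ _)).1 h1).symm
  refine ne_top_of_le_ne_top (measure_ne_top P A) ?_
  calc ∫⁻ ω in A, g ω ∂P ≤ ∫⁻ _ in A, 1 ∂P := lintegral_mono hg1
    _ = P A := setLIntegral_one A

end CondProb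

lemma sup_eq_generateFrom {Ω : Type*} (m₁ m₂ : MeasurableSpace Ω) : m₁ ⊔ m₂ =
    MeasurableSpace.generateFrom
      {s | ∃ G, MeasurableSet[m₁] G ∧ ∃ H, MeasurableSet[m₂] H ∧ G ∩ H = s} := by
  refine le_antisymm (sup_le ?_ ?_) (MeasurableSpace.generateFrom_le ?_)
  · exact fun G hG => MeasurableSpace.measurableSet_generateFrom
      ⟨G, hG, Set.univ, MeasurableSet.univ, Set.inter_univ G⟩
  · exact fun H hH => MeasurableSpace.measurableSet_generateFrom
      ⟨Set.univ, MeasurableSet.univ, H, hH, Set.univ_inter H⟩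
  · rintro _ ⟨G, hG, H, hH, rfl⟩
    exact MeasurableSet.inter (le_sup_left (a := m₁) (b := m₂) G hG)
      (le_sup_right (a := m₁) (b := m₂) H hH)

/-- Conditional probabilities are not changed by independent information. -/
lemma measure_inter_eq_of_indep {Ω : Type*} {m₁ m₂ m₃ mΩ : MeasurableSpace Ω}
    {P : Measure Ω} [IsProbabilityMeasure P] (h₁ : m₁ ≤ mΩ) (h₂ : m₂ ≤ mΩ)
    (h₃ : m₃ ≤ m₂) (hind : Indep m₁ m₂ P) {T : Set Ω} (hT : MeasurableSet[m₂] T) {g : Ω → ℝ≥0∞}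
    (hg : Measurable[m₂] g) (h : ∀ H, MeasurableSet[m₃] H → P (H ∩ T) = ∫⁻ ω in H, g ω ∂P)
    {D : Set Ω} (hD : MeasurableSet[m₁ ⊔ m₃] D) : P (D ∩ T) = ∫⁻ ω in D, g ω ∂P := by
  have hle : m₁ ⊔ m₃ ≤ mΩ := sup_le h₁ (h₃.trans h₂)
  have hgm : Measurable g := hg.mono h₂ le_rfl
  -- Both sides are finite measures in `D`, so agreement is needed only on the intersections `G ∩
  -- H`, which form a generating π-system; there independence factors out `P G`.
  have key : (P.restrict T).trim hle = (P.withDensity g).trim hle := by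
    have hgen : ∀ s ∈ {s | ∃ G, MeasurableSet[m₁] G ∧ ∃ H, MeasurableSet[m₃] H ∧ G ∩ H = s},
        (P.restrict T).trim hle s = (P.withDensity g).trim hle s := by
      rintro _ ⟨G, hG, H, hH, rfl⟩
      have hGH : MeasurableSet[m₁ ⊔ m₃] (G ∩ H) := MeasurableSet.inter
        (le_sup_left (a := m₁) (b := m₃) G hG) (le_sup_right (a := m₁) (b := m₃) H hH)
      rw [trim_measurableSet_eq hle hGH, trim_measurableSet_eq hle hGH,
        Measure.restrict_apply (hle _ hGH), withDensity_apply _ (hle _ hGH), Set.inter_assoc,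
        (Indep_iff _ _ _).1 hind G (H ∩ T) hG (MeasurableSet.inter (h₃ H hH) hT), h H hH]
      have hGm : Measurable[m₁] (G.indicator fun _ => (1 : ℝ≥0∞)) := measurable_const.indicator hG
      have h4 := lintegral_mul_eq_lintegral_mul_lintegral_of_independent_measurableSpace
        h₁ h₂ hind (g := H.indicator g)
        hGm (hg.indicator (h₃ H hH))
      rw [lintegral_indicator_const (h₁ G hG), one_mul, lintegral_indicator (h₂ _ (h₃ H hH))] at h4
      rw [← h4, ← lintegral_indicator ((h₁ G hG).inter (h₂ _ (h₃ H hH)))]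
      refine lintegral_congr fun ω => ?_
      by_cases h5 : ω ∈ G <;> by_cases h6 : ω ∈ H <;> simp [h5, h6]
    refine ext_of_generate_finite _ (sup_eq_generateFrom m₁ m₃) ?_ hgen (hgen _
      ⟨Set.univ, MeasurableSet.univ, Set.univ, MeasurableSet.univ, Set.univ_inter _⟩)
    rintro _ ⟨G, hG, H, hH, rfl⟩ _ ⟨G', hG', H', hH', rfl⟩ -
    exact ⟨G ∩ G', MeasurableSet.inter hG hG', H ∩ H', MeasurableSet.inter hH hH',
      Set.inter_inter_inter_comm _ _ _ _⟩
  have h5 := congrArg (fun μ : @Measure Ω (m₁ ⊔ m₃) => μ D) key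
  simpa only [trim_measurableSet_eq hle hD, Measure.restrict_apply (hle _ hD),
    withDensity_apply _ (hle _ hD)] using h5

/-! ### The past of a backbone vertex -/

section Past

variable {d : ℕ} {α : ℝ} {Ω : Type*}

/-- The `σ`-field generated by the weights off the subtree of `y` and by the time to reach
infinity from the parent of `y` through `y`. -/
@[reducible] def parentPast (α : ℝ) (U : Vertex d → Ω → ℝ) (y : Vertex d) : MeasurableSpace Ω :=
  offSubtree U y ⊔ MeasurableSpace.comap (fun ω => edgeTime α (fun z => U z ω) y) inferInstance

variable {U : Vertex d → Ω → ℝ}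

lemma parentPast_le_widePastTime (U : Vertex d → Ω → ℝ) (y : Vertex d) :
    parentPast α U y ≤ widePastTime α U y := by
  refine sup_le ((iSup₂_le fun z hz => ?_).trans le_sup_left) ?_
  · exact le_iSup₂ (f := fun z (_ : z ∈ {z : Vertex d | ¬(y <+: z ∧ z ≠ y)}) =>
      MeasurableSpace.comap (U z) inferInstance) z fun h => hz h.1
  · refine Measurable.comap_le (m₁ := widePastTime α U y) ?_
    have h0 : Measurable[widePastTime α U y] fun ω => scaledTime α (fun z => U z ω) y := by
      rw [measurable_iff_comap_le]
      exact le_sup_right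
    unfold edgeTime
    refine Measurable.add ?_ (h0.const_mul _)
    · have h1 : Measurable[widePast U y] (U y) := measurable_biSup_comap fun h => h.2 rfl
      exact (h1.mono le_sup_left le_rfl).ennreal_ofReal

/-- On the event that the backbone passes through `x ++ [c]`, the past of `x` is contained in the
past of `x ++ [c]`. -/
lemma exists_parentPast_trace (hα : 0 < α) (x : Vertex d) (c : Fin d) (n : ℕ) {B : Set Ω}
    (hB : MeasurableSet[widePastTime α U x] B) :
    ∃ B', MeasurableSet[parentPast α U (x ++ [c])] B' ∧
      B ∩ {ω | backbone α (fun z => U z ω) (n + 1) = x ++ [c]} =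
        B' ∩ {ω | backbone α (fun z => U z ω) (n + 1) = x ++ [c]} := by
  set E := {ω | backbone α (fun z => U z ω) (n + 1) = x ++ [c]} with hE
  -- The events with the required trace form a `σ`-field, so generators suffice. Weights are already
  -- in the smaller past, and on the event `W(x)` coincides with the time through the edge to `x ++
  -- [c]`.
  suffices hle : widePastTime α U x ≤
      ((parentPast α U (x ++ [c])).comap (Subtype.val : E → Ω)).map Subtype.val by
    obtain ⟨B', hB', h⟩ := hle B hB
    refine ⟨B', hB', ?_⟩
    rw [Set.inter_comm B, Set.inter_comm B']
    exact (Subtype.preimage_coe_eq_preimage_coe_iff.1 h).symm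
  refine sup_le (iSup₂_le fun z hz => ?_) ?_
  · have h1 : Measurable[parentPast α U (x ++ [c])] (U z) := by
      have h2 : Measurable[offSubtree U (x ++ [c])] (U z) := measurable_biSup_comap fun h => by
        refine hz ⟨(List.prefix_append x [c]).trans h, fun hzx => ?_⟩
        have := h.length_le
        simp [hzx] at this
      exact h2.mono le_sup_left le_rfl
    exact h1.comap_le.trans fun A hA => ⟨A, hA, rfl⟩
  · rintro _ ⟨S, hS, rfl⟩
    refine ⟨(fun ω => edgeTime α (fun z => U z ω) (x ++ [c])) ⁻¹' S, ?_, ?_⟩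
    · exact le_sup_right (a := offSubtree U (x ++ [c])) _ ⟨S, hS, rfl⟩
    · ext ⟨ω, hω⟩
      simp only [Set.mem_preimage]
      rw [(scaledTime_eq_edgeTime_of_backbone hα hω).2]

variable [mΩ : MeasurableSpace Ω] {P : Measure Ω}

/-- Events of the past of the `n`-th backbone vertex, traced on the possible positions of the next
backbone vertex. -/
lemma exists_parentPast_trace_of_backbonePast (hα : 0 < α) {n : ℕ} {A : Set Ω}
    (hA : MeasurableSet[backbonePast α U n] A) {y : Vertex d} (hy : y.length = n + 1) :
    ∃ B, MeasurableSet[parentPast α U y] B ∧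
      A ∩ {ω | backbone α (fun z => U z ω) (n + 1) = y} =
        B ∩ {ω | backbone α (fun z => U z ω) (n + 1) = y} := by
  obtain ⟨x, c, rfl⟩ : ∃ x c, y = x ++ [c] := by
    rcases List.eq_nil_or_concat y with h | ⟨x, c, h⟩
    · simp [h] at hy
    · exact ⟨x, c, by simpa using h⟩
  obtain ⟨B, hB, h⟩ := hA.2 x (by simpa using hy)
  obtain ⟨B', hB', h'⟩ := exists_parentPast_trace hα x c n hB
  refine ⟨B', hB', ?_⟩
  rw [← h']
  ext ω
  have h1 := Set.ext_iff.1 h ω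
  simp only [Set.mem_inter_iff, Set.mem_ofPred_eq] at h1 ⊢
  constructor
  · rintro ⟨h2, h3⟩
    exact ⟨(h1.1 ⟨h2, (scaledTime_eq_edgeTime_of_backbone hα h3).1⟩).1, h3⟩
  · rintro ⟨h2, h3⟩
    exact ⟨(h1.2 ⟨h2, (scaledTime_eq_edgeTime_of_backbone hα h3).1⟩).1, h3⟩

/-- The wide past of a vertex is not contained in that of its child, because `W` at the parent looks
into the whole subtree; the inclusion holds only after restriction to the position of the backbone.
-/
lemma monotone_backbonePast (hα : 0 < α) (U : Vertex d → Ω → ℝ) :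
    Monotone (backbonePast α U) := by
  refine monotone_nat_of_le_succ fun n A hA => ⟨hA.1, fun y hy => ?_⟩
  obtain ⟨B, hB, h⟩ := exists_parentPast_trace_of_backbonePast hα hA hy
  exact ⟨B, parentPast_le_widePastTime U y B hB, h⟩

lemma measurable_W_backbonePast (hα : 0 < α) (hU : ∀ z, Measurable (U z)) (n : ℕ) :
    Measurable[backbonePast α U n] (W α U n) := by
  intro S hS
  refine ⟨measurable_W hα hU n hS, fun x _ =>
    ⟨(fun ω => (scaledTime α (fun z => U z ω) x).toReal) ⁻¹' S, ?_, ?_⟩⟩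
  · have h1 : Measurable[widePastTime α U x] fun ω => scaledTime α (fun z => U z ω) x := by
      rw [measurable_iff_comap_le]
      exact le_sup_right
    exact h1.ennreal_toReal hS
  · ext ω
    simp only [Set.mem_inter_iff, Set.mem_preimage, Set.mem_ofPred_eq, W, backboneTime]
    constructor <;> rintro ⟨h1, h2⟩
    · exact ⟨by rwa [h2] at h1, h2⟩
    · exact ⟨by rwa [h2], h2⟩

/-- Up to a null set, the event that the backbone passes through `x ++ [c]` is in the past of
`x ++ [c]`. -/
lemma IsExpEnvironment.exists_backbone_ae_eq (hU : IsExpEnvironment U P) (hα : 0 < α)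
    (hα1 : α < 1) (hd : 1 ≤ d) (x : Vertex d) (c : Fin d) :
    ∃ E, MeasurableSet[parentPast α U (x ++ [c])] E ∧
      {ω | backbone α (fun z => U z ω) (x.length + 1) = x ++ [c]} =ᵐ[P] E := by
  refine ⟨⋂ y : Vertex d, ⋂ _ : y.length = x.length + 1, ⋂ _ : y ≠ x ++ [c],
    {ω | totalTime α (fun z => U z ω) (x ++ [c]) < totalTime α (fun z => U z ω) y}, ?_, ?_⟩
  · refine MeasurableSet.iInter fun y => MeasurableSet.iInter fun hy =>
      MeasurableSet.iInter fun hyx => ?_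
    have h1 := (measurable_totalTime_offSubtree (α := α) hα U (y := x ++ [c]) (y' := y)
      (by simpa using hy) hyx).mono (le_sup_left (b := MeasurableSpace.comap
        (fun ω => edgeTime α (fun z => U z ω) (x ++ [c])) inferInstance)) le_rfl
    have h2 : Measurable[parentPast α U (x ++ [c])]
        fun ω => totalTime α (fun z => U z ω) (x ++ [c]) := by
      have h3 : Measurable[parentPast α U (x ++ [c])]
          fun ω => edgeTime α (fun z => U z ω) (x ++ [c]) := by
        rw [measurable_iff_comap_le]
        exact le_sup_right
      simp only [totalTime_concat hα]
      exact ((measurable_passageTime_offSubtree U x c).mono le_sup_left le_rfl).add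
        (h3.const_mul _)
    exact (h2.prodMk h1) measurableSet_lt'
  · refine Filter.eventuallyEq_set.2 ?_
    filter_upwards [hU.ae_isGeneric hα hα1 hd] with ω hω
    have h := hω.backbone_eq_iff hα hd (n := x.length + 1) (x := x ++ [c]) (by simp)
    refine h.trans ?_
    simp only [Set.mem_iInter, Set.mem_ofPred_eq]

lemma IsExpEnvironment.measure_edgeTime_inter (hU : IsExpEnvironment U P) (hα : 0 < α)
    (hα1 : α < 1) (hd : 1 ≤ d) (y : Vertex d) {S : Set ℝ≥0∞} (hS : MeasurableSet S)
    {B : Set ℝ} (hB : MeasurableSet B) :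
    P ((fun ω => edgeTime α (fun z => U z ω) y) ⁻¹' S ∩
        (fun ω => (scaledTime α (fun z => U z ω) y).toReal) ⁻¹' B) =
      ∫⁻ ω in (fun ω => edgeTime α (fun z => U z ω) y) ⁻¹' S,
        treeKernel α (rootLaw d α) (edgeTime α (fun z => U z ω) y).toReal B ∂P := by
  have hF := isTreeLaw_rootLaw hα hα1 hd
  have := isProbabilityMeasure_rootLaw d hα
  have h1 := (measurable_edgeTime hα (U := U) (x := y) fun z => hU.measurable _).ennreal_toReal
  have h2 := (measurable_scaledTime hα (U := U) (x := y) fun z _ => hU.measurable _).ennreal_toReal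
  have hS' : MeasurableSet (ENNReal.ofReal ⁻¹' S) := ENNReal.measurable_ofReal hS
  have hae : (fun ω => edgeTime α (fun z => U z ω) y) ⁻¹' S =ᵐ[P]
      (fun ω => (edgeTime α (fun z => U z ω) y).toReal) ⁻¹' (ENNReal.ofReal ⁻¹' S) := by
    filter_upwards [hU.ae_edgeTime_toReal hα hα1 hd] with ω hω
    change (edgeTime α (fun z => U z ω) y ∈ S) =
      (ENNReal.ofReal (edgeTime α (fun z => U z ω) y).toReal ∈ S)
    rw [ENNReal.ofReal_toReal (hω y).1]
  have hae' : ((fun ω => edgeTime α (fun z => U z ω) y) ⁻¹' S ∩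
      (fun ω => (scaledTime α (fun z => U z ω) y).toReal) ⁻¹' B : Set Ω) =ᵐ[P]
      ((fun ω => (edgeTime α (fun z => U z ω) y).toReal) ⁻¹' (ENNReal.ofReal ⁻¹' S) ∩
      (fun ω => (scaledTime α (fun z => U z ω) y).toReal) ⁻¹' B : Set Ω) :=
    ae_eq_set_inter hae (ae_eq_refl _)
  rw [measure_congr hae', setLIntegral_congr hae]
  have h3 : P ((fun ω => (edgeTime α (fun z => U z ω) y).toReal) ⁻¹' (ENNReal.ofReal ⁻¹' S) ∩
      (fun ω => (scaledTime α (fun z => U z ω) y).toReal) ⁻¹' B) =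
      P.map (fun ω => ((edgeTime α (fun z => U z ω) y).toReal,
        (scaledTime α (fun z => U z ω) y).toReal)) ((ENNReal.ofReal ⁻¹' S) ×ˢ B) := by
    rw [Measure.map_apply (h1.prodMk h2) (hS'.prod hB)]
    rfl
  rw [h3, hU.map_edgeTime_prod hα hα1 hd y, hF.map_prod_eq_compProd hα,
    Measure.compProd_apply_prod hS' hB, ← hU.map_edgeTime hα hα1 hd y,
    setLIntegral_map hS' ((treeKernel α (rootLaw d α)).measurable_coe hB) h1]

/-- Given the edge time, the law of `W(y)` is the kernel; the weights off the subtree of `y` are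
independent of both and add no information. -/
lemma IsExpEnvironment.measure_inter_scaledTime (hU : IsExpEnvironment U P) (hα : 0 < α)
    (hα1 : α < 1) (hd : 1 ≤ d) (y : Vertex d) {B : Set ℝ} (hB : MeasurableSet B) {D : Set Ω}
    (hD : MeasurableSet[parentPast α U y] D) :
    P (D ∩ (fun ω => (scaledTime α (fun z => U z ω) y).toReal) ⁻¹' B) =
      ∫⁻ ω in D, treeKernel α (rootLaw d α) (edgeTime α (fun z => U z ω) y).toReal B ∂P := by
  have := hU.isProbabilityMeasure
  have h1 := measurable_edgeTime_onSubtree hα U y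
  refine measure_inter_eq_of_indep (hU.biSup_comap_le _) (hU.biSup_comap_le _) h1.comap_le
    (hU.indep_subtree y) ((measurable_scaledTime_onSubtree hα U y).ennreal_toReal hB)
    (((treeKernel α (rootLaw d α)).measurable_coe hB).comp h1.ennreal_toReal) ?_ hD
  rintro _ ⟨S, hS, rfl⟩
  exact hU.measure_edgeTime_inter hα hα1 hd y hS hB

/-- The Markov property on an event of the past. -/
theorem IsExpEnvironment.measure_inter_W (hU : IsExpEnvironment U P) (hα : 0 < α)
    (hα1 : α < 1) (hd : 1 ≤ d) (n : ℕ) {B : Set ℝ} (hB : MeasurableSet B) {A : Set Ω}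
    (hA : MeasurableSet[backbonePast α U n] A) :
    P (A ∩ W α U (n + 1) ⁻¹' B) =
      ∫⁻ ω in A, treeKernel α (rootLaw d α) (W α U n ω) B ∂P := by
  have hbm := measurableSet_backbone_eq hα hU.measurable (n + 1)
  set N : Vertex d → Set Ω := fun y => {ω | backbone α (fun z => U z ω) (n + 1) = y} with hN
  have hcover : ∀ D : Set Ω, D = ⋃ y, D ∩ N y := by
    intro D
    ext ω
    simp [hN]
  have hdisj : ∀ D : Set Ω, Pairwise (Function.onFun Disjoint fun y => D ∩ N y) := by
    intro D y y' hne
    refine Set.disjoint_left.2 fun ω h h' => hne ?_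
    exact h.2.symm.trans h'.2
  have hWm := measurable_W hα hU.measurable (n + 1) hB
  rw [hcover (A ∩ _), measure_iUnion (hdisj _) fun y => (hA.1.inter hWm).inter (hbm y)]
  conv_rhs => rw [hcover A, lintegral_iUnion (fun y => hA.1.inter (hbm y)) (hdisj _)]
  congr 1
  funext y
  -- For each possible position the event is traced to the past of that vertex. Words of the wrong
  -- length carry no mass, since they arise only from the default value of the backbone.
  by_cases hy : y.length = n + 1
  · obtain ⟨D, hD, hAD⟩ := exists_parentPast_trace_of_backbonePast hα hA hy
    obtain ⟨x, c, rfl⟩ : ∃ x c, y = x ++ [c] := by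
      rcases List.eq_nil_or_concat y with h | ⟨x, c, h⟩
      · simp [h] at hy
      · exact ⟨x, c, by simpa using h⟩
    have hx : x.length = n := by simpa using hy
    obtain ⟨E, hE, hNE⟩ := hU.exists_backbone_ae_eq hα hα1 hd x c
    rw [hx] at hNE
    have h1 := hU.measure_inter_scaledTime hα hα1 hd (x ++ [c]) hB (MeasurableSet.inter hD hE)
    have h2 : (A ∩ N (x ++ [c]) : Set Ω) =ᵐ[P] (D ∩ E : Set Ω) := by
      rw [hAD]
      exact ae_eq_set_inter (ae_eq_refl (D : Set Ω)) hNE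
    have h2' : (A ∩ N (x ++ [c]) ∩
        (fun ω => (scaledTime α (fun z => U z ω) (x ++ [c])).toReal) ⁻¹' B : Set Ω) =ᵐ[P]
        (D ∩ E ∩ (fun ω => (scaledTime α (fun z => U z ω) (x ++ [c])).toReal) ⁻¹' B : Set Ω) :=
      ae_eq_set_inter h2 (ae_eq_refl _)
    rw [← setLIntegral_congr h2, ← measure_congr h2'] at h1
    calc P (A ∩ W α U (n + 1) ⁻¹' B ∩ N (x ++ [c]))
        = P (A ∩ N (x ++ [c]) ∩
            (fun ω => (scaledTime α (fun z => U z ω) (x ++ [c])).toReal) ⁻¹' B) := by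
          congr 1
          ext ω
          simp only [Set.mem_inter_iff, Set.mem_preimage, hN, Set.mem_ofPred_eq, W, backboneTime]
          constructor
          · rintro ⟨⟨h3, h4⟩, h5⟩
            exact ⟨⟨h3, h5⟩, by rwa [h5] at h4⟩
          · rintro ⟨⟨h3, h5⟩, h4⟩
            exact ⟨⟨h3, by rwa [h5]⟩, h5⟩
      _ = _ := h1
      _ = _ := by
          refine setLIntegral_congr_fun (hA.1.inter (hbm _)) fun ω hω => ?_
          obtain ⟨h3, h4⟩ := scaledTime_eq_edgeTime_of_backbone hα (u := fun z => U z ω) hω.2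
          simp only [W, backboneTime, h3, h4]
  · have hnull : P (N y) = 0 := by
      refine measure_mono_null ?_ (ae_iff.1 (hU.ae_isGeneric hα hα1 hd))
      intro ω hω hgen
      refine hy ?_
      rw [← show backbone α (fun z => U z ω) (n + 1) = y from hω]
      exact (backbone_isLine (hgen.existsUnique_line hα hd) (n + 1)).1
    rw [measure_mono_null Set.inter_subset_right hnull,
      setLIntegral_measure_zero _ _ (measure_mono_null Set.inter_subset_right hnull)]

lemma IsExpEnvironment.map_W_zero (hU : IsExpEnvironment U P) (hα : 0 < α) :
    P.map (W α U 0) = rootLaw d α := by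
  rw [← hU.map_scaledTime hα []]
  congr 1
  funext ω
  rw [W, backboneTime, backbone_zero]

lemma IsExpEnvironment.backboneKernel_eq (hU : IsExpEnvironment U P) (hα : 0 < α) :
    backboneKernel α U P = treeKernel α (rootLaw d α) := by
  rw [backboneKernel, hU.map_W_zero hα, treeKernel]

lemma IsExpEnvironment.map_W (hU : IsExpEnvironment U P) (hα : 0 < α) (hα1 : α < 1) (hd : 1 ≤ d)
    (n : ℕ) : P.map (W α U n) = stepLaw α (rootLaw d α) n := by
  induction n with
  | zero => exact hU.map_W_zero hα
  | succ n ih =>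
    refine Measure.ext fun B hB => ?_
    rw [stepLaw, ← ih, Measure.bind_apply hB (Kernel.aemeasurable _),
      lintegral_map (Kernel.measurable_coe _ hB) (measurable_W hα hU.measurable n),
      Measure.map_apply (measurable_W hα hU.measurable _) hB, ← setLIntegral_univ,
      ← hU.measure_inter_W hα hα1 hd n hB MeasurableSet.univ, Set.univ_inter]

theorem IsExpEnvironment.isMarkovChain (hU : IsExpEnvironment U P) (hα : 0 < α) (hα1 : α < 1)
    (hd : 1 ≤ d) : IsMarkovChain P (backbonePast α U) (W α U) (backboneKernel α U P) where
  mono := monotone_backbonePast hα U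
  le _ _ hA := hA.1
  adapted n := measurable_W_backbonePast hα hU.measurable n
  markov n B hB := by
    have := hU.isProbabilityMeasure
    have hF := isTreeLaw_rootLaw hα hα1 hd
    rw [hU.backboneKernel_eq hα]
    refine condExp_indicator_ae_eq (m := backbonePast α U n) (fun _ hA => hA.1) (measurable_W hα hU.measurable _ hB)
      (((treeKernel α (rootLaw d α)).measurable_coe hB).comp
        (measurable_W_backbonePast hα hU.measurable n)) (fun ω => ?_)
      fun A hA => hU.measure_inter_W hα hα1 hd n hB hA
    simp only [treeKernel, condKernel_apply]
    rw [cond_apply measurableSet_Ioo]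
    exact (mul_le_mul_right (measure_mono Set.inter_subset_left) _).trans
      (ENNReal.inv_mul_le_one _)

lemma IsExpEnvironment.ae_backbone (hU : IsExpEnvironment U P) (hα : 0 < α) (hα1 : α < 1)
    (hd : 1 ≤ d) : ∀ᵐ ω ∂P, (∃! ξ : ℕ → Vertex d, IsLineOfDescent α (fun x => U x ω) ξ) ∧
      ∀ n, 0 < W α U n ω := by
  filter_upwards [hU.ae_isGeneric hα hα1 hd] with ω hω
  exact ⟨hω.existsUnique_line hα hd, fun n =>
    ENNReal.toReal_pos (hω.scaledTime_pos _).ne' (hω.scaledTime_ne_top _)⟩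

end Past

end TreeDLA
end

noncomputable section

namespace TreeDLA

/-! ### Chains on path space -/

/-- The `σ`-field generated by the first `n + 1` coordinates. -/
@[reducible] def coordPast (n : ℕ) : MeasurableSpace (ℕ → ℝ) :=
  ⨆ k ∈ Set.Iic n, MeasurableSpace.comap (fun x : ℕ → ℝ => x k) inferInstance

lemma coordPast_le (n : ℕ) : coordPast n ≤ MeasurableSpace.pi :=
  iSup₂_le fun k _ => (measurable_pi_apply k).comap_le

lemma measurable_coordPast {k n : ℕ} (h : k ≤ n) :
    Measurable[coordPast n] fun x : ℕ → ℝ => x k := by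
  rw [measurable_iff_comap_le]
  exact le_iSup₂ (f := fun k (_ : k ∈ Set.Iic n) =>
    MeasurableSpace.comap (fun x : ℕ → ℝ => x k) inferInstance) k h

lemma monotone_coordPast : Monotone coordPast := fun _ _ h =>
  iSup₂_le fun _ hk => (measurable_coordPast (le_trans hk h)).comap_le

/-- The natural filtration of path space. -/
def coordFiltration : Filtration ℕ (MeasurableSpace.pi : MeasurableSpace (ℕ → ℝ)) where
  seq := coordPast
  mono' := monotone_coordPast
  le' := coordPast_le

/-- The path after time `m`. -/
def tailPath (m : ℕ) (x : ℕ → ℝ) : ℕ → ℝ := fun i => x (m + i)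

lemma measurable_tailPath (m : ℕ) : Measurable (tailPath m) :=
  measurable_pi_lambda _ fun _ => measurable_pi_apply _

lemma tailPath_zero (x : ℕ → ℝ) : tailPath 0 x = x := by
  funext i
  simp [tailPath]

lemma tailPath_succ (m : ℕ) (x : ℕ → ℝ) : tailPath (m + 1) x = shift (tailPath m x) := by
  funext i
  simp [tailPath, shift, add_assoc, add_comm 1 i]

lemma tailPath_mem_iff {A : Set (ℕ → ℝ)} (hA : shift ⁻¹' A = A) (m : ℕ) (x : ℕ → ℝ) :
    tailPath m x ∈ A ↔ x ∈ A := by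
  induction m with
  | zero => rw [tailPath_zero]
  | succ m ih => rw [tailPath_succ, ← ih, ← Set.mem_preimage, hA]

namespace IsChainLaw

variable {κ : Kernel ℝ ℝ} {μ : Measure ℝ} {Q : Measure (ℕ → ℝ)} (hQ : IsChainLaw κ μ Q)
  (hκ : ∀ w, κ w Set.univ ≤ 1)
include hQ hκ

lemma measure_inter (n : ℕ) {B : Set ℝ} (hB : MeasurableSet B) {D : Set (ℕ → ℝ)}
    (hD : MeasurableSet[coordPast n] D) :
    Q (D ∩ (fun x => x (n + 1)) ⁻¹' B) = ∫⁻ x in D, κ (x n) B ∂Q := by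
  have := hQ.isProbabilityMeasure
  exact measure_inter_of_condExp_ae_eq (coordPast_le n) (measurable_pi_apply (n + 1) hB)
    ((κ.measurable_coe hB).comp (measurable_pi_apply n))
    (fun x => (measure_mono (Set.subset_univ _)).trans (hκ _)) (hQ.chain.markov n B hB) hD

lemma map_restrict_succ (n : ℕ) {D : Set (ℕ → ℝ)} (hD : MeasurableSet[coordPast n] D) :
    (Q.restrict D).map (fun x => x (n + 1)) = ((Q.restrict D).map fun x => x n).bind κ := by
  have hm : Measurable fun x : ℕ → ℝ => x (n + 1) := measurable_pi_apply _
  refine Measure.ext fun B hB => ?_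
  rw [Measure.map_apply hm hB,
    Measure.restrict_apply (measurable_pi_apply (n + 1) hB), Set.inter_comm,
    hQ.measure_inter hκ n hB hD, Measure.bind_apply hB κ.aemeasurable,
    lintegral_map (κ.measurable_coe hB) (measurable_pi_apply n)]

lemma setLIntegral_succ (n : ℕ) {D : Set (ℕ → ℝ)} (hD : MeasurableSet[coordPast n] D)
    {f : ℝ → ℝ≥0∞} (hf : Measurable f) :
    ∫⁻ x in D, f (x (n + 1)) ∂Q = ∫⁻ x in D, ∫⁻ v, f v ∂(κ (x n)) ∂Q := by
  rw [← lintegral_map hf (measurable_pi_apply (n + 1)), hQ.map_restrict_succ hκ n hD,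
    Measure.lintegral_bind κ.aemeasurable hf.aemeasurable,
    lintegral_map hf.lintegral_kernel (measurable_pi_apply n)]

lemma map_eval (hμ : μ.bind κ = μ) (n : ℕ) : Q.map (fun x => x n) = μ := by
  induction n with
  | zero => exact hQ.initial
  | succ n ih =>
    have h := hQ.map_restrict_succ hκ n MeasurableSet.univ
    rw [Measure.restrict_univ, ih, hμ] at h
    exact h

/-- Integrate out the coordinates from last to first. The point is that the same `g` serves for
every time `m`, which expresses time homogeneity. -/
lemma exists_cylinder (k : ℕ) {B : ℕ → Set ℝ} (hB : ∀ i, MeasurableSet (B i)) :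
    ∃ g : ℝ → ℝ≥0∞, Measurable g ∧ ∀ m, ∀ D, MeasurableSet[coordPast m] D →
      Q (D ∩ tailPath m ⁻¹' {x | ∀ i < k, x i ∈ B i}) = ∫⁻ x in D, g (x m) ∂Q := by
  induction k generalizing B with
  | zero => exact ⟨fun _ => 1, measurable_const, fun m D _ => by simp⟩
  | succ k ih =>
    obtain ⟨g, hg, h⟩ := ih (B := fun i => B (i + 1)) fun i => hB _
    refine ⟨(B 0).indicator fun w => ∫⁻ v, g v ∂(κ w), hg.lintegral_kernel.indicator (hB 0),
      fun m D hD => ?_⟩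
    have hD0 : MeasurableSet[coordPast m] ((fun x : ℕ → ℝ => x m) ⁻¹' B 0) :=
      measurable_coordPast le_rfl (hB 0)
    have hD' : MeasurableSet[coordPast m] (D ∩ (fun x : ℕ → ℝ => x m) ⁻¹' B 0) :=
      MeasurableSet.inter hD hD0
    have hset : D ∩ tailPath m ⁻¹' {x | ∀ i < k + 1, x i ∈ B i} =
        (D ∩ (fun x : ℕ → ℝ => x m) ⁻¹' B 0) ∩
          tailPath (m + 1) ⁻¹' {x | ∀ i < k, x i ∈ B (i + 1)} := by
      ext x
      simp only [Set.mem_inter_iff, Set.mem_preimage, Set.mem_ofPred_eq, tailPath, and_assoc,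
        Nat.forall_lt_succ_left, Nat.add_zero]
      simp only [add_assoc, add_comm 1]
    rw [hset, h (m + 1) _ (monotone_coordPast (Nat.le_succ m) _ hD'),
      hQ.setLIntegral_succ hκ m hD' hg, ← lintegral_indicator (coordPast_le m _ hD'),
      ← lintegral_indicator (coordPast_le m _ hD)]
    refine lintegral_congr fun x => ?_
    by_cases h1 : x ∈ D <;> by_cases h2 : x m ∈ B 0 <;> simp [h1, h2]

/-- The conditional law of the future of a stationary chain. -/
theorem measure_inter_tailPath [IsFiniteMeasure Q] (hμ : μ.bind κ = μ) (m : ℕ) {A : Set (ℕ → ℝ)}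
    (hA : MeasurableSet A) {D : Set (ℕ → ℝ)} (hD : MeasurableSet[coordPast m] D) :
    Q (D ∩ tailPath m ⁻¹' A) =
      ∫⁻ x in D, condDistrib id (fun y : ℕ → ℝ => y 0) Q (x m) A ∂Q := by
  have := hQ.isProbabilityMeasure
  set K := condDistrib id (fun y : ℕ → ℝ => y 0) Q with hK
  have hprob : IsProbabilityMeasure μ :=
    hQ.initial ▸ Measure.isProbabilityMeasure_map (measurable_pi_apply 0).aemeasurable
  have hcyl : ∀ C ∈ squareCylinders fun _ : ℕ => {s : Set ℝ | MeasurableSet s},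
      Q (D ∩ tailPath m ⁻¹' C) = ∫⁻ x in D, K (x m) C ∂Q := by
    rintro _ ⟨s, t, ht, rfl⟩
    classical
    have ht' : ∀ i, MeasurableSet (t i) := fun i => ht i (Set.mem_univ i)
    set B : ℕ → Set ℝ := fun i => if i ∈ s then t i else Set.univ with hBdef
    have hB : ∀ i, MeasurableSet (B i) := by
      intro i
      simp only [hBdef]
      split_ifs
      exacts [ht' i, MeasurableSet.univ]
    obtain ⟨g, hg, h⟩ := hQ.exists_cylinder hκ (s.sup id + 1) hB
    have hset : ((s : Set ℕ).pi t) = {x : ℕ → ℝ | ∀ i < s.sup id + 1, x i ∈ B i} := by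
      ext x
      simp only [Set.mem_pi, Finset.mem_coe, Set.mem_ofPred_eq, hBdef]
      constructor
      · intro hx i _
        split_ifs with his
        · exact hx i his
        · trivial
      · intro hx i his
        have := hx i (Nat.lt_succ_of_le (Finset.le_sup (f := id) his))
        rwa [if_pos his] at this
    rw [hset, h m D hD]
    set C := {x : ℕ → ℝ | ∀ i < s.sup id + 1, x i ∈ B i} with hC
    have hCm : MeasurableSet C :=
      hset ▸ MeasurableSet.pi s.countable_toSet fun i _ => ht' i
    -- At time `0` the function `g` is a version of the conditional probability given the initial
    -- state. As every coordinate has law `μ`, the identification transfers to time `m`.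
    have hae : g =ᵐ[μ] fun w => K w C := by
      refine ae_eq_of_forall_setLIntegral_eq_of_sigmaFinite hg (K.measurable_coe hCm)
        fun S hS _ => ?_
      have h1 := h 0 _ (measurable_coordPast (le_refl 0) hS)
      have h2 : ∫⁻ w in S, g w ∂μ = ∫⁻ x in (fun x : ℕ → ℝ => x 0) ⁻¹' S, g (x 0) ∂Q := by
        rw [← hQ.initial, setLIntegral_map hS hg (measurable_pi_apply 0)]
      have h3 : ∫⁻ w in S, K w C ∂μ = Q ((fun x : ℕ → ℝ => x 0) ⁻¹' S ∩ C) := by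
        have h4 := compProd_map_condDistrib (mβ := Real.measurableSpace) (μ := Q) (X := fun y : ℕ → ℝ => y 0) (Y := id)
          aemeasurable_id
        rw [← hK, hQ.initial] at h4
        rw [← Measure.compProd_apply_prod hS hCm, h4,
          Measure.map_apply ((measurable_pi_apply 0).prodMk measurable_id) (hS.prod hCm)]
        rfl
      rw [h2, ← h1, h3]
      congr 2
      ext x
      rw [Set.mem_preimage, tailPath_zero]
    refine lintegral_congr_ae (ae_restrict_of_ae ?_)
    exact ae_of_ae_map (f := fun x : ℕ → ℝ => x m) (measurable_pi_apply m).aemeasurable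
      ((hQ.map_eval hκ hμ m).symm ▸ hae)
  have key : (Q.restrict D).map (tailPath m) = ((Q.restrict D).map fun x => x m).bind K := by
    have happ : ∀ C, MeasurableSet C → (Q.restrict D).map (tailPath m) C =
        Q (D ∩ tailPath m ⁻¹' C) := fun C hC => by
      rw [Measure.map_apply (measurable_tailPath m) hC,
        Measure.restrict_apply (measurable_tailPath m hC), Set.inter_comm]
    have happ' : ∀ C, MeasurableSet C → ((Q.restrict D).map fun x => x m).bind K C =
        ∫⁻ x in D, K (x m) C ∂Q := fun C hC => by
      rw [Measure.bind_apply hC K.aemeasurable,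
        lintegral_map (K.measurable_coe hC) (measurable_pi_apply m)]
    refine ext_of_generate_finite _ generateFrom_squareCylinders.symm
      (isPiSystem_squareCylinders (fun _ => MeasurableSpace.isPiSystem_measurableSet) (by simp))
      (fun C hC => ?_) ?_
    · have hCm : MeasurableSet C := by
        obtain ⟨s, t, ht, rfl⟩ := hC
        exact MeasurableSet.pi s.countable_toSet fun i _ => ht i (Set.mem_univ i)
      rw [happ C hCm, happ' C hCm, hcyl C hC]
    · rw [happ _ MeasurableSet.univ, happ' _ MeasurableSet.univ]
      simp
  have h5 := congrArg (fun ν : Measure (ℕ → ℝ) => ν A) key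
  rwa [Measure.map_apply (measurable_tailPath m) hA,
    Measure.restrict_apply (measurable_tailPath m hA), Set.inter_comm,
    Measure.bind_apply hA K.aemeasurable,
    lintegral_map (K.measurable_coe hA) (measurable_pi_apply m)] at h5

lemma map_tailPath (hμ : μ.bind κ = μ) (m : ℕ) : Q.map (tailPath m) = Q := by
  have := hQ.isProbabilityMeasure
  have h : ∀ m, ∀ A, MeasurableSet A → Q.map (tailPath m) A =
      ∫⁻ w, condDistrib id (fun y : ℕ → ℝ => y 0) Q w A ∂μ := by
    intro m A hA
    have h1 := hQ.measure_inter_tailPath hκ hμ m hA MeasurableSet.univ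
    rw [Measure.map_apply (measurable_tailPath m) hA, ← Set.univ_inter (_ ⁻¹' A), h1,
      setLIntegral_univ, ← hQ.map_eval hκ hμ m,
      lintegral_map (Kernel.measurable_coe _ hA) (measurable_pi_apply m)]
  have h0 : tailPath 0 = id := funext tailPath_zero
  refine Measure.ext fun A hA => ?_
  rw [h m A hA, ← h 0 A hA, h0, Measure.map_id]

theorem measurePreserving_shift (hμ : μ.bind κ = μ) : MeasurePreserving shift Q Q := by
  have h1 : shift = tailPath 1 := by
    funext x i
    simp [shift, tailPath, add_comm]
  rw [h1]
  exact ⟨measurable_tailPath 1, hQ.map_tailPath hκ hμ 1⟩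

/-- A shift-invariant event of a stationary chain is determined by the initial state. -/
theorem exists_preimage_ae_eq (hμ : μ.bind κ = μ) {A : Set (ℕ → ℝ)} (hA : MeasurableSet A)
    (hinv : shift ⁻¹' A = A) :
    ∃ S, MeasurableSet S ∧ ∀ m, (fun x : ℕ → ℝ => x m) ⁻¹' S =ᵐ[Q] A := by
  have := hQ.isProbabilityMeasure
  set K := condDistrib id (fun y : ℕ → ℝ => y 0) Q with hK
  have htail : ∀ m, tailPath m ⁻¹' A = A := fun m => Set.ext (tailPath_mem_iff hinv m)
  set g : ℝ → ℝ := fun w => (K w A).toReal with hg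
  have hgm : Measurable g := (K.measurable_coe hA).ennreal_toReal
  have hcond : ∀ m, Q⟦A | coordFiltration m⟧ =ᵐ[Q] fun x => g (x m) := fun m =>
    condExp_indicator_ae_eq (coordPast_le m) hA
      ((K.measurable_coe hA).comp (measurable_coordPast le_rfl)) (fun x => prob_le_one)
      fun D hD => by
        have h1 := hQ.measure_inter_tailPath hκ hμ m hA hD
        rwa [htail m] at h1
  set h : (ℕ → ℝ) → ℝ := fun x => g (x 0) - A.indicator (fun _ => (1 : ℝ)) x with hh
  have hhm : Measurable h := (hgm.comp (measurable_pi_apply 0)).sub (measurable_const.indicator hA)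
  -- By stationarity and invariance of `A`, the distance between `A` and its conditional probability
  -- at time `m` does not depend on `m`. Lévy's upward theorem sends it to zero, so it is zero
  -- already at time `0`.
  have hnorm : ∀ m, eLpNorm (Q⟦A | coordFiltration m⟧ - A.indicator fun _ => (1 : ℝ)) 1 Q =
      eLpNorm h 1 Q := by
    intro m
    conv_rhs => rw [← hQ.map_tailPath hκ hμ m]
    rw [eLpNorm_map_measure hhm.aestronglyMeasurable (measurable_tailPath m).aemeasurable]
    refine eLpNorm_congr_ae ?_
    filter_upwards [hcond m] with x hx
    have h2 : A.indicator (fun _ => (1 : ℝ)) (tailPath m x) = A.indicator (fun _ => (1 : ℝ)) x := by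
      by_cases hxA : x ∈ A
      · rw [Set.indicator_of_mem hxA, Set.indicator_of_mem ((tailPath_mem_iff hinv m x).2 hxA)]
      · rw [Set.indicator_of_notMem hxA,
          Set.indicator_of_notMem fun h' => hxA ((tailPath_mem_iff hinv m x).1 h')]
    simp only [Pi.sub_apply, hx, Function.comp_apply, hh, h2]
    simp [tailPath]
  have hsup : (⨆ n, coordFiltration n : MeasurableSpace (ℕ → ℝ)) = MeasurableSpace.pi := by
    refine le_antisymm (iSup_le fun n => coordPast_le n) (iSup_le fun i => ?_)
    exact (measurable_coordPast (le_refl i)).comap_le.trans (le_iSup coordPast i)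
  have hlim := Integrable.tendsto_eLpNorm_condExp (ℱ := coordFiltration)
    ((integrable_const (μ := Q) (1 : ℝ)).indicator hA)
    (by rw [hsup]; exact stronglyMeasurable_const.indicator hA)
  simp only [hnorm] at hlim
  have hzero : eLpNorm h 1 Q = 0 := tendsto_nhds_unique tendsto_const_nhds hlim
  rw [eLpNorm_eq_zero_iff hhm.aestronglyMeasurable one_ne_zero] at hzero
  have h0 : (fun x : ℕ → ℝ => x 0) ⁻¹' {w | g w = 1} =ᵐ[Q] A := by
    refine Filter.eventuallyEq_set.2 ?_
    filter_upwards [hzero] with x hx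
    simp only [hh, Pi.zero_apply, sub_eq_zero] at hx
    simp only [Set.mem_preimage, Set.mem_ofPred_eq, hx]
    by_cases hxA : x ∈ A <;> simp [hxA]
  refine ⟨{w | g w = 1}, measurableSet_eq_fun hgm measurable_const, fun m => ?_⟩
  have hmp : MeasurePreserving (tailPath m) Q Q :=
    ⟨measurable_tailPath m, hQ.map_tailPath hκ hμ m⟩
  have h3 := hmp.quasiMeasurePreserving.preimage_ae_eq h0
  rw [htail m] at h3
  exact h3

/-- The event `A` is at once `x 0 ∈ S` and `x 1 ∈ S` up to null sets, so one step of the chain on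
`A` carries the restricted law to itself. -/
lemma restrict_bind (hμ : μ.bind κ = μ) {A : Set (ℕ → ℝ)} {S : Set ℝ} (hS : MeasurableSet S)
    (hSA : ∀ m, (fun x : ℕ → ℝ => x m) ⁻¹' S =ᵐ[Q] A) :
    (μ.restrict S).bind κ = μ.restrict S := by
  have hmeas : ∀ m, Measurable fun x : ℕ → ℝ => x m := fun m => measurable_pi_apply m
  have h1 : ∀ m, μ.restrict S = (Q.restrict A).map fun x => x m := by
    intro m
    rw [← hQ.map_eval hκ hμ m, Measure.restrict_map (hmeas m) hS, Measure.restrict_congr_set (hSA m)]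
  have h2 := hQ.map_restrict_succ hκ 0 (measurable_coordPast (le_refl 0) hS)
  rw [Measure.restrict_congr_set (hSA 0), ← h1, ← h1] at h2
  exact h2.symm

end IsChainLaw

namespace IsTreeLaw

variable {d : ℕ} {α : ℝ} {F : Measure ℝ} (hF : IsTreeLaw d α F)
include hF

lemma treeKernel_univ_le (w : ℝ) : treeKernel α F w Set.univ ≤ 1 := by
  rw [hF.treeKernel_apply_apply, Set.inter_univ]
  exact ENNReal.inv_mul_le_one _

/-- An invariant event splits `μ` into two invariant pieces carried by disjoint sets. Were both
nonzero they would dominate a common nonzero measure, which is impossible. -/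
theorem ergodic_shift (hα : 0 < α) (hα1 : α < 1) (hd : 1 ≤ d) {μ : Measure ℝ}
    [IsFiniteMeasure μ] (hμ0 : μ (Set.Iic 0) = 0) (hμ : μ.bind (treeKernel α F) = μ)
    {Q : Measure (ℕ → ℝ)} (hQ : IsChainLaw (treeKernel α F) μ Q) : Ergodic shift Q where
  toMeasurePreserving := hQ.measurePreserving_shift hF.treeKernel_univ_le hμ
  aeconst_set := by
    intro A hA hinv
    have hκ := hF.treeKernel_univ_le
    obtain ⟨S, hS, hSA⟩ := hQ.exists_preimage_ae_eq hκ hμ hA hinv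
    have hSA' : ∀ m, (fun x : ℕ → ℝ => x m) ⁻¹' Sᶜ =ᵐ[Q] (Aᶜ : Set (ℕ → ℝ)) := fun m =>
      (hSA m).compl
    have hres : ∀ T : Set ℝ, μ.restrict T (Set.Iic 0) = 0 := fun T =>
      le_antisymm ((Measure.restrict_le_self _).trans hμ0.le) zero_le
    have hor : μ.restrict S = 0 ∨ μ.restrict Sᶜ = 0 := by
      by_contra! h
      obtain ⟨ρ, hρ, h1, h2⟩ := hF.exists_common_le hα hα1 hd (hres S) (hres Sᶜ) h.1 h.2
        (hQ.restrict_bind hκ hμ hS hSA).le (hQ.restrict_bind hκ hμ hS.compl hSA').le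
      refine hρ (Measure.measure_univ_eq_zero.1 ?_)
      rw [← Set.union_compl_self S]
      refine measure_union_null ?_ ?_
      · refine le_antisymm ((h2 S).trans ?_) zero_le
        rw [Measure.restrict_apply hS, Set.inter_compl_self, measure_empty]
      · refine le_antisymm ((h1 Sᶜ).trans ?_) zero_le
        rw [Measure.restrict_apply hS.compl, Set.compl_inter_self, measure_empty]
    have hmeas : ∀ T : Set ℝ, MeasurableSet T → μ.restrict T = 0 →
        Q ((fun x : ℕ → ℝ => x 0) ⁻¹' T) = 0 := by
      intro T hT h
      rw [← Measure.map_apply (measurable_pi_apply 0) hT, hQ.initial]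
      exact Measure.restrict_eq_zero.1 h
    refine Filter.eventuallyConst_set'.2 ?_
    rcases hor with h | h
    · left
      rw [ae_eq_empty, ← measure_congr (hSA 0)]
      exact hmeas S hS h
    · right
      rw [ae_eq_univ, ← measure_congr (hSA' 0)]
      exact hmeas Sᶜ hS.compl h

/-! ### Construction of the stationary chain. -/

/-- The kernel, modified off `(0, ∞)` to be a Markov kernel. -/
lemma exists_markov_kernel (hα : 0 < α) (hα1 : α < 1) (hd : 1 ≤ d) :
    ∃ η : Kernel ℝ ℝ, IsMarkovKernel η ∧ (∀ w, 0 < w → η w = treeKernel α F w) ∧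
      ∀ w, ∀ᵐ v ∂(η w), 0 < v := by
  classical
  refine ⟨Kernel.piecewise (s := Set.Ioi 0) measurableSet_Ioi (treeKernel α F)
    (Kernel.const ℝ (Measure.dirac 1)), ⟨fun w => ?_⟩, fun w hw => ?_, fun w => ?_⟩
  · rw [Kernel.piecewise_apply]
    split_ifs with hw
    · exact hF.isProbabilityMeasure_treeKernel hα hα1 hd hw
    · rw [Kernel.const_apply]
      infer_instance
  · rw [Kernel.piecewise_apply, if_pos (show w ∈ Set.Ioi 0 from hw)]
  · rw [Kernel.piecewise_apply]
    split_ifs with hw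
    · exact hF.treeKernel_pos w
    · rw [Kernel.const_apply, ae_dirac_iff measurableSet_Ioi]
      exact one_pos

/-- The Ionescu-Tulcea theorem needs a Markov kernel, whereas the tree kernel has mass zero off `(0,
∞)`. The trajectories of the modified kernel stay positive almost surely, so they never see the
modification. -/
theorem exists_chainLaw (hα : 0 < α) (hα1 : α < 1) (hd : 1 ≤ d) {μ : Measure ℝ}
    [IsProbabilityMeasure μ] (hμ : ∀ᵐ w ∂μ, 0 < w) :
    ∃ Q : Measure (ℕ → ℝ), IsChainLaw (treeKernel α F) μ Q := by
  obtain ⟨η, hη, hηF, hηpos⟩ := hF.exists_markov_kernel hα hα1 hd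
  let κ : (n : ℕ) → Kernel ((i : Finset.Iic n) → ℝ) ℝ := fun n =>
    η.comap (fun x => x ⟨n, Finset.mem_Iic.2 le_rfl⟩) (measurable_pi_apply _)
  let Q : Measure (ℕ → ℝ) := Kernel.trajMeasure (X := fun _ => ℝ) μ κ
  have hQprob : IsProbabilityMeasure Q := by
    simp only [Q]
    infer_instance
  have hmeas : ∀ m, Measurable fun x : ℕ → ℝ => x m := fun m => measurable_pi_apply m
  have hpast : ∀ n, coordPast n ≤
      MeasurableSpace.comap (Preorder.frestrictLe (π := fun _ : ℕ => ℝ) n) inferInstance := by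
    intro n
    refine iSup₂_le fun k hk => ?_
    rintro _ ⟨S, hS, rfl⟩
    exact ⟨(fun x => x ⟨k, Finset.mem_Iic.2 hk⟩) ⁻¹' S, measurable_pi_apply _ hS, rfl⟩
  have hinit : Q.map (fun x => x 0) = μ := by
    have h1 : (fun x : ℕ → ℝ => x 0) =
        (fun y : (i : Finset.Iic 0) → ℝ => y ⟨0, Finset.mem_Iic.2 le_rfl⟩) ∘
          Preorder.frestrictLe (π := fun _ : ℕ => ℝ) 0 := rfl
    have h2 : Measurable fun y : (i : Finset.Iic 0) → ℝ => y ⟨0, Finset.mem_Iic.2 le_rfl⟩ :=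
      measurable_pi_apply _
    rw [h1, ← Measure.map_map h2 (Preorder.measurable_frestrictLe 0)]
    simp only [Q, Kernel.trajMeasure]
    rw [Measure.map_comp _ _ (Preorder.measurable_frestrictLe 0), Kernel.traj_map_frestrictLe,
      Kernel.partialTraj_self, Measure.id_comp,
      Measure.map_map h2 (MeasurableEquiv.measurable _)]
    exact Measure.map_id
  have hstep : ∀ n, ∀ B, MeasurableSet B → ∀ D, MeasurableSet[coordPast n] D →
      Q (D ∩ (fun x => x (n + 1)) ⁻¹' B) = ∫⁻ x in D, η (x n) B ∂Q := by
    intro n B hB D hD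
    obtain ⟨S, hS, rfl⟩ := hpast n D hD
    have h1 := Kernel.map_frestrictLe_trajMeasure_compProd_eq_map_trajMeasure
      (X := fun _ => ℝ) (μ₀ := μ) (κ := κ) (a := n)
    have h2 := congrArg (fun ν => ν (S ×ˢ B)) h1
    rw [Measure.compProd_apply_prod hS hB, Measure.map_apply
      ((Preorder.measurable_frestrictLe n).prodMk (measurable_pi_apply _)) (hS.prod hB),
      setLIntegral_map hS (Kernel.measurable_coe _ hB) (Preorder.measurable_frestrictLe n)] at h2
    exact h2.symm
  have hpos : ∀ n, ∀ᵐ x ∂Q, 0 < x n := by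
    intro n
    cases n with
    | zero => exact ae_of_ae_map (hmeas 0).aemeasurable (hinit.symm ▸ hμ)
    | succ n =>
      have h1 := hstep n (Set.Ioi 0)ᶜ measurableSet_Ioi.compl Set.univ MeasurableSet.univ
      have h2 : ∀ w, η w (Set.Ioi 0)ᶜ = 0 := fun w => ae_iff.1 (hηpos w)
      simp only [h2, lintegral_zero, Set.univ_inter] at h1
      exact ae_iff.2 h1
  refine ⟨Q, hQprob, hinit, ⟨monotone_coordPast, coordPast_le,
    fun n => measurable_coordPast le_rfl, fun n B hB => ?_⟩⟩
  have h1 := condExp_indicator_ae_eq (P := Q) (coordPast_le n) (hmeas (n + 1) hB)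
    ((η.measurable_coe hB).comp (measurable_coordPast (le_refl n))) (fun x => prob_le_one)
    (fun D hD => hstep n B hB D hD)
  refine h1.trans ?_
  filter_upwards [hpos n] with x hx
  simp only [Function.comp_apply, hηF _ hx]
  rfl

end IsTreeLaw

end TreeDLA
end

/-! ### The theorem. -/

theorem theorem5p2 (d : ℕ) (hd : 1 ≤ d) (α : ℝ) (hα0 : 0 < α) (hα1 : α < 1) :
    ∃ π : ProbabilityMeasure ℝ, (π : Measure ℝ) (Set.Iic 0) = 0 ∧
      -- the tails of `π`, with constants depending only on `d`, `α` (and `p`)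
      (∀ p : ℝ, 0 < p → ∃ c : ℝ, 0 < c ∧ ∀ w : ℝ, 0 ≤ w →
        (π : Measure ℝ).real (Set.Ioc 0 w) ≤ c * w ^ p) ∧
      (∃ c : ℝ, 0 < c ∧ ∀ w : ℝ, 0 ≤ w →
        (π : Measure ℝ).real (Set.Ici w) ≤ c * Real.exp (-(d * w))) ∧
      ∀ {Ω : Type*} [MeasurableSpace Ω] (P : Measure Ω) [IsProbabilityMeasure P]
        (U : Vertex d → Ω → ℝ), IsExpEnvironment U P →
        -- the backbone exists and the backbone times are finite and positive
        (∀ᵐ ω ∂P, (∃! ξ : ℕ → Vertex d, IsLineOfDescent α (fun x => U x ω) ξ) ∧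
          ∀ n, 0 < W α U n ω) ∧
        -- the Markov property and stochastic monotonicity
        IsMarkovChain P (backbonePast α U) (W α U) (backboneKernel α U P) ∧
        (∀ n, StochLE (P.map (W α U (n + 1))) (P.map (W α U n))) ∧
        -- convergence to the stationary law
        TendstoInDistribution (W α U) atTop id (fun _ => P) (π : Measure ℝ) ∧
        (backboneKernel α U P).Invariant (π : Measure ℝ) ∧
        -- uniqueness of the stationary law
        (∀ π' : ProbabilityMeasure ℝ, (π' : Measure ℝ) (Set.Iic 0) = 0 →
          (backboneKernel α U P).Invariant (π' : Measure ℝ) → π' = π) ∧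
        -- the stationary chain exists and is ergodic
        (∃ Q : Measure (ℕ → ℝ), IsChainLaw (backboneKernel α U P) (π : Measure ℝ) Q) ∧
        (∀ Q : Measure (ℕ → ℝ), IsChainLaw (backboneKernel α U P) (π : Measure ℝ) Q →
          Ergodic shift Q) := by
  -- The law of `W_0` is taken on the canonical space of weights, so `π` and the constants are fixed
  -- by `d`, `α` and `p` before any probability space is given.
  have hF := isTreeLaw_rootLaw (d := d) hα0 hα1 hd
  have hπ := hF.isProbabilityMeasure_limitLaw hα0 hα1 hd
  have hπ0 := hF.limitLaw_Iic_zero hα0 hα1 hd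
  have hinv := hF.limitLaw_bind hα0 hα1 hd
  obtain ⟨c, hc, hexp⟩ := hF.exists_limitLaw_Ici_le hα0 hα1 hd
  have hIoc : ∀ p : ℝ, 0 < p → ∃ c : ℝ, 0 < c ∧ ∀ w : ℝ, 0 ≤ w →
      (limitLaw α (rootLaw d α)).real (Set.Ioc 0 w) ≤ c * w ^ p :=
    fun _ hp => hF.exists_limitLaw_Ioc_le hα0 hα1 hd hp
  have hpos := hF.limitLaw_ae_pos hα0 hα1 hd
  have hlim := fun f : BoundedContinuousFunction ℝ ℝ =>
    hF.tendsto_integral_stepLaw hα0 hα1 hd f.continuous.measurable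
      (fun w _ => f.continuous.continuousAt) f.norm_coe_le_norm
  obtain ⟨π, hπdef⟩ : ∃ π : ProbabilityMeasure ℝ, (π : Measure ℝ) = limitLaw α (rootLaw d α) :=
    ⟨⟨_, hπ⟩, rfl⟩
  rw [← hπdef] at hπ0 hinv hpos
  simp only [← hπdef] at hexp hIoc hlim
  refine ⟨π, hπ0, hIoc, ⟨c, hc, fun w _ => hexp w⟩, ?_⟩
  intro Ω _ P _ U hU
  have hκ := hU.backboneKernel_eq hα0
  refine ⟨hU.ae_backbone hα0 hα1 hd, hU.isMarkovChain hα0 hα1 hd, fun n => ?_, ?_, ?_, ?_, ?_, ?_⟩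
  · rw [hU.map_W hα0 hα1 hd, hU.map_W hα0 hα1 hd]
    exact hF.stochLE_stepLaw hα0 hα1 hd n
  · refine ⟨fun n => (measurable_W hα0 hU.measurable n).aemeasurable, aemeasurable_id, ?_⟩
    refine ProbabilityMeasure.tendsto_iff_forall_integral_tendsto.2 fun f => ?_
    change Tendsto (fun n => ∫ w, f w ∂(P.map (W α U n))) atTop
      (𝓝 (∫ w, f w ∂((π : Measure ℝ).map id)))
    simp only [Measure.map_id, hU.map_W hα0 hα1 hd]
    exact hlim f
  · rw [hκ]
    exact hinv
  · intro π' hπ'0 hπ'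
    rw [hκ] at hπ'
    exact ProbabilityMeasure.toMeasure_injective (hF.eq_of_invariant hα0 hα1 hd hπ'0 hπ0 hπ' hinv)
  · rw [hκ]
    exact hF.exists_chainLaw hα0 hα1 hd hpos
  · intro Q hQ
    rw [hκ] at hQ
    exact hF.ergodic_shift hα0 hα1 hd hπ0 hinv hQ
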